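/- Let $d\in\mathbb N$. There is a hybrid quantum-classical algorithm without QRAM (one program and one constant, depending only on $d$) such that the following holds for all integers $n\ge 3$, $1\le k\le n$, $0\le b\le d\lceil\log_2 n\rceil$, all real $\varepsilon\in(0,1)$, and every array $a[1],\dots,a[n]$ of elements of a totally ordered set $A$ whose elements are stored, in an order-preserving way, as unsigned $b$-bit integers (so each takes $O(1)$ words). Given $n$, $k$, $b$, the binary digits of $\varepsilon$, and the quantum oracle $\mathcal O_a|i,j,z\rangle=|i,j\oplus a[i],z\rangle$, the algorithm always halts, and with probability at least $1-\varepsilon$ it outputs $(i_1,\dots,i_k)$, where $i_1,\dots,i_k$ are the indices of the $k$ smallest elements of $a$ in increasing order (ties are broken in favour of the smaller index). In every execution its query complexity is $$O\left(\sqrt{nk\log\left(\frac{k\log n}{\varepsilon}\right)}\right)$$ and its time complexity is $$O\left(\sqrt{nk\log\left(\frac{k\log n}{\varepsilon}\right)}\,\log n\right),$$ and it uses only $O(\log n)$ qubits; here $\log$ is the natural logarithm and the implied constants depend only on $d$. The computational model is as follows. A classical word RAM with words of $\Theta(\log n)$ bits repeatedly writes down a quantum circuit, composed of one- and two-qubit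 gates (gates with parameters are described by closed-form expressions in the contents of registers) and of applications of $\mathcal O_a$; the circuit is run on $|0\cdots0\rangle$, all qubits are measured in the computational basis, and the outcome is handed to the word RAM. Memory can be addressed only classically, and no quantum state persists between two circuits. The query complexity is the total number of applications of $\mathcal O_a$; the time complexity is the sum of the query complexity, the number of one- and two-qubit gates and one-qubit measurements, and the number of word RAM steps. -/

import Mathlib

namespace HybridRAM

noncomputable section

/-! ## Quantum circuits on `S` qubits with an oracle -/

/-- The data that an execution can access from outside: the oracle for the array, acting on an
index register of `idxBits` qubits and a value register of `valBits` qubits, and a read-only tape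
with the binary digits of the error parameter `eps`. -/
structure Env where
  idxBits : ℕ
  valBits : ℕ
  /-- `table i` is the (encoded) `i`-th entry of the array -/
  table : ℕ → ℕ
  eps : ℝ

/-- Computational basis states of `S` qubits. -/
abbrev Basis (S : ℕ) := Fin S → Bool

/-- Elements of a quantum circuit. All one-qubit gates (up to an irrelevant global phase, through
Euler angles), the controlled NOT gate, and the oracle. Every two-qubit gate is a product of
boundedly many of these one- and two-qubit gates. -/
inductive Op (S : ℕ) where
  | u3 (θ φ lam : ℝ) (q : Fin S)
  | cnot (control target : Fin S)
  | query

/-- The circuit made of a list of elements, the LAST one applied first (so that a new element is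
appended to a circuit by `::`). -/
abbrev Circuit (S : ℕ) := List (Op S)

def Op.isQuery {S : ℕ} : Op S → Bool
  | .query => true
  | _ => false

/-- Number of queries of a circuit. -/
def Circuit.queries {S : ℕ} (c : Circuit S) : ℕ := c.countP (fun g => g.isQuery)

/-- Number of one- and two-qubit gates of a circuit. -/
def Circuit.gates {S : ℕ} (c : Circuit S) : ℕ := c.countP (fun g => !g.isQuery)

/-- Entries of the one-qubit gate
`[[cos(θ/2), -e^{iλ} sin(θ/2)], [e^{iφ} sin(θ/2), e^{i(φ+λ)} cos(θ/2)]]`. -/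
def u3Entry (θ φ lam : ℝ) : Bool → Bool → ℂ
  | false, false => Real.cos (θ / 2)
  | false, true => -(Complex.exp (lam * Complex.I) * Real.sin (θ / 2))
  | true, false => Complex.exp (φ * Complex.I) * Real.sin (θ / 2)
  | true, true => Complex.exp ((φ + lam : ℝ) * Complex.I) * Real.cos (θ / 2)

/-- The action of the controlled NOT gate on basis states (nothing happens if the two qubits
coincide). -/
def cnotMap {S : ℕ} (c t : Fin S) (x : Basis S) : Basis S :=
  if c = t then x else Function.update x t (xor (x t) (x c))

/-- The content of the index register (qubits `0, …, ℓ - 1`, least significant bit first). -/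
def indexOf {S : ℕ} (ℓ : ℕ) (x : Basis S) : ℕ :=
  ∑ p : Fin S, if (p : ℕ) < ℓ ∧ x p = true then 2 ^ (p : ℕ) else 0

/-- The oracle `|i, j, z⟩ ↦ |i, j ⊕ a[i], z⟩` on basis states: `i` is held by the first `idxBits`
qubits, `j` by the following `valBits` qubits, and `z` by the remaining ones. -/
def queryMap (E : Env) {S : ℕ} (x : Basis S) : Basis S := fun p =>
  xor (x p) (decide (E.idxBits ≤ (p : ℕ) ∧ (p : ℕ) < E.idxBits + E.valBits) &&
    (E.table (indexOf E.idxBits x)).testBit ((p : ℕ) - E.idxBits))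

/-- The action of a circuit element on a vector of amplitudes. -/
def Op.apply (E : Env) {S : ℕ} : Op S → (Basis S → ℂ) → (Basis S → ℂ)
  | .u3 θ φ lam q, ψ => fun x =>
      u3Entry θ φ lam (x q) false * ψ (Function.update x q false) +
      u3Entry θ φ lam (x q) true * ψ (Function.update x q true)
  | .cnot c t, ψ => fun x => ψ (cnotMap c t x)
  | .query, ψ => fun x => ψ (queryMap E x)

/-- The vector of amplitudes obtained from `|0…0⟩`. -/
def Circuit.amplitudes (E : Env) {S : ℕ} (c : Circuit S) : Basis S → ℂ :=
  c.foldr (fun g ψ => g.apply E ψ) (Pi.single (fun _ => false) 1)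

theorem cnotMap_involutive {S : ℕ} (c t : Fin S) : Function.Involutive (cnotMap c t) := by
  intro x
  unfold cnotMap
  by_cases h : c = t
  · simp [h]
  · simp only [h, if_false]
    funext p
    by_cases hp : p = t
    · subst hp
      simp [Function.update_of_ne h]
    · simp [Function.update_of_ne hp]

theorem indexOf_queryMap (E : Env) {S : ℕ} (x : Basis S) :
    indexOf E.idxBits (queryMap E x) = indexOf E.idxBits x := by
  unfold indexOf
  refine Finset.sum_congr rfl fun p _ => ?_
  by_cases hp : (p : ℕ) < E.idxBits
  · have : ¬ (E.idxBits ≤ (p : ℕ) ∧ (p : ℕ) < E.idxBits + E.valBits) := by omega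
    have hq : queryMap E x p = x p := by simp only [queryMap, this]; simp
    rw [hq]
  · simp [hp]

theorem queryMap_involutive (E : Env) {S : ℕ} :
    Function.Involutive (queryMap E : Basis S → Basis S) := by
  intro x
  funext p
  have h : queryMap E (queryMap E x) p = xor (queryMap E x p)
    (decide (E.idxBits ≤ (p : ℕ) ∧ (p : ℕ) < E.idxBits + E.valBits) &&
      (E.table (indexOf E.idxBits (queryMap E x))).testBit ((p : ℕ) - E.idxBits)) := rfl
  rw [h, indexOf_queryMap]
  simp [queryMap]

theorem u3_pair (θ φ lam : ℝ) (u v : ℂ) :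
    ‖u3Entry θ φ lam false false * u + u3Entry θ φ lam false true * v‖ ^ 2 +
      ‖u3Entry θ φ lam true false * u + u3Entry θ φ lam true true * v‖ ^ 2 =
    ‖u‖ ^ 2 + ‖v‖ ^ 2 := by
  have hsc := Real.sin_sq_add_cos_sq (θ / 2)
  have h1 := Real.sin_sq_add_cos_sq φ
  have h2 := Real.sin_sq_add_cos_sq lam
  simp only [u3Entry, Complex.sq_norm, Complex.normSq_apply]
  rw [Complex.ofReal_add, add_mul, Complex.exp_add]
  simp only [Complex.exp_mul_I, ← Complex.ofReal_cos, ← Complex.ofReal_sin, Complex.add_re,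
    Complex.add_im, Complex.mul_re, Complex.mul_im, Complex.neg_re, Complex.neg_im,
    Complex.ofReal_re, Complex.ofReal_im, Complex.I_re, Complex.I_im]
  generalize Real.cos (θ / 2) = c at *
  generalize Real.sin (θ / 2) = s at *
  generalize Real.cos φ = c1 at *
  generalize Real.sin φ = s1 at *
  generalize Real.cos lam = c2 at *
  generalize Real.sin lam = s2 at *
  have hs : s ^ 2 = 1 - c ^ 2 := by linarith
  have hs1 : s1 ^ 2 = 1 - c1 ^ 2 := by linarith
  have hs2 : s2 ^ 2 = 1 - c2 ^ 2 := by linarith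
  grind

theorem Op.sum_norm_apply (E : Env) {S : ℕ} (g : Op S) (ψ : Basis S → ℂ) :
    ∑ x, ‖g.apply E ψ x‖ ^ 2 = ∑ x, ‖ψ x‖ ^ 2 := by
  cases g with
  | cnot c t =>
    exact Equiv.sum_comp (cnotMap_involutive c t).toPerm (fun x => ‖ψ x‖ ^ 2)
  | query =>
    exact Equiv.sum_comp (queryMap_involutive E).toPerm (fun x => ‖ψ x‖ ^ 2)
  | u3 θ φ lam q =>
    have hinv : Function.Involutive
        (fun x : Basis S => Function.update x q (!(x q))) := by
      intro x
      simp
    have key : ∀ f : Basis S → ℝ,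
        ∑ x, f (Function.update x q (!(x q))) = ∑ x, f x := fun f =>
      Equiv.sum_comp hinv.toPerm f
    have hpair : ∀ x : Basis S,
        ‖(Op.u3 θ φ lam q).apply E ψ x‖ ^ 2 +
          ‖(Op.u3 θ φ lam q).apply E ψ (Function.update x q (!(x q)))‖ ^ 2 =
        ‖ψ x‖ ^ 2 + ‖ψ (Function.update x q (!(x q)))‖ ^ 2 := by
      intro x
      have hx : Function.update x q (x q) = x := Function.update_eq_self q x
      have := u3_pair θ φ lam (ψ (Function.update x q false)) (ψ (Function.update x q true))
      cases hq : x q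
      · rw [hq] at hx
        simpa [Op.apply, hq, hx] using this
      · rw [hq] at hx
        rw [add_comm, add_comm (‖ψ x‖ ^ 2)]
        simpa [Op.apply, hq, hx] using this
    have hsum := Finset.sum_congr (rfl : (Finset.univ : Finset (Basis S)) = Finset.univ)
      (fun x _ => hpair x)
    rw [Finset.sum_add_distrib, Finset.sum_add_distrib,
      key (fun x => ‖(Op.u3 θ φ lam q).apply E ψ x‖ ^ 2), key (fun x => ‖ψ x‖ ^ 2)] at hsum
    linarith

theorem Circuit.sum_norm_amplitudes (E : Env) {S : ℕ} (c : Circuit S) :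
    ∑ x, ‖c.amplitudes E x‖ ^ 2 = 1 := by
  induction c with
  | nil =>
    rw [Finset.sum_eq_single (fun _ => false)]
    · simp [Circuit.amplitudes]
    · intro x _ hx
      simp [Circuit.amplitudes, Pi.single_eq_of_ne hx]
    · simp
  | cons g c ih => exact (Op.sum_norm_apply E g _).trans ih

/-- Born rule: the distribution of the outcome when all qubits are measured in the computational
basis after the circuit was applied to `|0…0⟩`. -/
def Circuit.measure (E : Env) {S : ℕ} (c : Circuit S) : PMF (Basis S) :=
  PMF.ofFintype (fun x => ENNReal.ofReal (‖c.amplitudes E x‖ ^ 2)) (by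
    rw [← ENNReal.ofReal_sum_of_nonneg (fun _ _ => by positivity), c.sum_norm_amplitudes E,
      ENNReal.ofReal_one])

/-! ## The classical control: a word RAM that writes down circuits and has them run -/

/-- Word operations. -/
inductive BinOp where
  | add | sub | mul | div | mod | and | or | xor | shl | shr | lt | eq

/-- Arithmetic is unsigned and modulo `2 ^ w`; comparisons return `0` or `1`. -/
def BinOp.eval {w : ℕ} : BinOp → BitVec w → BitVec w → BitVec w
  | .add, a, b => a + b
  | .sub, a, b => a - b
  | .mul, a, b => a * b
  | .div, a, b => a / b
  | .mod, a, b => a % b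
  | .and, a, b => a &&& b
  | .or, a, b => a ||| b
  | .xor, a, b => a ^^^ b
  | .shl, a, b => a <<< b
  | .shr, a, b => a >>> b
  | .lt, a, b => if a < b then 1 else 0
  | .eq, a, b => if a = b then 1 else 0

/-- Closed-form expressions in register contents; they are the classical descriptions of the
angles of one-qubit gates. -/
inductive Angle where
  | reg (r : ℕ)
  | lit (m : ℕ)
  | pi
  | add (a b : Angle)
  | sub (a b : Angle)
  | mul (a b : Angle)
  | div (a b : Angle)
  | sqrt (a : Angle)
  | sin (a : Angle)
  | cos (a : Angle)
  | arcsin (a : Angle)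

def Angle.eval {w : ℕ} (reg : ℕ → BitVec w) : Angle → ℝ
  | .reg r => ((reg r).toNat : ℝ)
  | .lit m => (m : ℝ)
  | .pi => Real.pi
  | .add a b => a.eval reg + b.eval reg
  | .sub a b => a.eval reg - b.eval reg
  | .mul a b => a.eval reg * b.eval reg
  | .div a b => a.eval reg / b.eval reg
  | .sqrt a => Real.sqrt (a.eval reg)
  | .sin a => Real.sin (a.eval reg)
  | .cos a => Real.cos (a.eval reg)
  | .arcsin a => Real.arcsin (a.eval reg)

/-- Length of the expression. -/
def Angle.size : Angle → ℕ
  | .reg _ => 1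
  | .lit _ => 1
  | .pi => 1
  | .add a b => a.size + b.size + 1
  | .sub a b => a.size + b.size + 1
  | .mul a b => a.size + b.size + 1
  | .div a b => a.size + b.size + 1
  | .sqrt a => a.size + 1
  | .sin a => a.size + 1
  | .cos a => a.size + 1
  | .arcsin a => a.size + 1

/-- Elementary instructions; `r`, `s`, `t` are names of registers. -/
inductive Instr where
  /-- `r := m` -/
  | const (r m : ℕ)
  /-- `r := s ∘ t` -/
  | bin (o : BinOp) (r s t : ℕ)
  /-- `r := mem[s]` -/
  | load (r s : ℕ)
  /-- `mem[r] := s` -/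
  | store (r s : ℕ)
  /-- `r := ` the binary digit of `eps` at position `s` (position `0` is the digit of `1/2`) -/
  | readEps (r s : ℕ)
  /-- `r := ` the bit with number `s` of the last measurement outcome -/
  | readOut (r s : ℕ)
  /-- append a one-qubit gate on the qubit whose number is in `s` to the circuit description -/
  | gate (θ φ lam : Angle) (s : ℕ)
  /-- append a controlled NOT gate, control in `s`, target in `t` -/
  | cnot (s t : ℕ)
  /-- append a query -/
  | query
  /-- run the described circuit on `|0…0⟩`, measure all qubits, start a new description -/
  | run

/-- Structured programs; conditions test whether a register is non-zero. -/
inductive Program where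
  | instr (i : Instr)
  | seq (P Q : Program)
  | ite (r : ℕ) (P Q : Program)
  | loop (r : ℕ) (P : Program)

/-- States of a machine with words of `w` bits and `S` qubits. No quantum data persist between two
circuits and no quantum operation can address the memory `mem`. -/
structure State (w S : ℕ) where
  reg : ℕ → BitVec w
  mem : BitVec w → BitVec w
  /-- the circuit described so far -/
  circ : Circuit S
  /-- the last measurement outcome -/
  out : Basis S
  /-- number of word RAM steps so far -/
  steps : ℕ
  /-- number of gates and one-qubit measurements so far -/
  gates : ℕ
  /-- number of queries so far -/
  queries : ℕ

namespace State

variable {w S : ℕ}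

/-- Time is the sum of the query complexity, the gate complexity and the word RAM time. -/
def time (s : State w S) : ℕ := s.queries + s.gates + s.steps

def tick (m : ℕ) (s : State w S) : State w S := { s with steps := s.steps + m }

def setReg (r : ℕ) (v : BitVec w) (s : State w S) : State w S :=
  { s with reg := Function.update s.reg r v }

/-- Qubit number named by a word, if there is such a qubit. -/
def qubit (v : BitVec w) : Option (Fin S) :=
  if h : v.toNat < S then some ⟨v.toNat, h⟩ else none

def push (g : Op S) (s : State w S) : State w S := { s with circ := g :: s.circ }

end State

/-- The binary digit of weight `2 ^ -(i + 1)` of `ε ∈ [0, 1)`. -/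
def epsDigit (ε : ℝ) (i : ℕ) : ℕ := ⌊ε * 2 ^ (i + 1)⌋₊ % 2

/-- Semantics of the instructions. A gate on a non-existing qubit is ignored. -/
def Instr.exec (E : Env) {w S : ℕ} : Instr → State w S → PMF (State w S)
  | .const r m, s => PMF.pure ((s.setReg r (BitVec.ofNat w m)).tick 1)
  | .bin o r a b, s => PMF.pure ((s.setReg r (o.eval (s.reg a) (s.reg b))).tick 1)
  | .load r a, s => PMF.pure ((s.setReg r (s.mem (s.reg a))).tick 1)
  | .store r a, s =>
      PMF.pure (({ s with mem := Function.update s.mem (s.reg r) (s.reg a) }).tick 1)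
  | .readEps r a, s =>
      PMF.pure ((s.setReg r (BitVec.ofNat w (epsDigit E.eps (s.reg a).toNat))).tick 1)
  | .readOut r a, s =>
      PMF.pure ((s.setReg r (match (State.qubit (s.reg a) : Option (Fin S)) with
        | some q => if s.out q then 1 else 0
        | none => 0)).tick 1)
  | .gate θ φ lam a, s =>
      PMF.pure ((match (State.qubit (s.reg a) : Option (Fin S)) with
        | some q => s.push (.u3 (θ.eval s.reg) (φ.eval s.reg) (lam.eval s.reg) q)
        | none => s).tick (θ.size + φ.size + lam.size + 1))
  | .cnot a b, s =>
      PMF.pure ((match (State.qubit (s.reg a) : Option (Fin S)),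
          (State.qubit (s.reg b) : Option (Fin S)) with
        | some c, some t => s.push (.cnot c t)
        | _, _ => s).tick 1)
  | .query, s => PMF.pure ((s.push .query).tick 1)
  | .run, s => (s.circ.measure E).map fun x =>
      ({ s with
          circ := []
          out := x
          gates := s.gates + s.circ.gates + S
          queries := s.queries + s.circ.queries } : State w S).tick 1

/-- Sequential composition for computations that may run out of fuel (`none`). -/
def andThen {α : Type} (p : PMF (Option α)) (f : α → PMF (Option α)) : PMF (Option α) :=
  p.bind fun o => match o with
    | none => PMF.pure none
    | some s => f s

/-- A while loop with at most `fuel` tests of its condition. -/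
def loopExec {w S : ℕ} (r : ℕ) (body : State w S → PMF (Option (State w S))) :
    ℕ → State w S → PMF (Option (State w S))
  | 0, _ => PMF.pure none
  | fuel + 1, s =>
      if s.reg r ≠ 0 then andThen (body (s.tick 1)) (loopExec r body fuel)
      else PMF.pure (some (s.tick 1))

/-- The distribution of the final state, where `none` means that the execution of some loop did
not end within `fuel` tests. If `none` has probability `0`, the program halts on every branch and
the distribution is the same for all larger values of `fuel`. -/
def Program.exec (E : Env) {w S : ℕ} (fuel : ℕ) :
    Program → State w S → PMF (Option (State w S))
  | .instr i, s => (i.exec E s).map some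
  | .seq P Q, s => andThen (P.exec E fuel s) (fun s' => Q.exec E fuel s')
  | .ite r P Q, s =>
      if s.reg r ≠ 0 then P.exec E fuel (s.tick 1) else Q.exec E fuel (s.tick 1)
  | .loop r P, s => loopExec r (fun s' => P.exec E fuel s') fuel s

/-! ## Finding the `k` smallest elements -/

/-- Initial state: `n`, `k` and the number `b` of bits of an array element are in the registers
`0`, `1` and `2`; everything else is `0`. -/
def initState (w S n k b : ℕ) : State w S where
  reg := fun r =>
    if r = 0 then BitVec.ofNat w n else if r = 1 then BitVec.ofNat w k
    else if r = 2 then BitVec.ofNat w b else 0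
  mem := fun _ => 0
  circ := []
  out := fun _ => false
  steps := 0
  gates := 0
  queries := 0

/-- The oracle for an array of `n` elements, the element `x` being stored as the `b`-bit number
`enc x`. The index register has `⌈log₂ n⌉` qubits; the oracle does nothing for indices `≥ n`. -/
def arrayEnv {A : Type*} {n b : ℕ} (a : Fin n → A) (enc : A → Fin (2 ^ b)) (ε : ℝ) : Env where
  idxBits := Nat.clog 2 n
  valBits := b
  table := fun i => if h : i < n then (enc (a ⟨i, h⟩) : ℕ) else 0
  eps := ε

/-- `i 0, …, i (k - 1)` are the indices of the `k` smallest elements of `a` in increasing order,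
ties being broken in favour of the smaller index. -/
def IsKMin {A : Type*} [LinearOrder A] {n k : ℕ} (a : Fin n → A) (i : Fin k → Fin n) : Prop :=
  (StrictMono fun j => toLex (a (i j), i j)) ∧
    ∀ m : Fin n, (∀ j, i j ≠ m) → ∀ j, toLex (a (i j), i j) < toLex (a m, m)

/-- The final state holds such indices in the memory cells `0, …, k - 1`. -/
def State.Correct {w S : ℕ} {A : Type*} [LinearOrder A] {n : ℕ} (a : Fin n → A) (k : ℕ)
    (s : State w S) : Prop :=
  ∃ i : Fin k → Fin n, IsKMin a i ∧ ∀ j : Fin k, (s.mem (BitVec.ofNat w j)).toNat = (i j : ℕ)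

end

end HybridRAM

/-! ### A program logic for probabilistic word RAM programs -/

namespace HybridRAM

noncomputable section

open scoped ENNReal

/-! ## Expectations -/

/-! Let l = ⌈log₂ n⌉. The index range, padded to length 2^l, is cut into 2^κ blocks of length N =
2^ν, where k/2 ≤ 2^κ ≤ k. An element is represented by its key 2^l a[i] + i, which makes keys
distinct and breaks ties by the index. A tournament tree in classical memory has one leaf per block,
holding the smallest key of the block that was not output yet. Filling the leaves and replacing one
leaf after each of the k outputs requires 2^κ + k ≤ 2k block minima. Since N = O(n/k), it is enough
to compute a block minimum with O(√(NΛ)) queries and failure probability O(ε/k), where Λ = O(log(k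
log n/ε)). A search in a block receives only the block number and two classical thresholds z and y,
and marks the keys in [z, y), so memory is never addressed in superposition.

For one block, let y be the best key so far and let its rank be the number of keys of the block in
[z, y). Amplitude amplification with an additional rotated qubit is tuned to an expected number T of
marked elements. If the rank is T, a marked element is found with certainty (`gAmp_exact`). If the
rank lies between T/2 and T, one is found with probability at least 1/2, uniformly among the marked
ones (`gAmp_half`), so with probability at least 1/4 the new rank is at most T/2 (`card_low`,
`spec_search_half`).

The halving phase takes T = N, N/2, N/4, … until T ≤ t₀ = min Λ N, with r = 3Λ searches for each T;
each halving fails with probability at most (3/4)^r ≤ 2^(-Λ) (`spec_halvingP`). The countdown phase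
then makes one search for each T = t₀, t₀ - 1, …, 1. It never fails: if the rank equals T it drops
by certainty, and if it is smaller there is nothing to do (`spec_countdownP`). The first phase costs
r times a geometric sum of √(N/T), of order Λ √(N/Λ), and the second costs ∑ √(N/T) = O(√(N t₀));
both are O(√(NΛ)) (`sum_cost_le`). The schedule does not depend on outcomes, so the bounds hold in
every execution. A union bound over 2k minima with at most l halvings each explains Λ: it is the
number of leading zero digits of ε plus κ plus ⌈log₂ l⌉ plus a constant (`failure_le`, `budget_le`).

After a query, index and value qubits read together are the key in binary, and a ladder of Toffoli
gates compares it with a classical threshold. An iteration thus takes O(log n) gates and O(log n)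
qubits, which is the extra factor log n of the time. That an output affects only the leaf of its own
block is `Good.next`.

Programs are verified with `Det` for deterministic pieces and `Spec` for randomised ones, where
running out of fuel has infinite cost. A single `Spec` of the whole program gives the resource
bounds on every branch (`Spec.support`) and the success probability (`Spec.prob`). -/

/-- The expectation of a non-negative function. -/
def expect {α : Type*} (p : PMF α) (g : α → ℝ≥0∞) : ℝ≥0∞ := ∑' a, p a * g a

theorem expect_pure {α : Type*} (a : α) (g : α → ℝ≥0∞) : expect (PMF.pure a) g = g a := by
  classical
  unfold expect
  rw [tsum_eq_single a]
  · simp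
  · intro b hb
    simp [PMF.pure_apply, hb]

theorem expect_bind {α β : Type*} (p : PMF α) (f : α → PMF β) (g : β → ℝ≥0∞) :
    expect (p.bind f) g = expect p (fun a => expect (f a) g) := by
  unfold expect
  simp only [PMF.bind_apply, ← ENNReal.tsum_mul_right, ← ENNReal.tsum_mul_left]
  rw [ENNReal.tsum_comm]
  simp only [mul_assoc]

theorem expect_map {α β : Type*} (p : PMF α) (f : α → β) (g : β → ℝ≥0∞) :
    expect (p.map f) g = expect p (fun a => g (f a)) := by
  unfold PMF.map
  rw [expect_bind]
  simp only [Function.comp, expect_pure]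

/-- A function on final states, extended to computations that run out of fuel. -/
def total {α : Type*} (g : α → ℝ≥0∞) : Option α → ℝ≥0∞
  | none => ⊤
  | some a => g a

/-- The tower property. Exhausted fuel has value `⊤`, so a finite expectation of `total g` shows by
itself that the fuel suffices with probability one; termination needs no separate argument. -/
theorem expect_andThen {α : Type} (p : PMF (Option α)) (f : α → PMF (Option α)) (g : α → ℝ≥0∞) :
    expect (andThen p f) (total g) = expect p (total fun a => expect (f a) (total g)) := by
  unfold andThen
  rw [expect_bind]
  congr 1
  funext o
  cases o with
  | none => simp [expect_pure, total]
  | some a => simp [total]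

/-! ## Views of machine states -/

/-- What matters of a machine state: the user registers and the memory as natural numbers, the
amplitudes prepared by the circuit described so far, the last measurement outcome (if it is still
of interest), and bounds on the resources used, including those of the pending circuit. -/
@[ext]
structure View (w S : ℕ) where
  var : ℕ → ℕ
  mem : ℕ → ℕ
  psi : Basis S → ℂ
  out : Option (Basis S)
  time : ℕ
  queries : ℕ

variable {w S : ℕ}

/-- The state `s` is described by `σ`. -/
structure Rep (E : Env) (s : State w S) (σ : View w S) : Prop where
  reg : ∀ r < 100, s.reg r = BitVec.ofNat w (σ.var r)
  mem : ∀ a < 2 ^ w, s.mem (BitVec.ofNat w a) = BitVec.ofNat w (σ.mem a)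
  psi : s.circ.amplitudes E = σ.psi
  out : ∀ x, σ.out = some x → s.out = x
  time : s.time + s.circ.length ≤ σ.time
  queries : s.queries + s.circ.queries ≤ σ.queries

namespace View

def set (σ : View w S) (r v : ℕ) : View w S := { σ with var := Function.update σ.var r v }

def setMem (σ : View w S) (a v : ℕ) : View w S := { σ with mem := Function.update σ.mem a v }

def tick (σ : View w S) (t : ℕ) : View w S := { σ with time := σ.time + t }

def act (σ : View w S) (U : (Basis S → ℂ) → (Basis S → ℂ)) : View w S :=
  { σ with psi := U σ.psi }

variable (σ : View w S) (r v t a : ℕ) (U : (Basis S → ℂ) → (Basis S → ℂ))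

@[simp] theorem var_set : (σ.set r v).var = fun r' => if r' = r then v else σ.var r' := by
  funext r'; simp [set, Function.update_apply]
@[simp] theorem mem_set : (σ.set r v).mem = σ.mem := rfl
@[simp] theorem psi_set : (σ.set r v).psi = σ.psi := rfl
@[simp] theorem out_set : (σ.set r v).out = σ.out := rfl
@[simp] theorem time_set : (σ.set r v).time = σ.time := rfl
@[simp] theorem queries_set : (σ.set r v).queries = σ.queries := rfl
@[simp] theorem var_setMem : (σ.setMem a v).var = σ.var := rfl
@[simp] theorem mem_setMem : (σ.setMem a v).mem = Function.update σ.mem a v := rfl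
@[simp] theorem psi_setMem : (σ.setMem a v).psi = σ.psi := rfl
@[simp] theorem out_setMem : (σ.setMem a v).out = σ.out := rfl
@[simp] theorem time_setMem : (σ.setMem a v).time = σ.time := rfl
@[simp] theorem queries_setMem : (σ.setMem a v).queries = σ.queries := rfl
@[simp] theorem var_tick : (σ.tick t).var = σ.var := rfl
@[simp] theorem mem_tick : (σ.tick t).mem = σ.mem := rfl
@[simp] theorem psi_tick : (σ.tick t).psi = σ.psi := rfl
@[simp] theorem out_tick : (σ.tick t).out = σ.out := rfl
@[simp] theorem time_tick : (σ.tick t).time = σ.time + t := rfl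
@[simp] theorem queries_tick : (σ.tick t).queries = σ.queries := rfl
@[simp] theorem var_act : (σ.act U).var = σ.var := rfl
@[simp] theorem mem_act : (σ.act U).mem = σ.mem := rfl
@[simp] theorem psi_act : (σ.act U).psi = U σ.psi := rfl
@[simp] theorem out_act : (σ.act U).out = σ.out := rfl
@[simp] theorem time_act : (σ.act U).time = σ.time := rfl
@[simp] theorem queries_act : (σ.act U).queries = σ.queries := rfl

end View

/-- A bound on the number of tests of every loop. -/
def fuelFor (w : ℕ) : ℕ := 2 ^ w + 1

/-- The program `P` leads from states described by `σ` to states described by `τ`. -/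
def Det (E : Env) (P : Program) (σ τ : View w S) : Prop :=
  ∀ s : State w S, Rep E s σ → ∃ s', P.exec E (fuelFor w) s = PMF.pure (some s') ∧ Rep E s' τ

/-- On states described by `σ`, the expectation of `f` after the program `P` is at most `v`. -/
def Tri (E : Env) (P : Program) (σ : View w S) (f : View w S → ℝ≥0∞) (v : ℝ≥0∞) : Prop :=
  ∀ s : State w S, Rep E s σ → ∀ g : State w S → ℝ≥0∞,
    (∀ s' τ, Rep E s' τ → g s' ≤ f τ) → expect (P.exec E (fuelFor w) s) (total g) ≤ v

variable {E : Env}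

/-- The consequence rule. Only registers below 100 are described, the others being scratch space for
expressions; an outcome may be forgotten and resource bounds may grow. -/
theorem Rep.weaken {s : State w S} {σ τ : View w S} (h : Rep E s σ) (hv : ∀ r < 100, σ.var r = τ.var r)
    (hm : σ.mem = τ.mem) (hp : σ.psi = τ.psi) (ho : τ.out = none ∨ τ.out = σ.out)
    (ht : σ.time ≤ τ.time) (hq : σ.queries ≤ τ.queries) : Rep E s τ where
  reg r hr := by rw [h.reg r hr, hv r hr]
  mem a ha := by rw [h.mem a ha, hm]
  psi := by rw [h.psi, hp]
  out x hx := by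
    rcases ho with ho | ho
    · rw [ho] at hx; cases hx
    · exact h.out x (by rw [← ho, hx])
  time := h.time.trans ht
  queries := h.queries.trans hq

theorem Det.weaken {P : Program} {σ τ υ : View w S} (h : Det E P σ τ)
    (hv : ∀ r < 100, τ.var r = υ.var r) (hm : τ.mem = υ.mem) (hp : τ.psi = υ.psi)
    (ho : υ.out = none ∨ υ.out = τ.out) (ht : τ.time ≤ υ.time) (hq : τ.queries ≤ υ.queries) :
    Det E P σ υ := fun s hs => by
  obtain ⟨s', h1, h2⟩ := h s hs
  exact ⟨s', h1, h2.weaken hv hm hp ho ht hq⟩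

theorem Det.strengthen {P : Program} {σ τ υ : View w S} (h : Det E P σ τ)
    (hv : ∀ r < 100, υ.var r = σ.var r) (hm : υ.mem = σ.mem) (hp : υ.psi = σ.psi)
    (ho : σ.out = none ∨ σ.out = υ.out) (ht : υ.time ≤ σ.time) (hq : υ.queries ≤ σ.queries) :
    Det E P υ τ := fun s hs => h s (hs.weaken hv hm hp ho ht hq)

theorem Det.seq {P Q : Program} {σ τ υ : View w S} (h1 : Det E P σ τ) (h2 : Det E Q τ υ) :
    Det E (.seq P Q) σ υ := fun s hs => by
  obtain ⟨s', h1, r1⟩ := h1 s hs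
  obtain ⟨s'', h2, r2⟩ := h2 s' r1
  refine ⟨s'', ?_, r2⟩
  simp only [Program.exec, h1, andThen, PMF.pure_bind, h2]

theorem Det.tri {P : Program} {σ τ : View w S} (h : Det E P σ τ) (f : View w S → ℝ≥0∞) :
    Tri E P σ f (f τ) := fun s hs g hg => by
  obtain ⟨s', h1, h2⟩ := h s hs
  rw [h1, expect_pure]
  exact hg s' τ h2

theorem Tri.mono {P : Program} {σ : View w S} {f f' : View w S → ℝ≥0∞} {v v' : ℝ≥0∞}
    (h : Tri E P σ f v) (hf : ∀ τ, f' τ ≤ f τ) (hv : v ≤ v') : Tri E P σ f' v' :=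
  fun s hs g hg => (h s hs g fun s' τ hτ => (hg s' τ hτ).trans (hf τ)).trans hv

theorem Tri.seq {P Q : Program} {σ : View w S} {f h : View w S → ℝ≥0∞} {v : ℝ≥0∞}
    (hP : Tri E P σ h v) (hQ : ∀ τ, Tri E Q τ f (h τ)) : Tri E (.seq P Q) σ f v :=
  fun s hs g hg => by
    rw [Program.exec, expect_andThen]
    exact hP s hs _ fun s' τ hτ => hQ τ s' hτ g hg

theorem Det.seq_tri {P Q : Program} {σ τ : View w S} {f : View w S → ℝ≥0∞} {v : ℝ≥0∞}
    (hP : Det E P σ τ) (hQ : Tri E Q τ f v) : Tri E (.seq P Q) σ f v :=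
  fun s hs g hg => by
    obtain ⟨s', h1, h2⟩ := hP s hs
    rw [Program.exec, expect_andThen, h1, expect_pure]
    exact hQ s' h2 g hg

theorem ofNat_eq_zero_iff {v : ℕ} : BitVec.ofNat w v = 0 ↔ v % 2 ^ w = 0 := by
  rw [← BitVec.toNat_inj]
  simp

theorem rep_tick {s : State w S} {σ : View w S} (h : Rep E s σ) (t : ℕ) :
    Rep E (s.tick t) (σ.tick t) where
  reg := h.reg
  mem := h.mem
  psi := h.psi
  out := h.out
  time := by
    have := h.time
    simp only [State.time, State.tick, View.time_tick] at *
    omega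
  queries := h.queries

/-- The view `σ i` belongs to the moment before the test that precedes round `i`. A loop of `m`
rounds makes `m + 1` tests, which `fuelFor` allows because `m ≤ 2 ^ w`, and each test costs a tick.
Conditions are read modulo `2 ^ w` because registers hold words. -/
theorem Det.loop {P : Program} {r m : ℕ} (hr : r < 100) (hm : m ≤ 2 ^ w) (σ : ℕ → View w S)
    (hs : ∀ i < m, (σ i).var r % 2 ^ w ≠ 0 ∧ Det E P ((σ i).tick 1) (σ (i + 1)))
    (h0 : (σ m).var r % 2 ^ w = 0) : Det E (.loop r P) (σ 0) ((σ m).tick 1) := by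
  intro s hrep
  -- Induction on the number `k` of rounds still to come, for every fuel larger than `k`.
  have key : ∀ k ≤ m, ∀ fuel, k < fuel → ∀ s : State w S, Rep E s (σ (m - k)) →
      ∃ s', loopExec r (fun s' => P.exec E (fuelFor w) s') fuel s = PMF.pure (some s') ∧
        Rep E s' ((σ m).tick 1) := by
    intro k
    induction k with
    | zero =>
      intro _ fuel hfuel s hs'
      obtain ⟨fuel, rfl⟩ : ∃ k, fuel = k + 1 := ⟨fuel - 1, by omega⟩
      have : s.reg r = 0 := by rw [hs'.reg r hr, ofNat_eq_zero_iff]; exact h0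
      refine ⟨s.tick 1, ?_, rep_tick hs' 1⟩
      simp only [loopExec, this, ne_eq, not_true_eq_false, if_false]
    | succ k ih =>
      intro hk fuel hfuel s hs'
      obtain ⟨fuel, rfl⟩ : ∃ k, fuel = k + 1 := ⟨fuel - 1, by omega⟩
      obtain ⟨h1, h2⟩ := hs (m - (k + 1)) (by omega)
      have hne : s.reg r ≠ 0 := by
        rw [hs'.reg r hr, Ne, ofNat_eq_zero_iff]; exact h1
      obtain ⟨s', e1, r1⟩ := h2 _ (rep_tick hs' 1)
      rw [show m - (k + 1) + 1 = m - k by omega] at r1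
      obtain ⟨s'', e2, r2⟩ := ih (by omega) fuel (by omega) s' r1
      refine ⟨s'', ?_, r2⟩
      simp only [loopExec, hne, ne_eq, not_false_eq_true, if_true, e1, andThen, PMF.pure_bind, e2]
  exact key m le_rfl _ (by unfold fuelFor; omega) s (by simpa using hrep)

/-! ## Expressions -/

/-- Arithmetic expressions in registers. -/
inductive Ex where
  | v (r : ℕ)
  | lit (m : ℕ)
  | bin (o : BinOp) (a b : Ex)

namespace Ex

/-- Code that evaluates an expression into register `t`, using registers from `t` on. -/
def code : Ex → ℕ → Program
  | v r, t => .instr (.bin .or t r r)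
  | lit m, t => .instr (.const t m)
  | bin o a b, t => .seq (a.code t) (.seq (b.code (t + 1)) (.instr (.bin o t t (t + 1))))

def cost : Ex → ℕ
  | v _ => 1
  | lit _ => 1
  | bin _ a b => a.cost + b.cost + 1

end Ex

/-- Arithmetic on natural numbers that the word operations implement. -/
def BinOp.ev : BinOp → ℕ → ℕ → ℕ
  | .add, a, b => a + b
  | .sub, a, b => a - b
  | .mul, a, b => a * b
  | .div, a, b => a / b
  | .mod, a, b => a % b
  | .and, a, b => a &&& b
  | .or, a, b => a ||| b
  | .xor, a, b => a ^^^ b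
  | .shl, a, b => a * 2 ^ b
  | .shr, a, b => a / 2 ^ b
  | .lt, a, b => if a < b then 1 else 0
  | .eq, a, b => if a = b then 1 else 0

/-- A sufficient condition for a word operation to compute the operation on natural numbers. -/
def BinOp.Ok (w : ℕ) : BinOp → ℕ → ℕ → Prop
  | .add, _, _ => True
  | .sub, a, b => b ≤ a
  | .mul, _, _ => True
  | .shl, _, b => b < 2 ^ w
  | .and, _, _ => False
  | .or, _, _ => False
  | .xor, _, _ => False
  | _, a, b => a < 2 ^ w ∧ b < 2 ^ w

/-- Sums and products respect reduction modulo `2 ^ w` and need no bounds; a difference needs only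
that it is not truncated, and a left shift only that the shift distance is a word. The remaining
operations need operands that are words. -/
theorem BinOp.eval_ofNat {o : BinOp} {a b : ℕ} (h : o.Ok w a b) :
    o.eval (BitVec.ofNat w a) (BitVec.ofNat w b) = BitVec.ofNat w (o.ev a b) := by
  cases o <;> simp only [BinOp.Ok] at h <;> simp only [BinOp.eval, BinOp.ev]
  · rw [BitVec.ofNat_add]
  · apply BitVec.eq_of_toNat_eq
    rw [BitVec.toNat_sub, BitVec.toNat_ofNat, BitVec.toNat_ofNat, BitVec.toNat_ofNat]
    have hlt := Nat.mod_lt b (Nat.two_pow_pos w)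
    have e : 2 ^ w - b % 2 ^ w + a % 2 ^ w ≡ a - b [MOD 2 ^ w] := by
      refine Nat.ModEq.add_right_cancel' b ?_
      rw [Nat.sub_add_cancel h]
      have h1 : 2 ^ w - b % 2 ^ w + a % 2 ^ w + b ≡ 2 ^ w - b % 2 ^ w + a + b % 2 ^ w [MOD 2 ^ w] := by
        refine Nat.ModEq.add (Nat.ModEq.add rfl (Nat.mod_modEq _ _)) (Nat.mod_modEq _ _).symm
      refine h1.trans ?_
      rw [show 2 ^ w - b % 2 ^ w + a + b % 2 ^ w = a + 2 ^ w by omega]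
      simp [Nat.ModEq]
    exact e
  · rw [BitVec.ofNat_mul]
  · apply BitVec.eq_of_toNat_eq
    simp only [BitVec.toNat_udiv, BitVec.toNat_ofNat, Nat.mod_eq_of_lt h.1, Nat.mod_eq_of_lt h.2]
    rw [Nat.mod_eq_of_lt ((Nat.div_le_self _ _).trans_lt h.1)]
  · apply BitVec.eq_of_toNat_eq
    simp only [BitVec.toNat_umod, BitVec.toNat_ofNat, Nat.mod_eq_of_lt h.1, Nat.mod_eq_of_lt h.2]
    rw [Nat.mod_eq_of_lt ((Nat.mod_le _ _).trans_lt h.1)]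
  · apply BitVec.eq_of_toNat_eq
    rw [BitVec.shiftLeft_eq', BitVec.toNat_shiftLeft, BitVec.toNat_ofNat, BitVec.toNat_ofNat,
      BitVec.toNat_ofNat, Nat.mod_eq_of_lt h, Nat.shiftLeft_eq, Nat.mod_mul_mod]
  · apply BitVec.eq_of_toNat_eq
    rw [BitVec.ushiftRight_eq', BitVec.toNat_ushiftRight, BitVec.toNat_ofNat, BitVec.toNat_ofNat,
      BitVec.toNat_ofNat, Nat.mod_eq_of_lt h.2, Nat.mod_eq_of_lt h.1, Nat.shiftRight_eq_div_pow,
      Nat.mod_eq_of_lt ((Nat.div_le_self _ _).trans_lt h.1)]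
  · have : (BitVec.ofNat w a < BitVec.ofNat w b) ↔ a < b := by
      rw [BitVec.lt_def, BitVec.toNat_ofNat, BitVec.toNat_ofNat, Nat.mod_eq_of_lt h.1,
        Nat.mod_eq_of_lt h.2]
    by_cases hab : a < b <;> simp [this, hab]
  · have : (BitVec.ofNat w a = BitVec.ofNat w b) ↔ a = b := by
      rw [← BitVec.toNat_inj, BitVec.toNat_ofNat, BitVec.toNat_ofNat, Nat.mod_eq_of_lt h.1,
        Nat.mod_eq_of_lt h.2]
    by_cases hab : a = b
    · simp [hab]
    · simp [this, hab]

namespace Ex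

/-- The value of an expression. -/
def ev (V : ℕ → ℕ) : Ex → ℕ
  | v r => V r
  | lit m => m
  | bin o a b => o.ev (a.ev V) (b.ev V)

/-- No overflow occurs that would spoil the value of the expression. -/
def Ok (w : ℕ) (V : ℕ → ℕ) : Ex → Prop
  | v r => r < 100
  | lit _ => True
  | bin o a b => a.Ok w V ∧ b.Ok w V ∧ o.Ok w (a.ev V) (b.ev V)

/-- The value of the left operand waits in register `t` while the right one is evaluated from `t +
1` on. This is sound because evaluation changes no register below its start, in particular no user
register. Copying is `or` of a register with itself. -/
theorem code_exec {V : ℕ → ℕ} {e : Ex} (h : e.Ok w V) : ∀ t, 100 ≤ t → ∀ s : State w S,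
    (∀ r < 100, s.reg r = BitVec.ofNat w (V r)) → ∀ fuel, ∃ R : ℕ → BitVec w,
      (e.code t).exec E fuel s = PMF.pure (some { s with reg := R, steps := s.steps + e.cost }) ∧
      R t = BitVec.ofNat w (e.ev V) ∧ ∀ r < t, R r = s.reg r := by
  induction e with
  | v r =>
    intro t ht s hs fuel
    refine ⟨Function.update s.reg t (s.reg r), ?_, ?_, ?_⟩
    · simp [code, Program.exec, Instr.exec, PMF.pure_map, BinOp.eval, State.setReg, State.tick, cost]
    · simp [hs r h, ev]
    · intro r hr; exact Function.update_of_ne (by omega) _ _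
  | lit m =>
    intro t ht s hs fuel
    refine ⟨Function.update s.reg t (BitVec.ofNat w m), ?_, ?_, ?_⟩
    · simp [code, Program.exec, Instr.exec, PMF.pure_map, State.setReg, State.tick, cost]
    · simp [ev]
    · intro r hr; exact Function.update_of_ne (by omega) _ _
  | bin o a b iha ihb =>
    intro t ht s hs fuel
    obtain ⟨ha, hb, ho⟩ := h
    obtain ⟨R1, e1, v1, f1⟩ := iha ha t ht s hs fuel
    obtain ⟨R2, e2, v2, f2⟩ := ihb hb (t + 1) (by omega)
      { s with reg := R1, steps := s.steps + a.cost }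
      (fun r hr => by rw [← hs r hr]; exact f1 r (by omega)) fuel
    refine ⟨Function.update R2 t (BitVec.ofNat w ((bin o a b).ev V)), ?_, ?_, ?_⟩
    · simp only [code, Program.exec, e1, andThen, PMF.pure_bind, e2, Instr.exec, PMF.pure_map,
        State.setReg, State.tick, cost]
      have : R2 t = BitVec.ofNat w (a.ev V) := by rw [f2 t (by omega)]; exact v1
      rw [this, v2, BinOp.eval_ofNat ho]
      simp only [ev, add_assoc]
    · simp
    · intro r hr
      rw [Function.update_of_ne (by omega), f2 r (by omega)]
      exact f1 r hr

end Ex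

/-- `r := e` -/
def assign (r : ℕ) (e : Ex) : Program := .seq (e.code 100) (.instr (.bin .or r 100 100))

theorem det_assign {σ : View w S} {r : ℕ} {e : Ex} (hr : r < 100) (h : e.Ok w σ.var) :
    Det E (assign r e) σ ((σ.set r (e.ev σ.var)).tick (e.cost + 1)) := by
  intro s hs
  obtain ⟨R, e1, v1, f1⟩ := Ex.code_exec (E := E) h 100 le_rfl s hs.reg (fuelFor w)
  refine ⟨_, by simp only [assign, Program.exec, e1, andThen, PMF.pure_bind, Instr.exec,
    PMF.pure_map]; rfl, ?_⟩
  constructor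
  · intro r' hr'
    by_cases h : r' = r
    · subst h; simp [State.setReg, State.tick, BinOp.eval, v1]
    · simp [State.setReg, State.tick, h, f1 r' hr', hs.reg r' hr']
  · exact hs.mem
  · exact hs.psi
  · exact hs.out
  · have := hs.time
    simp only [State.time, State.tick, State.setReg, View.time_tick, View.time_set] at *
    omega
  · exact hs.queries

/-! ## The other instructions -/

theorem det_load {σ : View w S} {r a : ℕ} (hr : r < 100) (ha : a < 100) (h : σ.var a < 2 ^ w) :
    Det E (.instr (.load r a)) σ ((σ.set r (σ.mem (σ.var a))).tick 1) := by
  intro s hs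
  refine ⟨_, by simp only [Program.exec, Instr.exec, PMF.pure_map]; rfl, rep_tick ?_ 1⟩
  refine ⟨fun r' hr' => ?_, hs.mem, hs.psi, hs.out, hs.time, hs.queries⟩
  by_cases h' : r' = r
  · subst h'; simp [State.setReg, hs.reg a ha, hs.mem _ h]
  · simp [State.setReg, h', hs.reg r' hr']

theorem det_store {σ : View w S} {r a : ℕ} (hr : r < 100) (ha : a < 100) (h : σ.var r < 2 ^ w) :
    Det E (.instr (.store r a)) σ ((σ.setMem (σ.var r) (σ.var a)).tick 1) := by
  intro s hs
  refine ⟨_, by simp only [Program.exec, Instr.exec, PMF.pure_map]; rfl, rep_tick ?_ 1⟩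
  refine ⟨hs.reg, fun i hi => ?_, hs.psi, hs.out, hs.time, hs.queries⟩
  have : BitVec.ofNat w i = BitVec.ofNat w (σ.var r) ↔ i = σ.var r := by
    rw [← BitVec.toNat_inj, BitVec.toNat_ofNat, BitVec.toNat_ofNat, Nat.mod_eq_of_lt hi,
      Nat.mod_eq_of_lt h]
  simp only [Function.update_apply, hs.reg r hr, hs.reg a ha, this, View.mem_setMem]
  split_ifs
  · rfl
  · exact hs.mem i hi

theorem det_readEps {σ : View w S} {r a : ℕ} (hr : r < 100) (ha : a < 100) (h : σ.var a < 2 ^ w) :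
    Det E (.instr (.readEps r a)) σ ((σ.set r (epsDigit E.eps (σ.var a))).tick 1) := by
  intro s hs
  refine ⟨_, by simp only [Program.exec, Instr.exec, PMF.pure_map]; rfl, rep_tick ?_ 1⟩
  refine ⟨fun r' hr' => ?_, hs.mem, hs.psi, hs.out, hs.time, hs.queries⟩
  by_cases h' : r' = r
  · subst h'; simp [State.setReg, hs.reg a ha, Nat.mod_eq_of_lt h]
  · simp [State.setReg, h', hs.reg r' hr']

/-- The qubit with number `q` of a basis state (`false` if there is no such qubit). -/
def bit (x : Basis S) (q : ℕ) : Bool := if h : q < S then x ⟨q, h⟩ else false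

theorem det_readOut {σ : View w S} {r a : ℕ} {x : Basis S} (hr : r < 100) (ha : a < 100)
    (h : σ.var a < 2 ^ w) (hx : σ.out = some x) :
    Det E (.instr (.readOut r a)) σ ((σ.set r (bit x (σ.var a)).toNat).tick 1) := by
  intro s hs
  refine ⟨_, by simp only [Program.exec, Instr.exec, PMF.pure_map]; rfl, rep_tick ?_ 1⟩
  refine ⟨fun r' hr' => ?_, hs.mem, hs.psi, hs.out, hs.time, hs.queries⟩
  by_cases h' : r' = r
  · subst h'
    simp only [State.setReg, Function.update_self, View.var_set, if_true, State.qubit,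
      hs.reg a ha, BitVec.toNat_ofNat, Nat.mod_eq_of_lt h, hs.out x hx, bit]
    by_cases hq : σ.var a < S
    · simp only [hq, dite_true]
      cases x ⟨σ.var a, hq⟩ <;> simp
    · simp [hq]
  · simp [State.setReg, h', hs.reg r' hr']

/-- The effect of a one-qubit gate on the qubit with number `q`. -/
def gateN (θ φ lam : ℝ) (q : ℕ) (ψ : Basis S → ℂ) : Basis S → ℂ :=
  if h : q < S then (Op.u3 θ φ lam ⟨q, h⟩).apply ⟨0, 0, fun _ => 0, 0⟩ ψ else ψ

/-- The effect of a controlled NOT gate on the qubits with numbers `c` and `t`. -/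
def cnotN (c t : ℕ) (ψ : Basis S → ℂ) : Basis S → ℂ :=
  if h : c < S ∧ t < S then fun x => ψ (cnotMap ⟨c, h.1⟩ ⟨t, h.2⟩ x) else ψ

/-- All registers in the expression are user registers. -/
def Angle.User : Angle → Prop
  | .reg r => r < 100
  | .lit _ => True
  | .pi => True
  | .add a b => a.User ∧ b.User
  | .sub a b => a.User ∧ b.User
  | .mul a b => a.User ∧ b.User
  | .div a b => a.User ∧ b.User
  | .sqrt a => a.User
  | .sin a => a.User
  | .cos a => a.User
  | .arcsin a => a.User

theorem Angle.eval_congr {R R' : ℕ → BitVec w} (h : ∀ r < 100, R r = R' r) {a : Angle}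
    (ha : a.User) : a.eval R = a.eval R' := by
  induction a <;> simp_all [Angle.User, Angle.eval]

/-- `Rep` charges for pending circuit elements. A gate therefore costs the writing of its angles,
one instruction, and one unit in advance for its execution. -/
theorem det_gate {σ : View w S} {θ φ lam : Angle} {a : ℕ} (ha : a < 100) (h : σ.var a < 2 ^ w)
    (hθ : θ.User) (hφ : φ.User) (hl : lam.User) :
    Det E (.instr (.gate θ φ lam a)) σ
      ((σ.act (gateN (θ.eval fun r => BitVec.ofNat w (σ.var r))
        (φ.eval fun r => BitVec.ofNat w (σ.var r)) (lam.eval fun r => BitVec.ofNat w (σ.var r))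
        (σ.var a))).tick (θ.size + φ.size + lam.size + 2)) := by
  intro s hs
  refine ⟨_, by simp only [Program.exec, Instr.exec, PMF.pure_map]; rfl, ?_⟩
  rw [Angle.eval_congr hs.reg hθ, Angle.eval_congr hs.reg hφ, Angle.eval_congr hs.reg hl,
    State.qubit, hs.reg a ha, BitVec.toNat_ofNat, Nat.mod_eq_of_lt h]
  have ht := hs.time
  have hq := hs.queries
  have hp := hs.psi
  by_cases hS : σ.var a < S
  · refine ⟨?_, ?_, ?_, ?_, ?_, ?_⟩
    · simpa [hS, State.tick, State.push] using hs.reg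
    · simpa [hS, State.tick, State.push] using hs.mem
    · simp only [hS, dite_true, State.tick, State.push, View.psi_tick, View.psi_act, ← hs.psi, gateN]
      rfl
    · simpa [hS, State.tick, State.push] using hs.out
    · simp only [hS, dite_true, State.tick, State.push, State.time, View.time_tick, View.time_act,
        List.length_cons] at *
      omega
    · simpa [hS, State.tick, State.push, Circuit.queries, Op.isQuery] using hq
  · refine ⟨?_, ?_, ?_, ?_, ?_, ?_⟩
    · simpa [hS, State.tick] using hs.reg
    · simpa [hS, State.tick] using hs.mem
    · simp [hS, State.tick, gateN, hp]
    · simpa [hS, State.tick] using hs.out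
    · simp only [hS, dite_false, State.tick, State.time, View.time_tick, View.time_act] at *
      omega
    · simpa [hS, State.tick] using hq

theorem det_cnot {σ : View w S} {a b : ℕ} (ha : a < 100) (hb : b < 100) (h : σ.var a < 2 ^ w)
    (h' : σ.var b < 2 ^ w) :
    Det E (.instr (.cnot a b)) σ ((σ.act (cnotN (σ.var a) (σ.var b))).tick 2) := by
  intro s hs
  refine ⟨_, by simp only [Program.exec, Instr.exec, PMF.pure_map]; rfl, ?_⟩
  rw [State.qubit, State.qubit, hs.reg a ha, hs.reg b hb, BitVec.toNat_ofNat, BitVec.toNat_ofNat,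
    Nat.mod_eq_of_lt h, Nat.mod_eq_of_lt h']
  have ht := hs.time
  have hq := hs.queries
  have hp := hs.psi
  by_cases hS : σ.var a < S ∧ σ.var b < S
  · refine ⟨?_, ?_, ?_, ?_, ?_, ?_⟩
    · simpa [hS, State.tick, State.push] using hs.reg
    · simpa [hS, State.tick, State.push] using hs.mem
    · simp only [hS, dite_true, and_self, State.tick, State.push, View.psi_tick, View.psi_act,
        ← hs.psi, cnotN]
      rfl
    · simpa [hS, State.tick, State.push] using hs.out
    · simp only [hS, dite_true, State.tick, State.push, State.time, View.time_tick, View.time_act,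
        List.length_cons] at *
      omega
    · simpa [hS, State.tick, State.push, Circuit.queries, Op.isQuery] using hq
  · have fin : Rep E (s.tick 1) ((σ.act (cnotN (σ.var a) (σ.var b))).tick 2) := by
      refine ⟨hs.reg, hs.mem, ?_, hs.out, ?_, hq⟩
      · simp [State.tick, cnotN, hS, hp]
      · simp only [State.tick, State.time, View.time_tick, View.time_act] at *
        omega
    by_cases h1 : σ.var a < S
    · have h2 : ¬ σ.var b < S := fun h2 => hS ⟨h1, h2⟩
      simpa only [h1, h2, dite_true, dite_false] using fin
    · simpa only [h1, dite_false] using fin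

theorem det_query {σ : View w S} :
    Det E (.instr .query) σ
      { (σ.act fun ψ x => ψ (queryMap E x)).tick 2 with queries := σ.queries + 1 } := by
  intro s hs
  refine ⟨_, by simp only [Program.exec, Instr.exec, PMF.pure_map]; rfl, ?_⟩
  have ht := hs.time
  have hq := hs.queries
  refine ⟨hs.reg, hs.mem, ?_, hs.out, ?_, ?_⟩
  · show (Circuit.amplitudes E (Op.query :: s.circ)) = _
    simp only [View.psi_tick, View.psi_act, ← hs.psi]
    rfl
  · simp only [State.tick, State.push, State.time, View.time_tick, View.time_act,
      List.length_cons] at *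
    omega
  · simp only [State.tick, State.push, Circuit.queries, List.countP_cons, Op.isQuery] at *
    simp only [if_true]
    omega

/-- The amplitudes of the state that circuits are run on. -/
def psiInit : Basis S → ℂ := Pi.single (fun _ => false) 1

/-- The Born rule as an expectation. Gates and queries were charged when they were written down, so
only the `S` measurements and the instruction itself are added. The normalisation may be assumed
because every circuit is unitary. -/
theorem tri_run {σ : View w S} {f : View w S → ℝ≥0∞} {v : ℝ≥0∞}
    (h : ∑ x, ‖σ.psi x‖ ^ 2 = 1 → ∑ x, ENNReal.ofReal (‖σ.psi x‖ ^ 2) *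
      f { σ.tick (S + 1) with psi := psiInit, out := some x } ≤ v) :
    Tri E (.instr .run) σ f v := by
  intro s hs g hg
  simp only [Program.exec, Instr.exec]
  rw [expect_map, expect_map]
  have hn := s.circ.sum_norm_amplitudes E
  rw [hs.psi] at hn
  refine le_trans ?_ (h hn)
  unfold expect
  rw [tsum_fintype]
  refine Finset.sum_le_sum fun x _ => ?_
  have : s.circ.measure E x = ENNReal.ofReal (‖σ.psi x‖ ^ 2) := by
    simp [Circuit.measure, hs.psi]
  rw [this]
  gcongr
  refine hg _ _ ⟨hs.reg, hs.mem, rfl, ?_, ?_, ?_⟩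
  · rintro y hy
    simpa [State.tick] using hy
  · have h1 := hs.time
    -- The length charged in advance splits into what the machine now adds to `queries` and `gates`.
    have h2 : s.circ.length = s.circ.queries + s.circ.gates := by
      simp only [Circuit.queries, Circuit.gates]
      rw [List.length_eq_countP_add_countP (fun g => g.isQuery)]
      congr 1
      apply List.countP_congr
      simp
    simp only [State.time, State.tick, View.time_tick, List.length_nil] at *
    omega
  · have := hs.queries
    simpa [State.tick, Circuit.queries] using this

end

end HybridRAM

/-! ### Qubit gates, the Toffoli gate, and comparison with a classical number -/

namespace HybridRAM

noncomputable section

open scoped ENNReal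

variable {w S : ℕ} {E : Env}

/-! ## Bits of basis states -/

/-- Set the qubit with number `q`. -/
def setb (x : Basis S) (q : ℕ) (v : Bool) : Basis S := fun p => if (p : ℕ) = q then v else x p

theorem bit_setb (x : Basis S) (q q' : ℕ) (v : Bool) :
    bit (setb x q v) q' = if q' = q ∧ q' < S then v else bit x q' := by
  unfold bit setb
  by_cases h : q' < S
  · by_cases h' : q' = q
    · subst h'; simp [h]
    · simp [h, h']
  · simp [h]

theorem basis_ext {x y : Basis S} (h : ∀ q < S, bit x q = bit y q) : x = y := by
  funext p
  have := h p p.2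
  simpa [bit, p.2] using this

theorem setb_eq_update (x : Basis S) {q : ℕ} (h : q < S) (v : Bool) :
    setb x q v = Function.update x ⟨q, h⟩ v := by
  funext p
  simp only [setb, Function.update_apply, Fin.ext_iff]

theorem setb_setb (x : Basis S) (q : ℕ) (u v : Bool) : setb (setb x q u) q v = setb x q v := by
  funext p; simp only [setb]; split_ifs <;> rfl

theorem setb_comm (x : Basis S) {q q' : ℕ} (h : q ≠ q') (u v : Bool) :
    setb (setb x q u) q' v = setb (setb x q' v) q u := by
  funext p; simp only [setb]; split_ifs <;> first | rfl | omega

theorem setb_bit (x : Basis S) (q : ℕ) : setb x q (bit x q) = x := by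
  funext p
  simp only [setb]
  split_ifs with h
  · subst h; simp [bit]
  · rfl

theorem gateN_apply {θ φ l : ℝ} {q : ℕ} (h : q < S) (ψ : Basis S → ℂ) (x : Basis S) :
    gateN θ φ l q ψ x = u3Entry θ φ l (bit x q) false * ψ (setb x q false) +
      u3Entry θ φ l (bit x q) true * ψ (setb x q true) := by
  simp only [gateN, h, dite_true, Op.apply, bit, setb_eq_update _ h]

theorem cnotN_apply {c t : ℕ} (hc : c < S) (ht : t < S) (hne : c ≠ t) (ψ : Basis S → ℂ)
    (x : Basis S) : cnotN c t ψ x = ψ (setb x t (xor (bit x t) (bit x c))) := by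
  simp only [cnotN, hc, ht, and_self, dite_true, cnotMap, Fin.mk.injEq, hne, if_false, bit,
    setb_eq_update _ ht]

/-! ## Standard gates -/

/-- The NOT gate if `c`, and the identity otherwise. -/
def xgate (c : Bool) (q : ℕ) (ψ : Basis S → ℂ) : Basis S → ℂ :=
  fun x => ψ (setb x q (xor (bit x q) c))

/-- The parameters π, 0, π give NOT and 0, 0, 0 give the identity. A classical bit can thus control
a gate through its angles, without a branch in the program. -/
theorem gateN_xgate (c : Bool) {q : ℕ} (h : q < S) :
    gateN (Real.pi * (c.toNat : ℝ)) 0 (Real.pi * (c.toNat : ℝ)) q = xgate (S := S) c q := by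
  funext ψ x
  rw [gateN_apply h, xgate]
  cases c
  · have := setb_bit x q
    cases hb : bit x q <;> rw [hb] at this <;> simp [u3Entry]
  · cases hb : bit x q <;> simp [u3Entry]

/-- The Hadamard gate. -/
def had (q : ℕ) (ψ : Basis S → ℂ) : Basis S → ℂ := fun x =>
  ((√2)⁻¹ : ℝ) * (ψ (setb x q false) + (if bit x q then -1 else 1) * ψ (setb x q true))

theorem gateN_had {q : ℕ} (h : q < S) : gateN (Real.pi / 2) 0 Real.pi q = had (S := S) q := by
  funext ψ x
  have e : Real.pi / 2 / 2 = Real.pi / 4 := by ring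
  have e2 : √2 / 2 = (√2)⁻¹ := by
    rw [div_eq_iff (by norm_num), ← div_eq_inv_mul, eq_div_iff (by positivity)]
    norm_num
  rw [gateN_apply h, had]
  cases hb : bit x q <;> simp [u3Entry, e, -Complex.ofReal_div, e2] <;> ring

/-- The phase gate. -/
def phase (l : ℝ) (q : ℕ) (ψ : Basis S → ℂ) : Basis S → ℂ := fun x =>
  (if bit x q then Complex.exp (l * Complex.I) else 1) * ψ x

theorem gateN_phase (l : ℝ) {q : ℕ} (h : q < S) : gateN 0 0 l q = phase (S := S) l q := by
  funext ψ x
  rw [gateN_apply h, phase]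
  have := setb_bit x q
  cases hb : bit x q <;> rw [hb] at this <;> simp [u3Entry, this]

/-- The Toffoli gate with controls `a`, `b` and target `t`. -/
def toff (a b t : ℕ) (ψ : Basis S → ℂ) : Basis S → ℂ := fun x =>
  ψ (setb x t (xor (bit x t) (bit x a && bit x b)))

/-- The standard decomposition into fifteen gates. Only the three bits at `a`, `b`, `t` matter, so
it is a check of eight cases in which ω = e^(iπ/4) enters only through ω ω' = 1 and ω⁴ = -1, and the
Hadamard factor through s² = 1/2. -/
theorem toff_decomposition {a b t : ℕ} (ha : a < S) (hb : b < S) (ht : t < S) (hab : a ≠ b)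
    (hat : a ≠ t) (hbt : b ≠ t) (ψ : Basis S → ℂ) :
    cnotN a b (phase (-(Real.pi / 4)) b (phase (Real.pi / 4) a (cnotN a b (had t
      (phase (Real.pi / 4) t (phase (Real.pi / 4) b (cnotN a t (phase (-(Real.pi / 4)) t
      (cnotN b t (phase (Real.pi / 4) t (cnotN a t (phase (-(Real.pi / 4)) t (cnotN b t
      (had t ψ)))))))))))))) = toff a b t ψ := by
  funext x
  have hx : x = setb (setb (setb x a (bit x a)) b (bit x b)) t (bit x t) := by
    simp only [setb_bit]
  rw [hx]
  generalize bit x a = u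
  generalize bit x b = v
  generalize bit x t = z
  have hs : (((√2)⁻¹ : ℝ) : ℂ) * (((√2)⁻¹ : ℝ) : ℂ) = 1 / 2 := by
    rw [← Complex.ofReal_mul, ← mul_inv, Real.mul_self_sqrt (by norm_num)]; norm_num
  have h1 : Complex.exp ((Real.pi / 4 : ℝ) * Complex.I) *
      Complex.exp ((-(Real.pi / 4) : ℝ) * Complex.I) = 1 := by
    rw [← Complex.exp_add, ← add_mul, ← Complex.ofReal_add]; simp
  have h4 : Complex.exp ((Real.pi / 4 : ℝ) * Complex.I) ^ 4 = -1 := by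
    rw [← Complex.exp_nat_mul, ← Complex.exp_pi_mul_I]; congr 1; push_cast; ring
  simp only [cnotN_apply ha hb hab, cnotN_apply ha ht hat, cnotN_apply hb ht hbt, phase, had, toff,
    bit_setb]
  generalize Complex.exp ((Real.pi / 4 : ℝ) * Complex.I) = ω at *
  generalize Complex.exp ((-(Real.pi / 4) : ℝ) * Complex.I) = ω' at *
  generalize (((√2)⁻¹ : ℝ) : ℂ) = s at *
  have c1 : ∀ (y : Basis S) (u v z v' : Bool), setb (setb (setb (setb y a u) b v) t z) b v' =
      setb (setb (setb y a u) b v') t z := by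
    intro y u v z v'
    rw [setb_comm _ hbt.symm, setb_setb]
  clear hx
  cases u <;> cases v <;> cases z <;>
  simp [ha, hb, ht, hab, hat, hbt, hbt.symm, setb_setb, c1] <;> grind

/-! ## Comparison with a classical number -/

/-- The value of the number whose binary digits are held by the first `p` qubits. -/
def val (x : Basis S) : ℕ → ℕ
  | 0 => 0
  | p + 1 => val x p + (bit x p).toNat * 2 ^ p

theorem val_lt (x : Basis S) (p : ℕ) : val x p < 2 ^ p := by
  induction p with
  | zero => simp [val]
  | succ p ih =>
    have := Bool.toNat_lt (bit x p)
    rw [val, pow_succ]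
    nlinarith [Nat.two_pow_pos p]

theorem testBit_val (x : Basis S) {p q : ℕ} (h : q < p) : (val x p).testBit q = bit x q := by
  induction p with
  | zero => omega
  | succ p ih =>
    rw [val, add_comm, mul_comm, Nat.testBit_two_pow_mul_add _ (val_lt x p)]
    by_cases hq : q < p
    · simp [hq, ih hq]
    · obtain rfl : q = p := by omega
      cases bit x q <;> simp

theorem val_congr {x y : Basis S} {p : ℕ} (h : ∀ q < p, bit x q = bit y q) : val x p = val y p := by
  induction p with
  | zero => rfl
  | succ p ih => rw [val, val, ih fun q hq => h q (by omega), h p (by omega)]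

theorem val_eq_of_testBit {x : Basis S} {p i : ℕ} (hi : i < 2 ^ p)
    (h : ∀ q < p, bit x q = i.testBit q) : val x p = i := by
  apply Nat.eq_of_testBit_eq
  intro q
  by_cases hq : q < p
  · rw [testBit_val x hq, h q hq]
  · rw [Nat.testBit_lt_two_pow ((val_lt x p).trans_le (Nat.pow_le_pow_right (by norm_num) (by omega))),
      Nat.testBit_lt_two_pow (hi.trans_le (Nat.pow_le_pow_right (by norm_num) (by omega)))]

theorem indexOf_eq_val {l : ℕ} (h : l ≤ S) (x : Basis S) : indexOf l x = val x l := by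
  have e : indexOf l x = ∑ p ∈ Finset.range S, if p < l then (bit x p).toNat * 2 ^ p else 0 := by
    rw [← Fin.sum_univ_eq_sum_range (fun p => if p < l then (bit x p).toNat * 2 ^ p else 0) S]
    refine Finset.sum_congr rfl fun p _ => ?_
    simp only [bit, p.2, dite_true, Fin.eta]
    by_cases hp : (p : ℕ) < l <;> cases x p <;> simp [hp]
  rw [e, ← Finset.sum_filter]
  have : (Finset.range S).filter (· < l) = Finset.range l := by ext; simp; omega
  rw [this]
  clear e this h
  induction l with
  | zero => rfl
  | succ l ih => rw [Finset.sum_range_succ, ih, val]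

/-- One step of the comparison: the bit `base + p` says whether the number given by the first `p`
qubits is smaller than the one given by the first `p` digits of `c`. -/
def ladder (base c p : ℕ) (x : Basis S) : Basis S :=
  setb x (base + p + 1) (xor (bit x (base + p + 1)) (xor (c.testBit p)
    (xor (bit x p) (!c.testBit p) && xor (bit x (base + p)) (c.testBit p))))

/-- The step adds to one bit a function of other bits, so it is an involution. The comparison is
therefore uncomputed by the same steps in reverse order. -/
theorem ladder_ladder (base c p : ℕ) (x : Basis S) :
    ladder base c p (ladder base c p x) = x := by
  have h1 : p ≠ base + p + 1 := by omega
  have h2 : base + p ≠ base + p + 1 := by omega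
  apply basis_ext
  intro q hq
  simp only [ladder, bit_setb, h1, h2, false_and, if_false]
  split_ifs with h3 h4
  · rw [h3.1]
    cases bit x (base + p + 1) <;> cases c.testBit p <;> cases bit x p <;>
      cases bit x (base + p) <;> rfl
  · exact absurd ⟨trivial, h3.1 ▸ h3.2⟩ h4
  · rfl

/-- The conjunction is one Toffoli gate, conjugated by NOT gates on its controls that depend on the
classical digit; one more NOT on the target adds the digit itself. -/
theorem ladder_gates {base p : ℕ} (hp : p < base) (hS : base + p + 1 < S) (c : ℕ)
    (ψ : Basis S → ℂ) :
    xgate (c.testBit p) (base + p + 1) (xgate (c.testBit p) (base + p) (xgate (!c.testBit p) p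
      (toff p (base + p) (base + p + 1) (xgate (c.testBit p) (base + p)
        (xgate (!c.testBit p) p ψ))))) = fun x => ψ (ladder base c p x) := by
  funext x
  simp only [xgate, toff]
  congr 1
  apply basis_ext
  intro q hq
  have h1 : p ≠ base + p := by omega
  have h2 : p ≠ base + p + 1 := by omega
  have h3 : base + p ≠ base + p + 1 := by omega
  have h4 : p < S := by omega
  have h5 : base + p < S := by omega
  have h6 : base ≠ 0 := by omega
  simp only [ladder, bit_setb]
  by_cases e1 : q = p
  · subst e1; cases c.testBit q <;> simp [h2, h4, h6]
  by_cases e2 : q = base + p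
  · subst e2; cases c.testBit p <;> simp [h5, h6]
  by_cases e3 : q = base + p + 1
  · subst e3
    cases c.testBit p <;> simp [e1, h2, h4, h5, h6, hS] <;>
      cases bit x (base + p + 1) <;> cases bit x p <;> cases bit x (base + p) <;> rfl
  simp [e1, e2, e3]

/-- The steps `0, …, m - 1` of the comparison. -/
def ladderUp (base c : ℕ) : ℕ → Basis S → Basis S
  | 0, x => x
  | m + 1, x => ladder base c m (ladderUp base c m x)

/-- The steps `m - 1, …, 0` of the comparison. -/
def ladderDown (base c : ℕ) : ℕ → Basis S → Basis S
  | 0, x => x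
  | m + 1, x => ladderDown base c m (ladder base c m x)

theorem ladderUp_down (base c m : ℕ) (x : Basis S) :
    ladderUp base c m (ladderDown base c m x) = x := by
  induction m generalizing x with
  | zero => rfl
  | succ m ih => rw [ladderUp, ladderDown, ih, ladder_ladder]

theorem bit_ladderUp_of_not_mem {base c m q : ℕ} (x : Basis S) (h : q ≤ base ∨ base + m < q) :
    bit (ladderUp base c m x) q = bit x q := by
  induction m with
  | zero => rfl
  | succ m ih =>
    have : ¬ (q = base + m + 1 ∧ q < S) := by omega
    rw [ladderUp, ladder, bit_setb, if_neg this, ih (by omega)]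

/-- If the leading bits `u` and `c.testBit p` agree, the comparison of the lower digits decides; if
they differ, the digit of `c` is the answer. -/
theorem lt_step {v c p : ℕ} (hv : v < 2 ^ p) (u : Bool) :
    xor (c.testBit p) (xor u (!c.testBit p) && xor (decide (v < c % 2 ^ p)) (c.testBit p)) =
      decide (v + u.toNat * 2 ^ p < c % 2 ^ (p + 1)) := by
  have h : c % 2 ^ (p + 1) = c % 2 ^ p + 2 ^ p * (c.testBit p).toNat := by
    rw [Nat.toNat_testBit, pow_succ, Nat.mod_mul]
  have h2 : c % 2 ^ p < 2 ^ p := Nat.mod_lt _ (Nat.two_pow_pos p)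
  rw [h]
  generalize c % 2 ^ p = c' at *
  cases c.testBit p <;> cases u <;> simp <;> omega

theorem bit_ladderUp {base c m : ℕ} (hS : base + m < S) (hm : m ≤ base) {x : Basis S}
    (hx : ∀ q, base ≤ q → q ≤ base + m → bit x q = false) :
    bit (ladderUp base c m x) (base + m) = decide (val x m < c % 2 ^ m) := by
  induction m with
  | zero => simp [ladderUp, hx base le_rfl le_rfl, val, Nat.mod_one]
  | succ m ih =>
    have ih := ih (by omega) (by omega) fun q h1 h2 => hx q h1 (by omega)
    rw [ladderUp, ladder, bit_setb, if_pos ⟨rfl, hS⟩, ih,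
      bit_ladderUp_of_not_mem x (q := m) (by omega),
      bit_ladderUp_of_not_mem x (q := base + m + 1) (by omega), hx _ (by omega) (by omega),
      Bool.false_xor, lt_step (val_lt x m), val]

/-- The phase flip if qubit `q` is set and the number given by the first `m` qubits is smaller
than `c` (for `c < 2 ^ m`, and if the qubits from `base` to `base + m` are not set). -/
def flip (base q m c : ℕ) (ψ : Basis S → ℂ) : Basis S → ℂ := fun x =>
  (if bit (ladderUp base c m x) (base + m) && bit (ladderUp base c m x) q then -1 else 1) * ψ x

/-- The controlled phase flip. -/
def czOp (q q' : ℕ) (ψ : Basis S → ℂ) : Basis S → ℂ := fun x =>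
  (if bit x q && bit x q' then -1 else 1) * ψ x

theorem cz_decomposition {c t : ℕ} (hc : c < S) (ht : t < S) (hne : c ≠ t) (ψ : Basis S → ℂ) :
    had t (cnotN c t (had t ψ)) = czOp c t ψ := by
  funext x
  have hs : (((√2)⁻¹ : ℝ) : ℂ) * (((√2)⁻¹ : ℝ) : ℂ) = 1 / 2 := by
    rw [← Complex.ofReal_mul, ← mul_inv, Real.mul_self_sqrt (by norm_num)]; norm_num
  have hx := setb_bit x t
  simp only [had, cnotN_apply hc ht hne, czOp, bit_setb]
  generalize (((√2)⁻¹ : ℝ) : ℂ) = s at *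
  cases h1 : bit x c <;> cases h2 : bit x t <;> rw [h2] at hx <;>
  simp [hne, hx, ht, setb_setb] <;> grind

/-- On clean work space the last ladder bit is the comparison with all of `c`, which has at most `m`
digits. On other basis states the sign is not controlled; `flip` is used only where amplitudes
vanish there. -/
theorem flip_apply {base q m c : ℕ} (hS : base + m < S) (hm : m ≤ base) (hq : q ≤ base)
    (hc : c < 2 ^ m) (ψ : Basis S → ℂ) {x : Basis S}
    (hx : ∀ q, base ≤ q → q ≤ base + m → bit x q = false) :
    flip base q m c ψ x = (if val x m < c ∧ bit x q = true then -1 else 1) * ψ x := by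
  rw [flip, bit_ladderUp hS hm hx, bit_ladderUp_of_not_mem x (q := q) (by omega),
    Nat.mod_eq_of_lt hc]
  simp

end

end HybridRAM

/-! ### Hadamard transforms, rotations, and the reflection about the prepared state -/

namespace HybridRAM

noncomputable section

open scoped ENNReal

variable {w S : ℕ} {E : Env}

/-! ## Hadamard transforms and rotations -/

theorem sqrt_two_inv_mul_self : (((√2)⁻¹ : ℝ) : ℂ) * (((√2)⁻¹ : ℝ) : ℂ) = 1 / 2 := by
  rw [← Complex.ofReal_mul, ← mul_inv, Real.mul_self_sqrt (by norm_num)]; norm_num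

theorem had_comm {p q : ℕ} (h : p ≠ q) (ψ : Basis S → ℂ) :
    had p (had q ψ) = had q (had p ψ) := by
  funext x
  simp only [had, bit_setb, h, h.symm, false_and, if_false, setb_comm x h]
  ring

theorem had_had {q : ℕ} (h : q < S) (ψ : Basis S → ℂ) : had q (had q ψ) = ψ := by
  funext x
  have hs := sqrt_two_inv_mul_self
  have hx := setb_bit x q
  simp only [had, bit_setb, h, setb_setb]
  generalize (((√2)⁻¹ : ℝ) : ℂ) = s at *
  cases hb : bit x q <;> rw [hb] at hx <;> simp [hx] <;> grind

/-- The only form of linearity that is needed: a reflection is the identity minus twice a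
projection, and it is conjugated by the preparation. -/
theorem had_sub (q : ℕ) (ψ χ : Basis S → ℂ) :
    had q (fun x => ψ x - 2 * χ x) = fun x => had q ψ x - 2 * had q χ x := by
  funext x; simp only [had]; ring

/-- The gate mixes only basis states that differ in qubit `q`, so vanishing on a set closed under
changes of `q` persists. It is applied to states with dirty work space. -/
theorem had_vanish {q : ℕ} {P : Basis S → Prop} (hP : ∀ x v, P x → P (setb x q v))
    {ψ : Basis S → ℂ} (h : ∀ x, P x → ψ x = 0) (x : Basis S) (hx : P x) : had q ψ x = 0 := by
  simp [had, h _ (hP x false hx), h _ (hP x true hx)]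

/-- Hadamard gates on the qubits `0, …, i - 1`. -/
def hadN : ℕ → (Basis S → ℂ) → (Basis S → ℂ)
  | 0, ψ => ψ
  | i + 1, ψ => had i (hadN i ψ)

theorem hadN_had {i q : ℕ} (h : i ≤ q) (ψ : Basis S → ℂ) :
    hadN i (had q ψ) = had q (hadN i ψ) := by
  induction i with
  | zero => rfl
  | succ i ih => rw [hadN, hadN, ih (by omega), had_comm (by omega)]

theorem hadN_hadN {i : ℕ} (h : i ≤ S) (ψ : Basis S → ℂ) : hadN i (hadN i ψ) = ψ := by
  induction i with
  | zero => rfl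
  | succ i ih =>
    rw [hadN, hadN, hadN_had le_rfl, ih (by omega), had_had (by omega)]

theorem hadN_sub (i : ℕ) (ψ χ : Basis S → ℂ) :
    hadN i (fun x => ψ x - 2 * χ x) = fun x => hadN i ψ x - 2 * hadN i χ x := by
  induction i with
  | zero => rfl
  | succ i ih => rw [hadN, ih, had_sub]; rfl

theorem hadN_vanish {i : ℕ} {P : Basis S → Prop} (hP : ∀ x q v, q < i → P x → P (setb x q v))
    {ψ : Basis S → ℂ} (h : ∀ x, P x → ψ x = 0) (x : Basis S) (hx : P x) : hadN i ψ x = 0 := by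
  induction i generalizing x with
  | zero => exact h x hx
  | succ i ih =>
    exact had_vanish (fun x v hx => hP x i v (by omega) hx)
      (fun x hx => ih (fun x q v hq => hP x q v (by omega)) x hx) x hx

/-- Store the number `u` in the first `i` qubits. -/
def setLow (i u : ℕ) (x : Basis S) : Basis S := fun p => if (p : ℕ) < i then u.testBit p else x p

theorem bit_setLow (i u : ℕ) (x : Basis S) (q : ℕ) :
    bit (setLow i u x) q = if q < i ∧ q < S then u.testBit q else bit x q := by
  unfold bit setLow
  by_cases h : q < S
  · by_cases h' : q < i <;> simp [h, h']
  · simp [h]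

theorem setLow_zero (u : ℕ) (x : Basis S) : setLow 0 u x = x := by
  funext p; simp [setLow]

theorem setLow_succ {i u : ℕ} (hu : u < 2 ^ i) (v : Bool) (x : Basis S) :
    setLow (i + 1) (2 ^ i * v.toNat + u) x = setLow i u (setb x i v) := by
  funext p
  simp only [setLow, setb]
  rw [Nat.testBit_two_pow_mul_add _ hu]
  rcases Nat.lt_trichotomy (p : ℕ) i with h | h | h
  · rw [if_pos (by omega), if_pos h, if_pos h]
  · rw [if_pos (by omega), if_neg (by omega), if_neg (by omega), if_pos h, h]
    cases v <;> simp
  · rw [if_neg (by omega), if_neg (by omega), if_neg (by omega)]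

theorem sum_range_two_pow_succ (i : ℕ) (f : ℕ → ℂ) :
    ∑ u ∈ Finset.range (2 ^ (i + 1)), f u =
      ∑ u ∈ Finset.range (2 ^ i), f u + ∑ u ∈ Finset.range (2 ^ i), f (2 ^ i + u) := by
  rw [pow_succ, mul_two, Finset.sum_range_add]

theorem hadN_low {i : ℕ} (φ : Basis S → ℂ) {x : Basis S} (hx : ∀ q < i, bit x q = false) :
    hadN i φ x = ((√2)⁻¹ : ℝ) ^ i * ∑ u ∈ Finset.range (2 ^ i), φ (setLow i u x) := by
  induction i generalizing x with
  | zero => simp [hadN, setLow_zero]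
  | succ i ih =>
    have h : ∀ v, ∀ q < i, bit (setb x i v) q = false := fun v q hq => by
      rw [bit_setb, if_neg (by omega), hx q (by omega)]
    rw [hadN, had, ih (h false), ih (h true), hx i (by omega), sum_range_two_pow_succ]
    have e0 : ∀ u ∈ Finset.range (2 ^ i), φ (setLow (i + 1) u x) =
        φ (setLow i u (setb x i false)) := fun u hu => by
      rw [← setLow_succ (Finset.mem_range.1 hu)]; simp
    have e1 : ∀ u ∈ Finset.range (2 ^ i), φ (setLow (i + 1) (2 ^ i + u) x) =
        φ (setLow i u (setb x i true)) := fun u hu => by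
      rw [← setLow_succ (Finset.mem_range.1 hu)]; simp
    rw [Finset.sum_congr rfl e0, Finset.sum_congr rfl e1]
    simp only [Bool.false_eq_true, if_false]
    ring

/-- The counterpart of `hadN_low`: that lemma computes the overlap with the uniform superposition,
this one spreads the amplitude of the zero string uniformly. Together they describe the conjugate of
the projection on the zero string. -/
theorem hadN_of_low {i : ℕ} (hi : i ≤ S) {φ : Basis S → ℂ}
    (hφ : ∀ x q, q < i → bit x q = true → φ x = 0) (x : Basis S) :
    hadN i φ x = ((√2)⁻¹ : ℝ) ^ i * φ (setLow i 0 x) := by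
  induction i generalizing x with
  | zero => simp [hadN, setLow_zero]
  | succ i ih =>
    have ih := ih (by omega) fun x q hq h => hφ x q (by omega) h
    have e1 : φ (setLow i 0 (setb x i true)) = 0 := by
      refine hφ _ i (by omega) ?_
      rw [bit_setLow, if_neg (by omega), bit_setb, if_pos ⟨rfl, by omega⟩]
    have e0 : setLow i 0 (setb x i false) = setLow (i + 1) 0 x := by
      rw [← setLow_succ (Nat.two_pow_pos i)]; simp
    rw [hadN, had, ih, ih, e1, e0]
    ring

/-- Rotation of a qubit. -/
def rot (θ : ℝ) (q : ℕ) (ψ : Basis S → ℂ) : Basis S → ℂ := fun x =>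
  if bit x q then Real.sin (θ / 2) * ψ (setb x q false) + Real.cos (θ / 2) * ψ (setb x q true)
  else Real.cos (θ / 2) * ψ (setb x q false) - Real.sin (θ / 2) * ψ (setb x q true)

theorem gateN_rot (θ : ℝ) {q : ℕ} (h : q < S) : gateN θ 0 0 q = rot (S := S) θ q := by
  funext ψ x
  rw [gateN_apply h, rot]
  cases bit x q <;> simp [u3Entry, sub_eq_add_neg]

theorem rot_rot_neg {q : ℕ} (h : q < S) (θ : ℝ) (ψ : Basis S → ℂ) :
    rot θ q (rot (-θ) q ψ) = ψ := by
  funext x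
  have hx := setb_bit x q
  have h1 : (Real.sin (θ / 2) : ℂ) ^ 2 + (Real.cos (θ / 2) : ℂ) ^ 2 = 1 := by
    rw [← Complex.ofReal_pow, ← Complex.ofReal_pow, ← Complex.ofReal_add,
      Real.sin_sq_add_cos_sq, Complex.ofReal_one]
  simp only [rot, bit_setb, h, setb_setb, neg_div, Real.sin_neg, Real.cos_neg, Complex.ofReal_neg]
  generalize (Real.sin (θ / 2) : ℂ) = s at *
  generalize (Real.cos (θ / 2) : ℂ) = c at *
  cases hb : bit x q <;> rw [hb] at hx <;> simp [hx] <;> grind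

theorem rot_sub (θ : ℝ) (q : ℕ) (ψ χ : Basis S → ℂ) :
    rot θ q (fun x => ψ x - 2 * χ x) = fun x => rot θ q ψ x - 2 * rot θ q χ x := by
  funext x; simp only [rot]; split_ifs <;> ring

theorem rot_vanish {θ : ℝ} {q : ℕ} {P : Basis S → Prop} (hP : ∀ x v, P x → P (setb x q v))
    {ψ : Basis S → ℂ} (h : ∀ x, P x → ψ x = 0) (x : Basis S) (hx : P x) : rot θ q ψ x = 0 := by
  simp [rot, h _ (hP x false hx), h _ (hP x true hx)]

/-! ## The reflection about the prepared state -/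

/-- The amplitudes of the rotated qubit. -/
def rotAmp (θ : ℝ) (a : Bool) : ℝ := if a then Real.sin (θ / 2) else Real.cos (θ / 2)

theorem prepare_apply {θ : ℝ} {i q : ℕ} (hi : i ≤ q) (hq : q < S) {φ : Basis S → ℂ}
    (h1 : ∀ x p, p < i → bit x p = true → φ x = 0) (h2 : ∀ x, bit x q = true → φ x = 0)
    (x : Basis S) : rot θ q (hadN i φ) x =
      rotAmp θ (bit x q) * (((√2)⁻¹ : ℝ) ^ i * φ (setLow i 0 (setb x q false))) := by
  have e : φ (setLow i 0 (setb x q true)) = 0 := h2 _ (by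
    rw [bit_setLow, if_neg (by omega), bit_setb, if_pos ⟨rfl, hq⟩])
  rw [rot, hadN_of_low (by omega) h1, hadN_of_low (by omega) h1, e, rotAmp]
  split_ifs <;> simp

/-- Reflection about the state that is prepared by Hadamard gates on the first `i` qubits and a
rotation of qubit `m`, where the qubits from `m + 1` on serve as work space. -/
def reflect (θ : ℝ) (i m : ℕ) (ψ : Basis S → ℂ) : Basis S → ℂ :=
  rot θ m (hadN i (xgate true m (flip (m + 1) m i 1 (xgate true m (hadN i (rot (-θ) m ψ))))))

/-- The work space is not empty. -/
def Dirty (m : ℕ) (x : Basis S) : Prop := ∃ q, m < q ∧ bit x q = true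

theorem dirty_setb {m q : ℕ} (h : q ≤ m) (x : Basis S) (v : Bool) :
    Dirty m (setb x q v) ↔ Dirty m x := by
  unfold Dirty
  refine exists_congr fun p => and_congr_right fun hp => ?_
  rw [bit_setb, if_neg (by omega)]

theorem not_dirty {m : ℕ} {x : Basis S} (h : ¬ Dirty m x) {q : ℕ} (hq : m < q) :
    bit x q = false := by
  by_contra hb
  exact h ⟨q, hq, by simpa using hb⟩

/-- With A the preparation, the circuit is A (1 - 2Π) A⁻¹, where Π projects on zeros in the first
`i` qubits and in qubit `m`. The flip with threshold 1 tests for zero in the first `i` qubits, and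
the NOT gates around it turn "qubit `m` is set" into "qubit `m` is not set". The identity part gives
back ψ, and A Π A⁻¹ is the projection on the prepared state. -/
theorem reflect_apply {θ : ℝ} {i m : ℕ} (h1 : 1 ≤ i) (hi : i ≤ m) (hS : m + 1 + i < S)
    {ψ : Basis S → ℂ} (hψ : ∀ x, Dirty m x → ψ x = 0) (x : Basis S) :
    reflect θ i m ψ x = ψ x - 2 * (rotAmp θ (bit x m) * ((1 / 2 : ℝ) ^ i *
      ∑ u ∈ Finset.range (2 ^ i), (rotAmp θ false * ψ (setLow i u (setb x m false)) +
        rotAmp θ true * ψ (setLow i u (setb x m true))))) := by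
  set φ := hadN i (rot (-θ) m ψ) with hφ
  have hv : ∀ x, Dirty m x → φ x = 0 := fun x hx =>
    hadN_vanish (fun x q v hq h => (dirty_setb (by omega) x v).2 h)
      (fun x hx => rot_vanish (fun x v h => (dirty_setb le_rfl x v).2 h) hψ x hx) x hx
  -- The component Π A⁻¹ ψ.
  set χ : Basis S → ℂ := fun x => if val x i = 0 ∧ bit x m = false then φ x else 0 with hχ
  have e : xgate true m (flip (m + 1) m i 1 (xgate true m φ)) = fun x => φ x - 2 * χ x := by
    funext y
    have e1 : setb (setb y m (xor (bit y m) true)) m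
        (xor (bit (setb y m (xor (bit y m) true)) m) true) = y := by
      rw [setb_setb, bit_setb, if_pos ⟨rfl, by omega⟩, Bool.xor_assoc, Bool.xor_self,
        Bool.xor_false, setb_bit]
    -- On dirty states both sides are zero, whatever sign the flip produces.
    by_cases hd : Dirty m y
    · have h0 := hv y hd
      simp only [xgate, flip, e1, hχ, h0]
      simp
    · have hclean : ∀ q, m + 1 ≤ q → q ≤ m + 1 + i →
          bit (setb y m (xor (bit y m) true)) q = false := fun q hq _ => by
        rw [bit_setb, if_neg (by omega)]; exact not_dirty hd (by omega)
      have e2 : val (setb y m (xor (bit y m) true)) i = val y i :=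
        val_congr fun q hq => by rw [bit_setb, if_neg (by omega)]
      have h2 : 1 < 2 ^ i := Nat.one_lt_two_pow (by omega)
      show flip (m + 1) m i 1 (xgate true m φ) (setb y m (xor (bit y m) true)) = _
      have e3 : bit (setb y m (xor (bit y m) true)) m = xor (bit y m) true := by
        rw [bit_setb, if_pos ⟨rfl, by omega⟩]
      rw [flip_apply (by omega) (by omega) (by omega) h2 _ hclean, e2, e3]
      simp only [xgate, e1, hχ, Nat.lt_one_iff]
      cases bit y m <;> by_cases hz : val y i = 0 <;> simp [hz] <;> ring
  have hχ1 : ∀ x p, p < i → bit x p = true → χ x = 0 := fun x p hp hb => by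
    have : val x i ≠ 0 := fun h0 => by
      have := testBit_val x hp
      rw [h0, hb] at this
      simp at this
    simp [hχ, this]
  have hχ2 : ∀ x, bit x m = true → χ x = 0 := fun x hb => by simp [hχ, hb]
  have hz : ∀ q < i, bit (setLow i 0 (setb x m false)) q = false := fun q hq => by
    rw [bit_setLow, if_pos ⟨hq, by omega⟩]; simp
  have hχ3 : χ (setLow i 0 (setb x m false)) = ((√2)⁻¹ : ℝ) ^ i *
      ∑ u ∈ Finset.range (2 ^ i), (rotAmp θ false * ψ (setLow i u (setb x m false)) +
        rotAmp θ true * ψ (setLow i u (setb x m true))) := by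
    have c1 : val (setLow i 0 (setb x m false)) i = 0 :=
      val_eq_of_testBit (Nat.two_pow_pos i) fun q hq => by rw [hz q hq]; simp
    have c2 : bit (setLow i 0 (setb x m false)) m = false := by
      rw [bit_setLow, if_neg (by omega), bit_setb, if_pos ⟨rfl, by omega⟩]
    simp only [hχ, c1, c2, and_self, if_true]
    rw [hφ, hadN_low _ hz]
    congr 1
    refine Finset.sum_congr rfl fun u _ => ?_
    have c3 : ∀ v, setb (setLow i u (setLow i 0 (setb x m false))) m v =
        setLow i u (setb x m v) := fun v => by
      funext p
      simp only [setb, setLow]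
      split_ifs <;> first | rfl | omega
    have c4 : bit (setLow i u (setLow i 0 (setb x m false))) m = false := by
      rw [bit_setLow, if_neg (by omega), c2]
    rw [rot, c4, c3, c3]
    simp [rotAmp, neg_div]
  rw [reflect, ← hφ, e, hadN_sub, rot_sub]
  simp only
  rw [prepare_apply hi (by omega) hχ1 hχ2, hχ3, hφ, hadN_hadN (by omega), rot_rot_neg (by omega)]
  -- One normalisation factor comes from the overlap, the other from preparing the state again.
  have hs : ((1 / 2 : ℝ) : ℂ) ^ i = (((√2)⁻¹ : ℝ) : ℂ) ^ i * (((√2)⁻¹ : ℝ) : ℂ) ^ i := by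
    rw [← mul_pow, sqrt_two_inv_mul_self]; norm_num
  rw [hs]
  ring

end

end HybridRAM

/-! ### Keys, blocks, and the action of one iteration on a block -/

namespace HybridRAM

noncomputable section

open scoped ENNReal

variable {w S : ℕ} {E : Env}

/-! ## The search register -/

/-- The oracle has `l` index and `b` value qubits, blocks have size `2 ^ ν`, and the circuits have
room for the key, a rotated qubit with number `l + b + 1`, and the comparison of keys. -/
structure Layout (E : Env) (S l b ν : ℕ) : Prop where
  idx : E.idxBits = l
  vals : E.valBits = b
  table_lt : ∀ i, E.table i < 2 ^ b
  one_le : 1 ≤ ν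
  le : ν ≤ l
  room : 2 * (l + b + 1) + 1 < S

/-- The key of an array element: its value, ties being broken by the index. -/
def Env.key (E : Env) (l i : ℕ) : ℕ := 2 ^ l * E.table i + i

theorem key_lt {l b ν : ℕ} (L : Layout E S l b ν) {i : ℕ} (hi : i < 2 ^ l) :
    E.key l i < 2 ^ (l + b) := by
  have := L.table_lt i
  unfold Env.key
  rw [pow_add]
  nlinarith [Nat.two_pow_pos l]

theorem bit_queryMap (x : Basis S) {q : ℕ} (hq : q < S) (hS : E.idxBits ≤ S) :
    bit (queryMap E x) q = xor (bit x q) (decide (E.idxBits ≤ q ∧ q < E.idxBits + E.valBits) &&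
      (E.table (val x E.idxBits)).testBit (q - E.idxBits)) := by
  simp only [bit, hq, dite_true, queryMap, indexOf_eq_val hS]

theorem bit_queryMap_of_le {l b ν : ℕ} (L : Layout E S l b ν) (x : Basis S) {q : ℕ}
    (hq : l + b ≤ q) : bit (queryMap E x) q = bit x q := by
  have h1 := L.idx
  have h2 := L.vals
  by_cases h : q < S
  · rw [bit_queryMap x h (by have := L.room; omega), h1, h2]
    have : ¬ (l ≤ q ∧ q < l + b) := by omega
    simp [this]
  · simp [bit, h]

theorem dirty_queryMap {l b ν : ℕ} (L : Layout E S l b ν) (x : Basis S) :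
    Dirty (l + b + 1) (queryMap E x) ↔ Dirty (l + b + 1) x := by
  unfold Dirty
  refine exists_congr fun q => and_congr_right fun hq => ?_
  rw [bit_queryMap_of_le L x (by omega)]

/-- The factor `-1` if the key is below `c` and the rotated qubit is set. -/
def below (key : ℕ) (a : Bool) (c : ℕ) : ℝ := if key < c ∧ a = true then -1 else 1

/-- Phase flips for the keys below `y`, `z`, `c₁`, `c₂`. -/
def oracle (E : Env) (m y z c₁ c₂ : ℕ) (ψ : Basis S → ℂ) : Basis S → ℂ := fun x =>
  flip (m + 1) m m c₂ (flip (m + 1) m m c₁ (flip (m + 1) m m z (flip (m + 1) m m y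
    (fun x => ψ (queryMap E x))))) (queryMap E x)

/-- The first query turns index and value qubits into the key and the second one erases the value.
In between only diagonal operations act, so their signs multiply. On dirty basis states both sides
vanish. -/
theorem oracle_apply {l b ν y z c₁ c₂ : ℕ} (L : Layout E S l b ν)
    (hy : y < 2 ^ (l + b + 1)) (hz : z < 2 ^ (l + b + 1)) (h1 : c₁ < 2 ^ (l + b + 1))
    (h2 : c₂ < 2 ^ (l + b + 1)) {ψ : Basis S → ℂ} (hψ : ∀ x, Dirty (l + b + 1) x → ψ x = 0)
    (x : Basis S) : oracle E (l + b + 1) y z c₁ c₂ ψ x =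
      ((below (val (queryMap E x) (l + b + 1)) (bit x (l + b + 1)) c₂ *
        (below (val (queryMap E x) (l + b + 1)) (bit x (l + b + 1)) c₁ *
        (below (val (queryMap E x) (l + b + 1)) (bit x (l + b + 1)) z *
        below (val (queryMap E x) (l + b + 1)) (bit x (l + b + 1)) y)) : ℝ) : ℂ) * ψ x := by
  have hQ : queryMap E (queryMap E x) = x := queryMap_involutive E x
  by_cases hd : Dirty (l + b + 1) x
  · simp [oracle, flip, hQ, hψ x hd]
  · have hc : ∀ q, l + b + 1 + 1 ≤ q → q ≤ l + b + 1 + 1 + (l + b + 1) →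
        bit (queryMap E x) q = false := fun q hq _ =>
      not_dirty (mt (dirty_queryMap L x).1 hd) (by omega)
    have hr := L.room
    rw [oracle, flip_apply (by omega) (by omega) (by omega) h2 _ hc,
      flip_apply (by omega) (by omega) (by omega) h1 _ hc,
      flip_apply (by omega) (by omega) (by omega) hz _ hc,
      flip_apply (by omega) (by omega) (by omega) hy _ hc, hQ,
      bit_queryMap_of_le L x (q := l + b + 1) (by omega)]
    simp only [below, Complex.ofReal_mul, apply_ite (fun r : ℝ => (r : ℂ)), Complex.ofReal_neg,
      Complex.ofReal_one]
    ring

/-- The basis state of the `u`-th element of block `B` with the rotated qubit `m` in state `a`. -/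
def pt (ν l m B u : ℕ) (a : Bool) : Basis S := fun q =>
  if (q : ℕ) < ν then u.testBit q else if (q : ℕ) < l then B.testBit (q - ν)
  else if (q : ℕ) = m then a else false

theorem bit_pt {ν l m B u : ℕ} {a : Bool} {q : ℕ} (hq : q < S) :
    bit (pt ν l m B u a : Basis S) q = if q < ν then u.testBit q else if q < l then
      B.testBit (q - ν) else if q = m then a else false := by
  simp [bit, hq, pt]

theorem setLow_pt {ν l m B u : ℕ} {a a' : Bool} (hm : l ≤ m) (v : ℕ) :
    setLow ν v (setb (pt ν l m B u a : Basis S) m a') = pt ν l m B v a' := by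
  funext q
  simp only [setLow, setb, pt]
  split_ifs <;> first | rfl | omega

theorem bit_pt_self {ν l b B u : ℕ} {a : Bool} (L : Layout E S l b ν) :
    bit (pt ν l (l + b + 1) B u a : Basis S) (l + b + 1) = a := by
  have := L.room
  have := L.le
  rw [bit_pt (by omega), if_neg (by omega), if_neg (by omega), if_pos rfl]

theorem val_pt {ν l b B u : ℕ} {a : Bool} (L : Layout E S l b ν) (hu : u < 2 ^ ν)
    (hB : 2 ^ ν * B + u < 2 ^ l) :
    val (pt ν l (l + b + 1) B u a : Basis S) l = 2 ^ ν * B + u := by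
  have := L.room
  refine val_eq_of_testBit hB fun q hq => ?_
  rw [bit_pt (by omega), Nat.testBit_two_pow_mul_add _ hu]
  simp [hq]

/-- The index occupies the low positions and the value the next ones, so the register after a query
is the key in binary. Qubit `l + b` stays zero; reading it as well leaves the number unchanged and
makes room for thresholds beyond all keys. -/
theorem val_queryMap_pt {ν l b B u : ℕ} {a : Bool} (L : Layout E S l b ν) (hu : u < 2 ^ ν)
    (hB : 2 ^ ν * B + u < 2 ^ l) {p : ℕ} (h1 : l + b ≤ p) (h2 : p ≤ l + b + 1) :
    val (queryMap E (pt ν l (l + b + 1) B u a : Basis S)) p = E.key l (2 ^ ν * B + u) := by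
  have hr := L.room
  have hle := L.le
  refine val_eq_of_testBit ((key_lt L hB).trans_le (Nat.pow_le_pow_right (by norm_num) h1))
    fun q hq => ?_
  rw [bit_queryMap _ (by omega) (by rw [L.idx]; omega), L.idx, L.vals, val_pt L hu hB, Env.key,
    Nat.testBit_two_pow_mul_add _ hB, bit_pt (by omega)]
  by_cases hql : q < l
  · rw [Nat.testBit_two_pow_mul_add _ hu]
    have : ¬ l ≤ q := by omega
    simp [hql, this]
  · have h3 : ¬ q < ν := by omega
    have h4 : ¬ q = l + b + 1 := by omega
    simp only [h3, hql, h4, if_false, Bool.false_xor]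
    by_cases h5 : q < l + b
    · have : l ≤ q := by omega
      simp [this, h5]
    · simp only [h5, and_false, decide_false, Bool.false_and]
      rw [Nat.testBit_lt_two_pow]
      exact (L.table_lt _).trans_le (Nat.pow_le_pow_right (by norm_num) (by omega))

/-- Basis states that do not belong to block `B`. -/
def Off (ν l m B : ℕ) (x : Basis S) : Prop :=
  ∃ q, ν ≤ q ∧ q < S ∧ q ≠ m ∧ bit x q ≠ bit (pt ν l m B 0 false : Basis S) q

/-- Whether a state belongs to the block does not depend on the first `ν` qubits or the rotated one,
the only qubits along which the reflection moves amplitude. -/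
theorem off_setLow {ν l m B u : ℕ} {a : Bool} (x : Basis S) :
    Off ν l m B (setLow ν u (setb x m a)) ↔ Off ν l m B x := by
  unfold Off
  refine exists_congr fun q => and_congr_right fun h1 => and_congr_right fun _ =>
    and_congr_right fun h2 => ?_
  rw [bit_setLow, if_neg (by omega), bit_setb, if_neg (by omega)]

theorem off_of_dirty {ν l b B : ℕ} (L : Layout E S l b ν) {x : Basis S}
    (h : Dirty (l + b + 1) x) : Off ν l (l + b + 1) B x := by
  obtain ⟨q, h1, h2⟩ := h
  have hle := L.le
  by_cases hq : q < S
  · refine ⟨q, by omega, hq, by omega, ?_⟩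
    rw [h2, bit_pt hq, if_neg (by omega), if_neg (by omega), if_neg (by omega)]
    simp
  · simp [bit, hq] at h2

theorem eq_pt_of_not_off {ν l b B : ℕ} (L : Layout E S l b ν) {x : Basis S}
    (h : ¬ Off ν l (l + b + 1) B x) :
    x = pt ν l (l + b + 1) B (val x ν) (bit x (l + b + 1)) := by
  apply basis_ext
  intro q hq
  have hle := L.le
  by_cases h1 : q < ν
  · rw [bit_pt hq, if_pos h1, testBit_val x h1]
  · by_cases h2 : q = l + b + 1
    · subst h2
      rw [bit_pt_self L]
    · by_contra h3
      refine h ⟨q, by omega, hq, h2, fun h4 => h3 ?_⟩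
      rw [h4, bit_pt hq, bit_pt hq]
      simp [h1, h2]

/-- The amplitudes `ψ` are supported on block `B` and given there by `g`. -/
def IsEmb (ν l m B : ℕ) (ψ : Basis S → ℂ) (g : ℕ → Bool → ℝ) : Prop :=
  (∀ u < 2 ^ ν, ∀ a, ψ (pt ν l m B u a) = g u a) ∧ ∀ x, Off ν l m B x → ψ x = 0

/-- One iteration of amplitude amplification within a block; `sg` are the phases of the oracle. -/
def gStep (sg : ℕ → Bool → ℝ) (θ : ℝ) (ν : ℕ) (g : ℕ → Bool → ℝ) (u : ℕ) (a : Bool) : ℝ :=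
  sg u a * g u a - 2 * (rotAmp θ a * ((1 / 2) ^ ν * ∑ u ∈ Finset.range (2 ^ ν),
    (rotAmp θ false * (sg u false * g u false) + rotAmp θ true * (sg u true * g u true))))

/-- The phases of the oracle on the elements of a block. -/
def phases (E : Env) (l ν B y z c₁ c₂ u : ℕ) (a : Bool) : ℝ :=
  below (E.key l (2 ^ ν * B + u)) a c₂ * (below (E.key l (2 ^ ν * B + u)) a c₁ *
    (below (E.key l (2 ^ ν * B + u)) a z * below (E.key l (2 ^ ν * B + u)) a y))

/-- The oracle is diagonal, and the reflection mixes only states of the same block. The quantum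
evolution thus reduces to the real recursion `gStep`. -/
theorem IsEmb.step {l b ν B y z c₁ c₂ : ℕ} {θ : ℝ} (L : Layout E S l b ν)
    (hB : 2 ^ ν * (B + 1) ≤ 2 ^ l)
    (hy : y < 2 ^ (l + b + 1)) (hz : z < 2 ^ (l + b + 1)) (h1 : c₁ < 2 ^ (l + b + 1))
    (h2 : c₂ < 2 ^ (l + b + 1)) {ψ : Basis S → ℂ} {g : ℕ → Bool → ℝ}
    (h : IsEmb ν l (l + b + 1) B ψ g) :
    IsEmb ν l (l + b + 1) B (reflect θ ν (l + b + 1) (oracle E (l + b + 1) y z c₁ c₂ ψ))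
      (gStep (phases E l ν B y z c₁ c₂) θ ν g) := by
  have hle := L.le
  have hr := L.room
  have hd : ∀ x, Dirty (l + b + 1) x → ψ x = 0 := fun x hx => h.2 x (off_of_dirty L hx)
  have ho := oracle_apply L hy hz h1 h2 hd
  have hod : ∀ x, Dirty (l + b + 1) x → oracle E (l + b + 1) y z c₁ c₂ ψ x = 0 := fun x hx => by
    rw [ho, hd x hx, mul_zero]
  have hoff : ∀ x, Off ν l (l + b + 1) B x → oracle E (l + b + 1) y z c₁ c₂ ψ x = 0 :=
    fun x hx => by rw [ho, h.2 x hx, mul_zero]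
  have hlt : ∀ u < 2 ^ ν, 2 ^ ν * B + u < 2 ^ l := fun u hu => by
    have : 2 ^ ν * (B + 1) = 2 ^ ν * B + 2 ^ ν := by ring
    omega
  have hpt : ∀ u < 2 ^ ν, ∀ a, oracle E (l + b + 1) y z c₁ c₂ ψ (pt ν l (l + b + 1) B u a) =
      ((phases E l ν B y z c₁ c₂ u a * g u a : ℝ) : ℂ) := fun u hu a => by
    rw [ho, h.1 u hu, val_queryMap_pt L hu (hlt u hu) (by omega) le_rfl, bit_pt_self L, phases]
    push_cast; ring
  have hrf := reflect_apply (θ := θ) L.one_le (m := l + b + 1) (by omega) (by omega) hod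
  constructor
  · intro u hu a
    rw [hrf, hpt u hu, bit_pt_self L, gStep]
    have : ∀ v ∈ Finset.range (2 ^ ν), (rotAmp θ false * oracle E (l + b + 1) y z c₁ c₂ ψ
        (setLow ν v (setb (pt ν l (l + b + 1) B u a) (l + b + 1) false)) +
        rotAmp θ true * oracle E (l + b + 1) y z c₁ c₂ ψ
        (setLow ν v (setb (pt ν l (l + b + 1) B u a) (l + b + 1) true)) : ℂ) =
        ((rotAmp θ false * (phases E l ν B y z c₁ c₂ v false * g v false) +
          rotAmp θ true * (phases E l ν B y z c₁ c₂ v true * g v true) : ℝ) : ℂ) := fun v hv => by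
      rw [setLow_pt (by omega), setLow_pt (by omega), hpt v (Finset.mem_range.1 hv),
        hpt v (Finset.mem_range.1 hv)]
      push_cast; ring
    rw [Finset.sum_congr rfl this]
    push_cast
    ring
  · intro x hx
    rw [hrf, hoff x hx, Finset.sum_eq_zero]
    · simp
    · intro u _
      rw [hoff _ ((off_setLow x).2 hx), hoff _ ((off_setLow x).2 hx)]
      simp

/-- The prepared state. -/
def prepared (θ : ℝ) (ν l m B : ℕ) : Basis S → ℂ :=
  rot θ m (hadN ν (Pi.single (pt ν l m B 0 false) 1))

theorem isEmb_prepared {l b ν B : ℕ} (θ : ℝ) (L : Layout E S l b ν) :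
    IsEmb (S := S) ν l (l + b + 1) B (prepared θ ν l (l + b + 1) B)
      (fun _ a => rotAmp θ a * (√2)⁻¹ ^ ν) := by
  have hle := L.le
  have hr := L.room
  have h0 : ∀ x : Basis S, x ≠ pt ν l (l + b + 1) B 0 false →
      (Pi.single (pt ν l (l + b + 1) B 0 false) 1 : Basis S → ℂ) x = 0 :=
    fun x hx => Pi.single_eq_of_ne hx 1
  have hp := prepare_apply (θ := θ) (i := ν) (q := l + b + 1) (by omega) (by omega : l + b + 1 < S)
    (φ := Pi.single (pt ν l (l + b + 1) B 0 false) 1)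
    (fun x p hp hb => h0 x fun h => by rw [h, bit_pt (by omega), if_pos hp] at hb; simp at hb)
    (fun x hb => h0 x fun h => by rw [h, bit_pt_self L] at hb; simp at hb)
  constructor
  · intro u hu a
    rw [prepared, hp, bit_pt_self L, setLow_pt (by omega), Pi.single_eq_same]
    push_cast; ring
  · intro x hx
    rw [prepared, hp, h0, mul_zero, mul_zero]
    intro h
    have := (off_setLow (ν := ν) (l := l) (m := l + b + 1) (B := B) (u := 0) (a := false) x).2 hx
    rw [h] at this
    obtain ⟨q, _, _, _, h4⟩ := this
    exact h4 rfl

/-- A sum over all basis states of a function supported on a block. -/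
theorem sum_block {l b ν B : ℕ} (L : Layout E S l b ν) {R : Type*} [AddCommMonoid R]
    {f : Basis S → R} (hf : ∀ x, Off ν l (l + b + 1) B x → f x = 0) :
    ∑ x, f x = ∑ u ∈ Finset.range (2 ^ ν), ∑ a, f (pt ν l (l + b + 1) B u a) := by
  rw [← Finset.sum_product']
  symm
  refine Finset.sum_of_injOn (fun p : ℕ × Bool => pt ν l (l + b + 1) B p.1 p.2) ?_ ?_ ?_ ?_
  · rintro ⟨u, a⟩ hu ⟨v, a'⟩ hv h
    simp only [Finset.coe_product, Set.mem_prod, Finset.coe_range, Set.mem_Iio] at hu hv h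
    have e1 : a = a' := by
      rw [← bit_pt_self (S := S) (B := B) (u := u) (a := a) L, h, bit_pt_self L]
    have e2 : u = v := by
      apply Nat.eq_of_testBit_eq
      intro q
      by_cases hq : q < ν
      · have hS : q < S := by have := L.room; have := L.le; omega
        have := congrArg (fun x => bit x q) h
        simpa only [bit_pt hS, if_pos hq] using this
      · rw [Nat.testBit_lt_two_pow (hu.1.trans_le (Nat.pow_le_pow_right (by norm_num) (by omega))),
          Nat.testBit_lt_two_pow (hv.1.trans_le (Nat.pow_le_pow_right (by norm_num) (by omega)))]
    rw [e1, e2]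
  · intro _ _; simp
  · intro x _ hx
    apply hf
    by_contra h
    refine hx ⟨(val x ν, bit x (l + b + 1)), ?_, (eq_pt_of_not_off L h).symm⟩
    simp [val_lt]
  · intro _ _; rfl

end

end HybridRAM

/-! ### Trigonometry of exact and approximate amplitude amplification -/

namespace HybridRAM

noncomputable section

open scoped ENNReal

/-! ## Amplitude amplification -/

/-- The amplitudes after `j` iterations. -/
def gAmp (sg : ℕ → Bool → ℝ) (θ : ℝ) (ν : ℕ) : ℕ → ℕ → Bool → ℝ
  | 0 => fun _ a => rotAmp θ a * (√2)⁻¹ ^ ν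
  | j + 1 => gStep sg θ ν (gAmp sg θ ν j)

/-- The phases that mark the elements satisfying `mk`. -/
def marking (mk : ℕ → Bool) (u : ℕ) (a : Bool) : ℝ := if a && mk u then -1 else 1

theorem rotAmp_sq (θ : ℝ) : rotAmp θ false ^ 2 + rotAmp θ true ^ 2 = 1 := by
  simp [rotAmp, Real.cos_sq_add_sin_sq]

/-- The iteration preserves the plane spanned by the marked and the unmarked part of the prepared
state, which makes the angle ϑ with the unmarked part. Each iteration rotates by 2ϑ. The sign (-1)^j
appears because the reflection is 1 - 2|s⟩⟨s| and not its negative. -/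
theorem gAmp_eq {mk : ℕ → Bool} {θ ϑ : ℝ} {ν t : ℕ}
    (ht : ((Finset.range (2 ^ ν)).filter fun u => mk u = true).card = t) (hs : Real.sin ϑ ≠ 0)
    (hc : Real.cos ϑ ≠ 0) (h : Real.sin ϑ ^ 2 = rotAmp θ true ^ 2 * (t / 2 ^ ν))
    (j u : ℕ) (a : Bool) (sg : ℕ → Bool → ℝ) (hsg : ∀ u < 2 ^ ν, ∀ a, sg u a = marking mk u a)
    (hu : u < 2 ^ ν) :
    gAmp sg θ ν j u a = rotAmp θ a * (√2)⁻¹ ^ ν * ((-1) ^ j *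
      if (a && mk u) = true then Real.sin ((2 * j + 1) * ϑ) / Real.sin ϑ
        else Real.cos ((2 * j + 1) * ϑ) / Real.cos ϑ) := by
  induction j generalizing u a with
  | zero =>
    simp [gAmp, hs, hc]
  | succ j ih =>
    set φ := (2 * (j : ℝ) + 1) * ϑ with hφ
    have e1 : (2 * ((j + 1 : ℕ) : ℝ) + 1) * ϑ = φ + 2 * ϑ := by rw [hφ]; push_cast; ring
    have hr := rotAmp_sq θ
    have hN : (0 : ℝ) < 2 ^ ν := by positivity
    -- The overlap with the prepared state after the phase flip; it is proportional to cos (φ + ϑ),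
    -- since the marked part has changed its sign.
    have hsum : ∑ v ∈ Finset.range (2 ^ ν), (rotAmp θ false * (sg v false *
        gAmp sg θ ν j v false) + rotAmp θ true * (sg v true *
        gAmp sg θ ν j v true)) = (√2)⁻¹ ^ ν * (-1) ^ j * 2 ^ ν *
          (Real.cos φ * Real.cos ϑ - Real.sin φ * Real.sin ϑ) := by
      have e : ∀ v ∈ Finset.range (2 ^ ν), (rotAmp θ false * (sg v false *
        gAmp sg θ ν j v false) + rotAmp θ true * (sg v true *
        gAmp sg θ ν j v true)) = (√2)⁻¹ ^ ν * (-1) ^ j *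
          (rotAmp θ false ^ 2 * (Real.cos φ / Real.cos ϑ) + rotAmp θ true ^ 2 *
            if mk v = true then - (Real.sin φ / Real.sin ϑ) else Real.cos φ / Real.cos ϑ) := by
        intro v hv
        have hv := Finset.mem_range.1 hv
        rw [ih v false hv, ih v true hv, hsg v hv, hsg v hv]
        cases hm : mk v <;> simp [marking, hm] <;> ring
      rw [Finset.sum_congr rfl e, ← Finset.mul_sum, Finset.sum_add_distrib, ← Finset.mul_sum,
        ← Finset.mul_sum, Finset.sum_ite, Finset.sum_const, Finset.sum_const, Finset.sum_const, ht]
      have e2 : ((Finset.range (2 ^ ν)).filter fun u => ¬ mk u = true).card = (2 : ℝ) ^ ν - t := by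
        have := Finset.card_filter_add_card_filter_not (s := Finset.range (2 ^ ν))
          (fun u => mk u = true)
        rw [ht, Finset.card_range] at this
        have h2 : ((t : ℝ) + (((Finset.range (2 ^ ν)).filter fun u => ¬ mk u = true).card : ℝ)) =
            2 ^ ν := by exact_mod_cast this
        linarith
      rw [nsmul_eq_mul, nsmul_eq_mul, nsmul_eq_mul, e2, Finset.card_range]
      have h3 : rotAmp θ true ^ 2 * t = Real.sin ϑ ^ 2 * 2 ^ ν := by rw [h]; field_simp
      have h4 : rotAmp θ false ^ 2 = 1 - rotAmp θ true ^ 2 := by linarith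
      have h5 : Real.sin ϑ ^ 2 = 1 - Real.cos ϑ ^ 2 := by
        have := Real.sin_sq_add_cos_sq ϑ; linarith
      push_cast
      have h6 : rotAmp θ false ^ 2 * ((2 : ℝ) ^ ν * (Real.cos φ / Real.cos ϑ)) +
          rotAmp θ true ^ 2 * (t * -(Real.sin φ / Real.sin ϑ) + (2 ^ ν - t) *
            (Real.cos φ / Real.cos ϑ)) = 2 ^ ν * (Real.cos φ / Real.cos ϑ) -
          (rotAmp θ true ^ 2 * t) * (Real.cos φ / Real.cos ϑ) -
          (rotAmp θ true ^ 2 * t) * (Real.sin φ / Real.sin ϑ) := by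
        rw [h4]; ring
      have h7 : (Real.cos φ / Real.cos ϑ) * (1 - Real.sin ϑ ^ 2) = Real.cos φ * Real.cos ϑ := by
        rw [h5]; field_simp; ring
      have h8 : Real.sin ϑ ^ 2 * (Real.sin φ / Real.sin ϑ) = Real.sin φ * Real.sin ϑ := by
        field_simp
      rw [h6, h3]
      linear_combination (√2)⁻¹ ^ ν * (-1) ^ j * 2 ^ ν * (h7 - h8)
    rw [gAmp, gStep, hsum, ih u a hu, hsg u hu, e1, Real.sin_add, Real.cos_add, Real.sin_two_mul,
      Real.cos_two_mul]
    have e3 : (1 / 2 : ℝ) ^ ν * ((√2)⁻¹ ^ ν * (-1) ^ j * 2 ^ ν *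
        (Real.cos φ * Real.cos ϑ - Real.sin φ * Real.sin ϑ)) =
        (√2)⁻¹ ^ ν * (-1) ^ j * (Real.cos φ * Real.cos ϑ - Real.sin φ * Real.sin ϑ) := by
      rw [one_div, inv_pow]; field_simp
    rw [e3]
    have h5 : Real.cos ϑ ^ 2 = 1 - Real.sin ϑ ^ 2 := by
      have := Real.sin_sq_add_cos_sq ϑ; linarith
    cases hm : (a && mk u)
    · simp only [marking, hm, Bool.false_eq_true, if_false, pow_succ (-1 : ℝ)]
      field_simp
      ring
    · simp only [marking, hm, if_true, pow_succ (-1 : ℝ)]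
      field_simp
      rw [h5]
      ring

variable {mk : ℕ → Bool} {sg : ℕ → Bool → ℝ} {ν t T j : ℕ}

/-- The angle by which the extra qubit is rotated if `T` elements are expected to be marked. -/
def extraAngle (j ν T : ℕ) : ℝ :=
  2 * Real.arcsin (Real.sin (Real.pi / (2 * (2 * j + 1))) * √(2 ^ ν / T))

/-- The argument of arcsin must not exceed 1. By sin x ≤ x and √(2^ν/T) ≤ j it is at most
πj/(2(2j+1)), and π ≤ 4 suffices. -/
theorem rotAmp_extraAngle (hj : 2 ^ ν ≤ j * j * T) (hT : 1 ≤ T) :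
    rotAmp (extraAngle j ν T) true = Real.sin (Real.pi / (2 * (2 * j + 1))) * √(2 ^ ν / T) := by
  have hT' : (0 : ℝ) < T := by exact_mod_cast hT
  have h1 : √((2 : ℝ) ^ ν / T) ≤ j := by
    refine Real.sqrt_le_iff.2 ⟨by positivity, ?_⟩
    rw [div_le_iff₀ hT']
    calc ((2 : ℝ) ^ ν) ≤ j * j * T := by exact_mod_cast hj
      _ = _ := by ring
  have hpi := Real.pi_pos
  have hpi4 := Real.pi_le_four
  have hj0 : (0 : ℝ) ≤ j := by positivity
  have h2 : Real.sin (Real.pi / (2 * (2 * j + 1))) ≤ Real.pi / (2 * (2 * j + 1)) :=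
    Real.sin_le (by positivity)
  have h3 : 0 ≤ Real.sin (Real.pi / (2 * (2 * j + 1))) := by
    refine Real.sin_nonneg_of_nonneg_of_le_pi (by positivity) ?_
    rw [div_le_iff₀ (by positivity)]
    nlinarith
  have h4 : Real.sin (Real.pi / (2 * (2 * j + 1))) * √(2 ^ ν / T) ≤ 1 := by
    calc _ ≤ Real.pi / (2 * (2 * j + 1)) * j := by
            refine mul_le_mul h2 h1 (Real.sqrt_nonneg _) (by positivity)
      _ ≤ 1 := by
        rw [div_mul_eq_mul_div, div_le_one (by positivity)]
        nlinarith
  have h5 : 0 ≤ Real.sin (Real.pi / (2 * (2 * j + 1))) * √((2 : ℝ) ^ ν / T) :=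
    mul_nonneg h3 (Real.sqrt_nonneg _)
  rw [rotAmp, extraAngle, if_pos rfl, mul_div_cancel_left₀ _ (two_ne_zero),
    Real.sin_arcsin (by linarith) h4]

/-- Put γ = π/(2(2j+1)). The extra rotation gives sin ϑ = sin γ · √(t/T). If t = T then ϑ = γ and
(2j+1)ϑ = π/2, so the amplification is exact. If t ≥ T/2 then γ/2 ≤ ϑ ≤ γ, so (2j+1)ϑ lies between
π/4 and π/2. -/
theorem exists_angle (hj : 2 ^ ν ≤ j * j * T) (ht : 1 ≤ t) (htT : t ≤ T) :
    ∃ ϑ : ℝ, 0 < Real.sin ϑ ∧ 0 < Real.cos ϑ ∧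
      Real.sin ϑ ^ 2 = rotAmp (extraAngle j ν T) true ^ 2 * (t / 2 ^ ν) ∧
      rotAmp (extraAngle j ν T) true ^ 2 * (1 / 2) ^ ν = Real.sin ϑ ^ 2 / t ∧
      (t = T → Real.cos ((2 * j + 1) * ϑ) = 0) ∧
      (T ≤ 2 * t → 1 / 2 ≤ Real.sin ((2 * j + 1) * ϑ) ^ 2) := by
  set γ := Real.pi / (2 * (2 * (j : ℝ) + 1)) with hγ
  have hpi := Real.pi_pos
  have hT' : (0 : ℝ) < T := by exact_mod_cast (by omega : 0 < T)
  have ht' : (0 : ℝ) < t := by exact_mod_cast (by omega : 0 < t)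
  have htT' : (t : ℝ) ≤ T := by exact_mod_cast htT
  have hN : (0 : ℝ) < 2 ^ ν := by positivity
  have hj1 : 1 ≤ j := by
    by_contra h
    have : j = 0 := by omega
    subst this
    have := Nat.two_pow_pos ν
    omega
  have hj1' : (1 : ℝ) ≤ j := by exact_mod_cast hj1
  have hγ0 : 0 < γ := by positivity
  have hγ1 : γ ≤ Real.pi / 6 := by
    rw [hγ]; gcongr; linarith
  have hsγ : 0 < Real.sin γ := Real.sin_pos_of_pos_of_lt_pi hγ0 (by linarith)
  set q := √((t : ℝ) / T) with hq
  have hq0 : 0 < q := Real.sqrt_pos.2 (by positivity)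
  have hq1 : q ≤ 1 := Real.sqrt_le_one.2 (by rw [div_le_one hT']; exact htT')
  have hq2 : q ^ 2 = t / T := Real.sq_sqrt (by positivity)
  have hsq : 0 < Real.sin γ * q := by positivity
  have hsq1 : Real.sin γ * q ≤ Real.sin γ := by nlinarith
  have hs1 := Real.sin_le_one γ
  have hsin : Real.sin (Real.arcsin (Real.sin γ * q)) = Real.sin γ * q :=
    Real.sin_arcsin (by linarith) (by linarith)
  have hle : Real.arcsin (Real.sin γ * q) ≤ γ := by
    calc _ ≤ Real.arcsin (Real.sin γ) := Real.monotone_arcsin hsq1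
      _ = γ := Real.arcsin_sin (by linarith) (by linarith)
  have hpos : 0 < Real.arcsin (Real.sin γ * q) := Real.arcsin_pos.2 hsq
  have hrot := rotAmp_extraAngle hj (by omega)
  have hr2 : rotAmp (extraAngle j ν T) true ^ 2 = Real.sin γ ^ 2 * (2 ^ ν / T) := by
    rw [hrot, mul_pow, Real.sq_sqrt (by positivity)]
  have hphi : (2 * (j : ℝ) + 1) * γ = Real.pi / 2 := by
    rw [hγ]; field_simp
  refine ⟨Real.arcsin (Real.sin γ * q), by rw [hsin]; exact hsq,
    Real.cos_pos_of_mem_Ioo ⟨by linarith, by linarith⟩, ?_, ?_, ?_, ?_⟩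
  · rw [hsin, mul_pow, hq2, hr2]; field_simp
  · rw [hsin, mul_pow, hq2, hr2, one_div, inv_pow]; field_simp
  · intro h
    have : q = 1 := by rw [hq, h, div_self hT'.ne', Real.sqrt_one]
    rw [this, mul_one, Real.arcsin_sin (by linarith) (by linarith), hphi, Real.cos_pi_div_two]
  · intro h
    have h' : (T : ℝ) ≤ 2 * t := by exact_mod_cast h
    -- In sin γ = 2 sin (γ/2) cos (γ/2) both cos (γ/2) and √(t/T) are at least √2/2, so sin γ ·
    -- √(t/T) ≥ sin (γ/2).
    have hlow : γ / 2 ≤ Real.arcsin (Real.sin γ * q) := by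
      rw [Real.le_arcsin_iff_sin_le' ⟨by linarith, by linarith⟩]
      have h1 : Real.sin γ = 2 * Real.sin (γ / 2) * Real.cos (γ / 2) := by
        rw [← Real.sin_two_mul]; congr 1; ring
      have h2 : √2 / 2 ≤ Real.cos (γ / 2) := by
        rw [← Real.cos_pi_div_four]
        exact Real.cos_le_cos_of_nonneg_of_le_pi (by linarith) (by linarith) (by linarith)
      have h3 : √2 / 2 ≤ q := by
        rw [hq]
        refine Real.le_sqrt_of_sq_le ?_
        rw [div_pow, Real.sq_sqrt (by norm_num), le_div_iff₀ hT']
        linarith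
      have h4 : 0 ≤ Real.sin (γ / 2) :=
        Real.sin_nonneg_of_nonneg_of_le_pi (by linarith) (by linarith)
      have h5 : (1 : ℝ) / 2 ≤ Real.cos (γ / 2) * q := by
        calc (1 : ℝ) / 2 = √2 / 2 * (√2 / 2) := by
              rw [div_mul_div_comm, Real.mul_self_sqrt (by norm_num)]; norm_num
          _ ≤ _ := mul_le_mul h2 h3 (by positivity) (le_trans (by positivity) h2)
      rw [h1]
      nlinarith
    have h1 : Real.pi / 4 ≤ (2 * (j : ℝ) + 1) * Real.arcsin (Real.sin γ * q) := by
      calc Real.pi / 4 = (2 * (j : ℝ) + 1) * (γ / 2) := by linarith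
        _ ≤ _ := by gcongr
    have h2 : (2 * (j : ℝ) + 1) * Real.arcsin (Real.sin γ * q) ≤ Real.pi / 2 := by
      rw [← hphi]; gcongr
    have h3 := Real.sin_le_sin_of_le_of_le_pi_div_two (by linarith) h2 h1
    rw [Real.sin_pi_div_four] at h3
    calc (1 : ℝ) / 2 = (√2 / 2) ^ 2 := by
          rw [div_pow, Real.sq_sqrt (by norm_num)]; norm_num
      _ ≤ _ := by gcongr

/-- The final angle is π/2, so its cosine, the amplitude of everything unmarked, is zero. States
whose extra qubit is not set count as unmarked. -/
theorem gAmp_exact (ht : ((Finset.range (2 ^ ν)).filter fun u => mk u = true).card = T)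
    (hT : 1 ≤ T) (hj : 2 ^ ν ≤ j * j * T) (hsg : ∀ u < 2 ^ ν, ∀ a, sg u a = marking mk u a)
    {u : ℕ} (hu : u < 2 ^ ν) {a : Bool} (h : (a && mk u) = false) :
    gAmp sg (extraAngle j ν T) ν j u a = 0 := by
  obtain ⟨ϑ, h1, h2, h3, -, h4, -⟩ := exists_angle hj hT le_rfl
  rw [gAmp_eq ht h1.ne' h2.ne' h3 j u a sg hsg hu, h, h4 rfl]
  simp

/-- The marked part has probability at least sin² (π/4) = 1/2, shared equally by the `t` marked
elements. -/
theorem gAmp_half (ht : ((Finset.range (2 ^ ν)).filter fun u => mk u = true).card = t)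
    (ht1 : 1 ≤ t) (htT : t ≤ T) (hTt : T ≤ 2 * t) (hj : 2 ^ ν ≤ j * j * T)
    (hsg : ∀ u < 2 ^ ν, ∀ a, sg u a = marking mk u a)
    {u : ℕ} (hu : u < 2 ^ ν) (h : mk u = true) :
    1 / (2 * t : ℝ) ≤ gAmp sg (extraAngle j ν T) ν j u true ^ 2 := by
  obtain ⟨ϑ, h1, h2, h3, h4, -, h5⟩ := exists_angle hj ht1 htT
  have ht' : (0 : ℝ) < t := by exact_mod_cast ht1
  rw [gAmp_eq ht h1.ne' h2.ne' h3 j u true sg hsg hu, h]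
  simp only [Bool.and_self, if_true]
  have e : ((√2)⁻¹ ^ ν) ^ 2 = (1 / 2 : ℝ) ^ ν := by
    rw [← pow_mul, mul_comm, pow_mul, inv_pow, Real.sq_sqrt (by norm_num), one_div]
  have e2 : (rotAmp (extraAngle j ν T) true * (√2)⁻¹ ^ ν * ((-1) ^ j *
      (Real.sin ((2 * j + 1) * ϑ) / Real.sin ϑ))) ^ 2 =
      (rotAmp (extraAngle j ν T) true ^ 2 * (1 / 2) ^ ν) *
      (Real.sin ((2 * j + 1) * ϑ) ^ 2 / Real.sin ϑ ^ 2) := by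
    have e1 : ((-1 : ℝ) ^ j) ^ 2 = 1 := by rw [← pow_mul, mul_comm, pow_mul]; norm_num
    rw [mul_pow, mul_pow, mul_pow, e, e1, one_mul, div_pow (Real.sin _)]
  rw [e2, h4]
  calc 1 / (2 * t : ℝ) = (1 / 2) / t := by ring
    _ ≤ Real.sin ((2 * j + 1) * ϑ) ^ 2 / t := by gcongr; exact h5 hTt
    _ = _ := by field_simp

end

end HybridRAM

/-! ### Programs that write down elementary gates and comparison steps -/

namespace HybridRAM

noncomputable section

open scoped ENNReal

variable {w S : ℕ} {E : Env}

/-! ## Code that writes down gates -/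

infixr:60 " ;; " => Program.seq

namespace Ex

instance : Add Ex := ⟨.bin .add⟩
instance : Sub Ex := ⟨.bin .sub⟩
instance : Mul Ex := ⟨.bin .mul⟩
instance : Div Ex := ⟨.bin .div⟩
instance : Mod Ex := ⟨.bin .mod⟩

variable {V : ℕ → ℕ} {w : ℕ} (a b : Ex) (m r : ℕ)

@[simp] theorem ev_add : (a + b).ev V = a.ev V + b.ev V := rfl
@[simp] theorem ev_sub : (a - b).ev V = a.ev V - b.ev V := rfl
@[simp] theorem ev_mul : (a * b).ev V = a.ev V * b.ev V := rfl
@[simp] theorem ev_div : (a / b).ev V = a.ev V / b.ev V := rfl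
@[simp] theorem ev_mod : (a % b).ev V = a.ev V % b.ev V := rfl
@[simp] theorem ev_lit : (lit m).ev V = m := rfl
@[simp] theorem ev_v : (v r).ev V = V r := rfl
@[simp] theorem ev_shl : (bin .shl a b).ev V = a.ev V * 2 ^ b.ev V := rfl
@[simp] theorem ev_shr : (bin .shr a b).ev V = a.ev V / 2 ^ b.ev V := rfl
@[simp] theorem ev_lt : (bin .lt a b).ev V = if a.ev V < b.ev V then 1 else 0 := rfl
@[simp] theorem ok_add : (a + b).Ok w V ↔ a.Ok w V ∧ b.Ok w V := by
  show _ ∧ _ ∧ True ↔ _; simp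
@[simp] theorem ok_mul : (a * b).Ok w V ↔ a.Ok w V ∧ b.Ok w V := by
  show _ ∧ _ ∧ True ↔ _; simp
@[simp] theorem ok_sub : (a - b).Ok w V ↔ a.Ok w V ∧ b.Ok w V ∧ b.ev V ≤ a.ev V := Iff.rfl
@[simp] theorem ok_div : (a / b).Ok w V ↔
    a.Ok w V ∧ b.Ok w V ∧ a.ev V < 2 ^ w ∧ b.ev V < 2 ^ w := Iff.rfl
@[simp] theorem ok_mod : (a % b).Ok w V ↔
    a.Ok w V ∧ b.Ok w V ∧ a.ev V < 2 ^ w ∧ b.ev V < 2 ^ w := Iff.rfl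
@[simp] theorem ok_lit : (lit m).Ok w V := trivial
@[simp] theorem ok_v : (v r).Ok w V ↔ r < 100 := Iff.rfl
@[simp] theorem ok_shl : (bin .shl a b).Ok w V ↔ a.Ok w V ∧ b.Ok w V ∧ b.ev V < 2 ^ w := Iff.rfl
@[simp] theorem ok_shr : (bin .shr a b).Ok w V ↔
    a.Ok w V ∧ b.Ok w V ∧ a.ev V < 2 ^ w ∧ b.ev V < 2 ^ w := Iff.rfl
@[simp] theorem ok_lt : (bin .lt a b).Ok w V ↔
    a.Ok w V ∧ b.Ok w V ∧ a.ev V < 2 ^ w ∧ b.ev V < 2 ^ w := Iff.rfl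

end Ex

/-- An assignment of known value and cost. -/
theorem det_set {σ : View w S} {r : ℕ} {e : Ex} (v t : ℕ) (h : e.Ok w σ.var)
    (hv : e.ev σ.var = v) (hr : r < 100 := by norm_num) (ht : e.cost + 1 ≤ t := by decide) :
    Det E (assign r e) σ ((σ.set r v).tick t) := by
  subst hv
  refine (det_assign hr h).weaken (fun _ _ => rfl) rfl rfl (.inr rfl) ?_ le_rfl
  simp only [View.time_tick, View.time_set]
  omega

/-- Set a register to zero. -/
def zero (r : ℕ) : Program := .instr (.const r 0)

theorem det_zero {σ : View w S} {r : ℕ} (hr : r < 100) :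
    Det E (zero r) σ ((σ.set r 0).tick 1) := by
  intro s hs
  refine ⟨_, by simp only [zero, Program.exec, Instr.exec, PMF.pure_map]; rfl, rep_tick ?_ 1⟩
  refine ⟨fun r' hr' => ?_, hs.mem, hs.psi, hs.out, hs.time, hs.queries⟩
  by_cases h' : r' = r
  · subst h'; simp [State.setReg]
  · simp [State.setReg, h', hs.reg r' hr']

def hadP (s : ℕ) : Program := .instr (.gate (.div .pi (.lit 2)) (.lit 0) .pi s)
def tP (s : ℕ) : Program := .instr (.gate (.lit 0) (.lit 0) (.div .pi (.lit 4)) s)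
def tdgP (s : ℕ) : Program :=
  .instr (.gate (.lit 0) (.lit 0) (.sub (.lit 0) (.div .pi (.lit 4))) s)
/-- The NOT gate if register `r` holds `1`. -/
def xP (r s : ℕ) : Program := .instr (.gate (.mul .pi (.reg r)) (.lit 0) (.mul .pi (.reg r)) s)
def cnotP (s t : ℕ) : Program := .instr (.cnot s t)

theorem det_hadP {σ : View w S} {s q : ℕ} (hs : s < 100) (hS : S < 2 ^ w) (hq : σ.var s = q)
    (h : q < S) : Det E (hadP s) σ ((σ.act (had q)).tick 10) := by
  subst hq
  refine (det_gate hs (h.trans hS) ?_ ?_ ?_).weaken (fun _ _ => rfl) rfl ?_ (.inr rfl) ?_ le_rfl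
  · simp [Angle.User]
  · simp [Angle.User]
  · simp [Angle.User]
  · simp [Angle.eval, gateN_had h]
  · simp [Angle.size]

theorem det_tP {σ : View w S} {s q : ℕ} (hs : s < 100) (hS : S < 2 ^ w) (hq : σ.var s = q)
    (h : q < S) : Det E (tP s) σ ((σ.act (phase (Real.pi / 4) q)).tick 10) := by
  subst hq
  refine (det_gate hs (h.trans hS) ?_ ?_ ?_).weaken (fun _ _ => rfl) rfl ?_ (.inr rfl) ?_ le_rfl
  · simp [Angle.User]
  · simp [Angle.User]
  · simp [Angle.User]
  · simp [Angle.eval, gateN_phase _ h]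
  · simp [Angle.size]

theorem det_tdgP {σ : View w S} {s q : ℕ} (hs : s < 100) (hS : S < 2 ^ w) (hq : σ.var s = q)
    (h : q < S) : Det E (tdgP s) σ ((σ.act (phase (-(Real.pi / 4)) q)).tick 10) := by
  subst hq
  refine (det_gate hs (h.trans hS) ?_ ?_ ?_).weaken (fun _ _ => rfl) rfl ?_ (.inr rfl) ?_ le_rfl
  · simp [Angle.User]
  · simp [Angle.User]
  · simp [Angle.User]
  · simp [Angle.eval, gateN_phase _ h]
  · simp [Angle.size]

theorem det_xP {σ : View w S} {r s q : ℕ} (c : Bool) (hr : r < 100) (hs : s < 100) (hS : S < 2 ^ w)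
    (hc : σ.var r = c.toNat) (hq : σ.var s = q) (h : q < S) :
    Det E (xP r s) σ ((σ.act (xgate c q)).tick 10) := by
  subst hq
  have h1 : c.toNat % 2 ^ w = c.toNat := Nat.mod_eq_of_lt (by have := c.toNat_lt; omega)
  refine (det_gate hs (h.trans hS) ?_ ?_ ?_).weaken (fun _ _ => rfl) rfl ?_ (.inr rfl) ?_ le_rfl
  · simp [Angle.User, hr]
  · simp [Angle.User]
  · simp [Angle.User, hr]
  · simp [Angle.eval, hc, h1, gateN_xgate c h]
  · simp [Angle.size]

theorem det_cnotP {σ : View w S} {s t p q : ℕ} (hs : s < 100) (ht : t < 100) (hS : S < 2 ^ w)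
    (hp : σ.var s = p) (hq : σ.var t = q) (h : p < S) (h' : q < S) :
    Det E (cnotP s t) σ ((σ.act (cnotN p q)).tick 2) := by
  subst hp hq
  exact det_cnot hs ht (h.trans hS) (h'.trans hS)

/-- The Toffoli gate on the qubits named by registers `34`, `35` (controls) and `36` (target). -/
def toffP : Program :=
  hadP 36 ;; cnotP 35 36 ;; tdgP 36 ;; cnotP 34 36 ;; tP 36 ;; cnotP 35 36 ;; tdgP 36 ;;
  cnotP 34 36 ;; tP 35 ;; tP 36 ;; hadP 36 ;; cnotP 34 35 ;; tP 34 ;; tdgP 35 ;; cnotP 34 35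

theorem det_toffP {σ : View w S} {a b t : ℕ} (hS : S < 2 ^ w) (h1 : σ.var 34 = a)
    (h2 : σ.var 35 = b) (h3 : σ.var 36 = t) (ha : a < S) (hb : b < S) (ht : t < S) (hab : a ≠ b)
    (hat : a ≠ t) (hbt : b ≠ t) : Det E toffP σ ((σ.act (toff a b t)).tick 120) := by
  have l4 : 34 < 100 := by norm_num
  have l5 : 35 < 100 := by norm_num
  have l6 : 36 < 100 := by norm_num
  refine Det.weaken (Det.seq (det_hadP l6 hS h3 ht) <| Det.seq (det_cnotP l5 l6 hS h2 h3 hb ht) <|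
    Det.seq (det_tdgP l6 hS h3 ht) <| Det.seq (det_cnotP l4 l6 hS h1 h3 ha ht) <|
    Det.seq (det_tP l6 hS h3 ht) <| Det.seq (det_cnotP l5 l6 hS h2 h3 hb ht) <|
    Det.seq (det_tdgP l6 hS h3 ht) <| Det.seq (det_cnotP l4 l6 hS h1 h3 ha ht) <|
    Det.seq (det_tP l5 hS h2 hb) <| Det.seq (det_tP l6 hS h3 ht) <|
    Det.seq (det_hadP l6 hS h3 ht) <| Det.seq (det_cnotP l4 l5 hS h1 h2 ha hb) <|
    Det.seq (det_tP l4 hS h1 ha) <| Det.seq (det_tdgP l5 hS h2 hb) <|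
    det_cnotP l4 l5 hS h1 h2 ha hb) ?_ ?_ ?_ (.inr ?_) ?_ ?_
  · intro r _
    simp only [View.var_tick, View.var_act]
  · simp only [View.mem_tick, View.mem_act]
  · simp only [View.psi_tick, View.psi_act]
    exact toff_decomposition ha hb ht hab hat hbt σ.psi
  · simp only [View.out_tick, View.out_act]
  · simp only [View.time_tick, View.time_act]
    omega
  · simp only [View.queries_tick, View.queries_act, le_refl]

open Ex in
/-- A step of the comparison with register `30`, for the digit given by register `32`. -/
def stepP : Program :=
  assign 33 (bin .shr (v 30) (v 32) % lit 2) ;; assign 34 (v 32) ;; assign 35 (v 13 + v 32) ;;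
  assign 36 (v 13 + v 32 + lit 1) ;; assign 38 (lit 1 - v 33) ;;
  xP 38 34 ;; xP 33 35 ;; toffP ;; xP 38 34 ;; xP 33 35 ;; xP 33 36 ;;
  zero 33 ;; zero 34 ;; zero 35 ;; zero 36 ;; zero 38

/-- All scratch registers are zero again at the end, so that the view changes only in its amplitudes
and the step can be iterated. The same convention holds for the later subroutines. -/
theorem det_stepP {σ : View w S} {base c p : ℕ} (hS : S < 2 ^ w) (h13 : σ.var 13 = base)
    (h30 : σ.var 30 = c) (h32 : σ.var 32 = p) (hc : c < 2 ^ w) (hp : p < base)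
    (hb : base + p + 1 < S) (h33 : σ.var 33 = 0) (h34 : σ.var 34 = 0) (h35 : σ.var 35 = 0)
    (h36 : σ.var 36 = 0) (h38 : σ.var 38 = 0) :
    Det E stepP σ ((σ.act fun ψ x => ψ (ladder base c p x)).tick 250) := by
  have hw : 2 < 2 ^ w := by omega
  have hpw : p < 2 ^ w := by omega
  have hbit : c / 2 ^ p % 2 = (c.testBit p).toNat := (Nat.toNat_testBit c p).symm
  have hbit' : 1 - (c.testBit p).toNat = (!c.testBit p).toNat := by cases c.testBit p <;> rfl
  have hdiv : c / 2 ^ p < 2 ^ w := (Nat.div_le_self _ _).trans_lt hc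
  have hle : (c.testBit p).toNat ≤ 1 := Bool.toNat_le _
  refine Det.weaken (Det.seq (det_set (c.testBit p).toNat 10 ?_ ?_) <|
    Det.seq (det_set p 10 ?_ ?_) <| Det.seq (det_set (base + p) 10 ?_ ?_) <|
    Det.seq (det_set (base + p + 1) 10 ?_ ?_) <|
    Det.seq (det_set (!c.testBit p).toNat 10 ?_ ?_) <|
    Det.seq (det_xP (!c.testBit p) (q := p) (by norm_num) (by norm_num) hS ?_ ?_ ?_) <|
    Det.seq (det_xP (c.testBit p) (q := base + p) (by norm_num) (by norm_num) hS ?_ ?_ ?_) <|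
    Det.seq (det_toffP (a := p) (b := base + p) (t := base + p + 1) hS ?_ ?_ ?_ ?_ ?_ ?_ ?_ ?_ ?_) <|
    Det.seq (det_xP (!c.testBit p) (q := p) (by norm_num) (by norm_num) hS ?_ ?_ ?_) <|
    Det.seq (det_xP (c.testBit p) (q := base + p) (by norm_num) (by norm_num) hS ?_ ?_ ?_) <|
    Det.seq (det_xP (c.testBit p) (q := base + p + 1) (by norm_num) (by norm_num) hS ?_ ?_ ?_) <|
    Det.seq (det_zero (by norm_num)) <| Det.seq (det_zero (by norm_num)) <|
    Det.seq (det_zero (by norm_num)) <| Det.seq (det_zero (by norm_num)) <|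
    det_zero (by norm_num)) ?_ ?_ ?_ (.inr ?_) ?_ ?_
  all_goals first
    | omega
    | (simp only [View.time_tick, View.time_act, View.time_set]; omega)
    | (simp [h13, h30, h32, hc, hpw, hw, hbit, hbit', hdiv, hle]; done)
    | (simp only [View.psi_tick, View.psi_act, View.psi_set]; exact ladder_gates hp hb c _)
    | (intro r _
       simp only [View.var_tick, View.var_set, View.var_act]
       split_ifs <;> simp_all)

end

end HybridRAM

/-! ### The program for the phase flip -/

namespace HybridRAM

set_option linter.unusedSimpArgs false

noncomputable section

open scoped ENNReal

variable {w S : ℕ} {E : Env}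

/-- `τ` describes all states that `σ` describes. -/
structure View.Le (σ τ : View w S) : Prop where
  var : ∀ r < 100, σ.var r = τ.var r
  mem : σ.mem = τ.mem
  psi : σ.psi = τ.psi
  out : τ.out = none ∨ τ.out = σ.out
  time : σ.time ≤ τ.time
  queries : σ.queries ≤ τ.queries

theorem Det.le {P : Program} {σ τ υ : View w S} (h : Det E P σ τ) (e : View.Le τ υ) :
    Det E P σ υ := h.weaken e.var e.mem e.psi e.out e.time e.queries

theorem Det.ge {P : Program} {σ τ υ : View w S} (h : Det E P σ τ) (e : View.Le υ σ) :
    Det E P υ τ := h.strengthen e.var e.mem e.psi e.out e.time e.queries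

theorem Tri.ge {P : Program} {σ υ : View w S} {f : View w S → ℝ≥0∞} {v : ℝ≥0∞}
    (h : Tri E P σ f v) (e : View.Le υ σ) : Tri E P υ f v :=
  fun s hs => h s (hs.weaken e.var e.mem e.psi e.out e.time e.queries)

open Ex in
/-- Flip the phase if the number held by as many qubits as register `31` says is smaller than
register `30`, and the rotated qubit is set. -/
def flipP : Program :=
  assign 37 (v 31) ;;
  .loop 37 (stepP ;; assign 32 (v 32 + lit 1) ;; assign 37 (v 37 - lit 1)) ;;
  assign 34 (v 13 + v 31) ;; hadP 8 ;; cnotP 34 8 ;; hadP 8 ;; zero 34 ;;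
  assign 37 (v 31) ;;
  .loop 37 (assign 32 (v 32 - lit 1) ;; stepP ;; assign 37 (v 37 - lit 1))

theorem det_flipP {σ : View w S} {base q c d : ℕ} (hS : S < 2 ^ w) (h8 : σ.var 8 = q)
    (h13 : σ.var 13 = base) (h30 : σ.var 30 = c) (h31 : σ.var 31 = d) (hc : c < 2 ^ w)
    (hd : d ≤ base) (hb : base + d < S) (hq : q < base)
    (hz : ∀ r, 32 ≤ r → r < 39 → σ.var r = 0) :
    Det E flipP σ ((σ.act (flip base q d c)).tick (600 * d + 100)) := by
  have hdw : d < 2 ^ w := by omega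
  have h32 := hz 32 (by norm_num) (by norm_num)
  have h33 := hz 33 (by norm_num) (by norm_num)
  have h34 := hz 34 (by norm_num) (by norm_num)
  have h35 := hz 35 (by norm_num) (by norm_num)
  have h36 := hz 36 (by norm_num) (by norm_num)
  have h37 := hz 37 (by norm_num) (by norm_num)
  have h38 := hz 38 (by norm_num) (by norm_num)
  -- Gates act on amplitudes by precomposition, so carrying out the steps 0, …, i - 1 in this order
  -- composes ψ with `ladderDown`.
  have up := Det.loop (E := E) (P := stepP ;; assign 32 (.v 32 + .lit 1) ;; assign 37 (.v 37 - .lit 1))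
    (r := 37) (m := d) (by norm_num) hdw.le
    (fun i => (((σ.act fun ψ x => ψ (ladderDown base c i x)).set 32 i).set 37 (d - i)).tick
      (10 + 280 * i)) (fun i hi => by
      refine ⟨by simp [Nat.mod_eq_of_lt (show d - i < 2 ^ w by omega)]; omega, ?_⟩
      refine Det.le (Det.seq (det_stepP (base := base) (c := c) (p := i) hS ?_ ?_ ?_ hc ?_ ?_ ?_ ?_ ?_ ?_ ?_) <|
        Det.seq (det_set (i + 1) 10 ?_ ?_) <| det_set (d - (i + 1)) 10 ?_ ?_) ⟨?_, ?_, ?_, .inr ?_, ?_, ?_⟩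
      all_goals first
        | omega
        | (simp only [View.time_tick, View.time_act, View.time_set]; omega)
        | (simp [h13, h30, h32, h33, h34, h35, h36, h38]; done)
        | (simp; omega)
        | rfl
        | (intro r _
           simp only [View.var_tick, View.var_set, View.var_act]
           split_ifs <;> simp_all)) (by simp)
  -- After the controlled sign, the amplitude at x is the sign at x times ψ at `ladderDown x`. By
  -- `ladderUp_down` this is `flip` evaluated at `ladderDown x`, and each further step cancels one
  -- rung.
  have down := Det.loop (E := E) (P := assign 32 (.v 32 - .lit 1) ;; stepP ;; assign 37 (.v 37 - .lit 1))
    (r := 37) (m := d) (by norm_num) hdw.le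
    (fun i => (((σ.act fun ψ x => flip base q d c ψ (ladderDown base c (d - i) x)).set 32 (d - i)).set
      37 (d - i)).tick (80 + 280 * d + 280 * i)) (fun i hi => by
      refine ⟨by simp [Nat.mod_eq_of_lt (show d - i < 2 ^ w by omega)]; omega, ?_⟩
      have e : d - i = d - (i + 1) + 1 := by omega
      refine Det.le (Det.seq (det_set (d - (i + 1)) 10 ?_ ?_) <|
        Det.seq (det_stepP (base := base) (c := c) (p := d - (i + 1)) hS ?_ ?_ ?_ hc ?_ ?_ ?_ ?_ ?_ ?_ ?_) <|
        det_set (d - (i + 1)) 10 ?_ ?_) ⟨?_, ?_, ?_, .inr ?_, ?_, ?_⟩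
      all_goals first
        | omega
        | (simp only [View.time_tick, View.time_act, View.time_set]; omega)
        | (simp [h13, h30, h32, h33, h34, h35, h36, h38]; done)
        | (simp; omega)
        | (simp only [View.psi_tick, View.psi_act, View.psi_set, e, ladderDown, ladder_ladder]; done)
        | (intro r _
           simp only [View.var_tick, View.var_set, View.var_act]
           split_ifs <;> simp_all)) (by simp)
  refine Det.le (Det.seq (det_set d 2 ?_ ?_) <| Det.seq (up.ge ⟨?_, ?_, ?_, .inr ?_, ?_, ?_⟩) <|
    Det.seq (det_set (base + d) 10 ?_ ?_) <| Det.seq (det_hadP (q := q) (by norm_num) hS ?_ ?_) <|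
    Det.seq (det_cnotP (p := base + d) (q := q) (by norm_num) (by norm_num) hS ?_ ?_ ?_ ?_) <|
    Det.seq (det_hadP (q := q) (by norm_num) hS ?_ ?_) <| Det.seq (det_zero (by norm_num)) <|
    Det.seq (det_set d 10 ?_ ?_) <| down.ge ⟨?_, ?_, ?_, .inr ?_, ?_, ?_⟩) ⟨?_, ?_, ?_, .inr ?_, ?_, ?_⟩
  all_goals first
    | omega
    | (simp only [View.time_tick, View.time_act, View.time_set]; omega)
    | (simp [h8, h13, h30, h31, h32, h33, h34, h35, h36, h38, ladderDown]; done)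
    | (simp only [View.psi_tick, View.psi_act, View.psi_set]
       rw [cz_decomposition (by omega) (by omega) (by omega)]
       funext x
       simp only [Nat.sub_zero, flip, czOp, ladderUp_down]
       done)
    | (simp; done)
    | (intro r _
       simp only [View.var_tick, View.var_set, View.var_act]
       split_ifs <;> simp_all)

end

end HybridRAM

/-! ### Programs for state preparation, oracle and reflection -/

namespace HybridRAM

set_option linter.unusedSimpArgs false

noncomputable section

open scoped ENNReal

variable {w S : ℕ} {E : Env}

open Ex in
/-- Hadamard gates on the first qubits, as many as register `5` says. -/
def hadsP : Program :=
  assign 37 (v 5) ;;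
  .loop 37 (hadP 32 ;; assign 32 (v 32 + lit 1) ;; assign 37 (v 37 - lit 1)) ;; zero 32

theorem det_hadsP {σ : View w S} {ν : ℕ} (hS : S < 2 ^ w) (h5 : σ.var 5 = ν) (hν : ν ≤ S)
    (h32 : σ.var 32 = 0) (h37 : σ.var 37 = 0) :
    Det E hadsP σ ((σ.act (hadN ν)).tick (40 * ν + 20)) := by
  have hw : ν < 2 ^ w := by omega
  have lp := Det.loop (E := E) (P := hadP 32 ;; assign 32 (.v 32 + .lit 1) ;; assign 37 (.v 37 - .lit 1))
    (r := 37) (m := ν) (by norm_num) hw.le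
    (fun i => (((σ.act (hadN i)).set 32 i).set 37 (ν - i)).tick (10 + 40 * i)) (fun i hi => by
      refine ⟨by simp [Nat.mod_eq_of_lt (show ν - i < 2 ^ w by omega)]; omega, ?_⟩
      refine Det.le (Det.seq (det_hadP (q := i) (by norm_num) hS ?_ ?_) <|
        Det.seq (det_set (i + 1) 10 ?_ ?_) <| det_set (ν - (i + 1)) 10 ?_ ?_)
        ⟨?_, ?_, ?_, .inr ?_, ?_, ?_⟩
      all_goals first
        | omega
        | (simp only [View.time_tick, View.time_act, View.time_set]; omega)
        | (simp; done)
        | (simp; omega)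
        | rfl
        | (intro r _
           simp only [View.var_tick, View.var_set, View.var_act]
           split_ifs <;> simp_all)) (by simp)
  refine Det.le (Det.seq (det_set ν 2 ?_ ?_) <| Det.seq (lp.ge ⟨?_, ?_, ?_, .inr ?_, ?_, ?_⟩) <|
    (det_zero (by norm_num))) ⟨?_, ?_, ?_, .inr ?_, ?_, ?_⟩
  all_goals first
    | omega
    | (simp only [View.time_tick, View.time_act, View.time_set]; omega)
    | (simp [h5, hadN]; done)
    | (intro r _
       simp only [View.var_tick, View.var_set, View.var_act]
       split_ifs <;> simp_all)

theorem xgate_single {i : ℕ} (hi : i < S) (c : Bool) {z : Basis S} (hz : bit z i = false) :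
    xgate c i (Pi.single z 1) = Pi.single (setb z i c) 1 := by
  funext x
  simp only [xgate, Pi.single_apply]
  congr 1
  refine propext ⟨fun h => ?_, fun h => ?_⟩
  · rw [← h, setb_setb]
    have h2 := congrArg (fun y => bit y i) h
    simp only [bit_setb, hi, and_self, if_true, hz] at h2
    have : c = bit x i := by cases c <;> cases hb : bit x i <;> simp_all
    rw [this, setb_bit]
  · subst h
    rw [setb_setb, bit_setb, if_pos ⟨rfl, hi⟩, Bool.xor_self, ← hz, setb_bit]

open Ex in
/-- Load the high part of the index of the elements of the block in register `20`. -/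
def blockP : Program :=
  assign 37 (v 3) ;; assign 39 (v 20 * v 6) ;;
  .loop 37 (assign 33 (bin .shr (v 39) (v 32) % lit 2) ;; xP 33 32 ;; assign 32 (v 32 + lit 1) ;;
    assign 37 (v 37 - lit 1)) ;; zero 32 ;; zero 33 ;; zero 39

theorem det_blockP {σ : View w S} {l b ν B : ℕ} (L : Layout E S l b ν) (hS : S < 2 ^ w)
    (h3 : σ.var 3 = l) (h6 : σ.var 6 = 2 ^ ν) (h20 : σ.var 20 = B) (h32 : σ.var 32 = 0)
    (h33 : σ.var 33 = 0) (h37 : σ.var 37 = 0) (h39 : σ.var 39 = 0) (hB : 2 ^ ν * B < 2 ^ w)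
    (hpsi : σ.psi = psiInit) :
    Det E blockP σ ((σ.act fun _ => Pi.single (pt ν l (l + b + 1) B 0 false) 1).tick
      (60 * l + 40)) := by
  have hr := L.room
  have hle := L.le
  have hlw : l < 2 ^ w := by omega
  have hB' : B * 2 ^ ν = 2 ^ ν * B := by ring
  -- The basis state after the lowest `i` digits of the first index of the block are loaded. Since
  -- 2^ν B has `ν` trailing zeros, `z l` is the element 0 of the block.
  set z : ℕ → Basis S := fun i q => if (q : ℕ) < i then (2 ^ ν * B).testBit q else false with hz
  have hz0 : ∀ i, bit (z i) i = false := fun i => by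
    simp only [bit, hz, lt_irrefl, if_false]; split_ifs <;> rfl
  have hzs : ∀ i, z (i + 1) = setb (z i) i ((2 ^ ν * B).testBit i) := fun i => by
    funext q
    simp only [hz, setb]
    rcases Nat.lt_trichotomy (q : ℕ) i with h | h | h
    · rw [if_pos (by omega), if_neg (by omega), if_pos h]
    · rw [if_pos (by omega), if_pos h, h]
    · rw [if_neg (by omega), if_neg (by omega), if_neg (by omega)]
  have hzl : z l = pt ν l (l + b + 1) B 0 false := by
    funext q
    simp only [hz, pt]
    have := Nat.testBit_two_pow_mul_add B (Nat.two_pow_pos ν) (q : ℕ)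
    rw [add_zero] at this
    rw [this]
    split_ifs <;> first | rfl | omega
  have hz00 : z 0 = fun _ => false := by funext q; simp [hz]
  have hdiv : ∀ i, 2 ^ ν * B / 2 ^ i < 2 ^ w := fun i => (Nat.div_le_self _ _).trans_lt hB
  have hbit : ∀ i, 2 ^ ν * B / 2 ^ i % 2 = ((2 ^ ν * B).testBit i).toNat :=
    fun i => (Nat.toNat_testBit _ i).symm
  have h2w : 2 < 2 ^ w := by omega
  have lp := Det.loop (E := E) (P := assign 33 (.bin .shr (.v 39) (.v 32) % .lit 2) ;; xP 33 32 ;;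
      assign 32 (.v 32 + .lit 1) ;; assign 37 (.v 37 - .lit 1))
    (r := 37) (m := l) (by norm_num) hlw.le
    -- Register 33 still holds the digit loaded in the previous round, and zero before the first
    -- round.
    (fun i => (((((σ.act fun _ => Pi.single (z i) 1).set 39 (2 ^ ν * B)).set 33
      (if i = 0 then 0 else ((2 ^ ν * B).testBit (i - 1)).toNat)).set 32 i).set 37 (l - i)).tick
        (20 + 60 * i))
    (fun i hi => by
      have hiw : i < 2 ^ w := by omega
      refine ⟨by simp [Nat.mod_eq_of_lt (show l - i < 2 ^ w by omega)]; omega, ?_⟩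
      refine Det.le (Det.seq (det_set ((2 ^ ν * B).testBit i).toNat 10 ?_ ?_) <|
        Det.seq (det_xP ((2 ^ ν * B).testBit i) (q := i) (by norm_num) (by norm_num) hS ?_ ?_ ?_) <|
        Det.seq (det_set (i + 1) 10 ?_ ?_) <| det_set (l - (i + 1)) 10 ?_ ?_)
        ⟨?_, ?_, ?_, .inr ?_, ?_, ?_⟩
      all_goals first
        | omega
        | (simp only [View.time_tick, View.time_act, View.time_set]; omega)
        | (simp only [View.psi_tick, View.psi_act, View.psi_set]
           rw [hzs i, xgate_single (by omega) _ (hz0 i)]; done)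
        | (simp [hdiv, hbit, h2w, hiw, hB]; done)
        | (simp; omega)
        | (intro r _
           simp only [View.var_tick, View.var_set, View.var_act]
           split_ifs <;> simp_all)) (by simp)
  refine Det.le (Det.seq (det_set l 2 ?_ ?_) <| Det.seq (det_set (2 ^ ν * B) 10 ?_ ?_) <|
    Det.seq (lp.ge ⟨?_, ?_, ?_, .inr ?_, ?_, ?_⟩) <|
    Det.seq (det_zero (by norm_num)) <| Det.seq (det_zero (by norm_num)) <|
    (det_zero (by norm_num))) ⟨?_, ?_, ?_, .inr ?_, ?_, ?_⟩
  all_goals first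
    | omega
    | (simp only [View.time_tick, View.time_act, View.time_set]; omega)
    | (simp [h3, h6, h20, hB', hzl]; done)
    | (simp only [View.psi_tick, View.psi_act, View.psi_set, hpsi, psiInit, hz00]; done)
    | (intro r _
       simp only [View.var_tick, View.var_set, View.var_act]
       split_ifs <;> simp_all)

/-- The angle of the extra qubit, given the number of iterations in register `24` and the expected
number of marked elements in register `23`. -/
def angleE : Angle :=
  .mul (.lit 2) (.arcsin (.mul (.sin (.div .pi (.mul (.lit 2) (.add (.mul (.lit 2) (.reg 24)) (.lit 1)))))
    (.sqrt (.div (.reg 6) (.reg 23)))))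

def rotP : Program := .instr (.gate angleE (.lit 0) (.lit 0) 8)
def rotNegP : Program := .instr (.gate (.sub (.lit 0) angleE) (.lit 0) (.lit 0) 8)

theorem angleE_eval {V : ℕ → ℕ} {ν j T : ℕ} (h6 : V 6 = 2 ^ ν) (h23 : V 23 = T) (h24 : V 24 = j)
    (hν : 2 ^ ν < 2 ^ w) (hT : T < 2 ^ w) (hj : j < 2 ^ w) :
    angleE.eval (fun r => BitVec.ofNat w (V r)) = extraAngle j ν T := by
  simp only [angleE, Angle.eval, h6, h23, h24, BitVec.toNat_ofNat, Nat.mod_eq_of_lt hν,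
    Nat.mod_eq_of_lt hT, Nat.mod_eq_of_lt hj, extraAngle]
  push_cast
  rfl

theorem angleE_user : angleE.User := by simp [angleE, Angle.User]

theorem det_rotP {σ : View w S} {ν j T m : ℕ} (hS : S < 2 ^ w) (h6 : σ.var 6 = 2 ^ ν)
    (h8 : σ.var 8 = m) (h23 : σ.var 23 = T) (h24 : σ.var 24 = j) (hm : m < S)
    (hν : 2 ^ ν < 2 ^ w) (hT : T < 2 ^ w) (hj : j < 2 ^ w) :
    Det E rotP σ ((σ.act (rot (extraAngle j ν T) m)).tick 30) := by
  subst h8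
  refine (det_gate (θ := angleE) (φ := .lit 0) (lam := .lit 0) (by norm_num) (hm.trans hS) angleE_user trivial trivial).weaken
    (fun _ _ => rfl) rfl ?_ (.inr rfl) ?_ le_rfl
  · simp [Angle.eval, angleE_eval h6 h23 h24 hν hT hj, gateN_rot _ hm]
  · simp [Angle.size, angleE]

theorem det_rotNegP {σ : View w S} {ν j T m : ℕ} (hS : S < 2 ^ w) (h6 : σ.var 6 = 2 ^ ν)
    (h8 : σ.var 8 = m) (h23 : σ.var 23 = T) (h24 : σ.var 24 = j) (hm : m < S)
    (hν : 2 ^ ν < 2 ^ w) (hT : T < 2 ^ w) (hj : j < 2 ^ w) :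
    Det E rotNegP σ ((σ.act (rot (-extraAngle j ν T) m)).tick 30) := by
  subst h8
  refine (det_gate (θ := .sub (.lit 0) angleE) (φ := .lit 0) (lam := .lit 0) (by norm_num) (hm.trans hS)
    ⟨trivial, angleE_user⟩ trivial trivial).weaken
    (fun _ _ => rfl) rfl ?_ (.inr rfl) ?_ le_rfl
  · simp [Angle.eval, angleE_eval h6 h23 h24 hν hT hj, gateN_rot _ hm]
  · simp [Angle.size, angleE]

/-- What is fixed during the search in a block. -/
structure Ready (E : Env) (l b ν n : ℕ) (σ : View w S) : Prop where
  layout : Layout E S l b ν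
  hS : S < 2 ^ w
  big : 2 ^ (l + b + 4) ≤ 2 ^ w
  n_le : n ≤ 2 ^ l
  v0 : σ.var 0 = n
  v3 : σ.var 3 = l
  v5 : σ.var 5 = ν
  v6 : σ.var 6 = 2 ^ ν
  v8 : σ.var 8 = l + b + 1
  v9 : σ.var 9 = 2 ^ l
  v13 : σ.var 13 = l + b + 1 + 1
  zero : ∀ r, 24 ≤ r → r < 40 → σ.var r = 0

def queryP : Program := .instr .query

open Ex in
/-- The phase flips for the marked elements. -/
def oracleP : Program :=
  queryP ;; assign 31 (v 8) ;; assign 30 (v 22) ;; flipP ;; assign 30 (v 21) ;; flipP ;;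
  assign 30 (v 27) ;; flipP ;; assign 30 (v 28) ;; flipP ;; queryP ;; zero 30 ;; zero 31

/-- Add to the number of queries. -/
def View.ask (σ : View w S) (q : ℕ) : View w S := { σ with queries := σ.queries + q }

@[simp] theorem View.var_ask (σ : View w S) (q : ℕ) : (σ.ask q).var = σ.var := rfl
@[simp] theorem View.mem_ask (σ : View w S) (q : ℕ) : (σ.ask q).mem = σ.mem := rfl
@[simp] theorem View.psi_ask (σ : View w S) (q : ℕ) : (σ.ask q).psi = σ.psi := rfl
@[simp] theorem View.out_ask (σ : View w S) (q : ℕ) : (σ.ask q).out = σ.out := rfl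
@[simp] theorem View.time_ask (σ : View w S) (q : ℕ) : (σ.ask q).time = σ.time := rfl
@[simp] theorem View.queries_ask (σ : View w S) (q : ℕ) :
    (σ.ask q).queries = σ.queries + q := rfl

theorem det_queryP {σ : View w S} :
    Det E queryP σ (((σ.act fun ψ x => ψ (queryMap E x)).ask 1).tick 2) := det_query

/-- Two queries, one to compute the values and one to erase them, and four flips of 600m + 100 time
units each account for the cost. -/
theorem det_oracleP {σ : View w S} {m y z c₁ c₂ : ℕ} (hS : S < 2 ^ w) (hm : 2 * m + 1 < S)
    (h8 : σ.var 8 = m) (h13 : σ.var 13 = m + 1)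
    (h22 : σ.var 22 = y) (h21 : σ.var 21 = z) (h27 : σ.var 27 = c₁) (h28 : σ.var 28 = c₂)
    (hy : y < 2 ^ w) (hzz : z < 2 ^ w) (h1 : c₁ < 2 ^ w) (h2 : c₂ < 2 ^ w)
    (hz : ∀ r, 29 < r → r < 40 → σ.var r = 0) :
    Det E oracleP σ (((σ.act (oracle E m y z c₁ c₂)).ask 2).tick (2400 * m + 500)) := by
  refine Det.le (Det.seq det_queryP <| Det.seq (det_set m 2 ?_ ?_) <| Det.seq (det_set y 2 ?_ ?_) <|
    Det.seq (det_flipP (q := m) (base := m + 1) (c := y) (d := m) hS ?_ ?_ ?_ ?_ hy ?_ ?_ ?_ ?_) <|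
    Det.seq (det_set z 2 ?_ ?_) <|
    Det.seq (det_flipP (q := m) (base := m + 1) (c := z) (d := m) hS ?_ ?_ ?_ ?_ hzz ?_ ?_ ?_ ?_) <|
    Det.seq (det_set c₁ 2 ?_ ?_) <|
    Det.seq (det_flipP (q := m) (base := m + 1) (c := c₁) (d := m) hS ?_ ?_ ?_ ?_ h1 ?_ ?_ ?_ ?_) <|
    Det.seq (det_set c₂ 2 ?_ ?_) <|
    Det.seq (det_flipP (q := m) (base := m + 1) (c := c₂) (d := m) hS ?_ ?_ ?_ ?_ h2 ?_ ?_ ?_ ?_) <|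
    Det.seq det_queryP <| Det.seq (det_zero (by norm_num)) <| (det_zero (by norm_num)))
    ⟨?_, ?_, ?_, .inr ?_, ?_, ?_⟩
  all_goals first
    | omega
    | (simp only [View.time_tick, View.time_act, View.time_set, View.time_ask]; omega)
    | (simp [h8, h13, h21, h22, h27, h28]; done)
    | rfl
    | (intro r hr1 hr2
       simp only [View.var_tick, View.var_set, View.var_act, View.var_ask]
       rw [hz r (by omega) (by omega)]
       split_ifs <;> omega)
    | (intro r _
       simp only [View.var_tick, View.var_set, View.var_act, View.var_ask]
       split_ifs <;> simp_all)

open Ex in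
/-- The reflection about the prepared state. -/
def reflectP : Program :=
  rotNegP ;; hadsP ;; assign 39 (lit 1) ;; xP 39 8 ;; assign 30 (lit 1) ;; assign 31 (v 5) ;; flipP ;;
  xP 39 8 ;; hadsP ;; rotP ;; zero 30 ;; zero 31 ;; zero 39

theorem det_reflectP {σ : View w S} {m ν j T : ℕ} (hS : S < 2 ^ w) (hm : 2 * m + 1 < S)
    (hνm : ν ≤ m) (h5 : σ.var 5 = ν) (h6 : σ.var 6 = 2 ^ ν) (h8 : σ.var 8 = m)
    (h13 : σ.var 13 = m + 1) (h23 : σ.var 23 = T) (h24 : σ.var 24 = j)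
    (hν : 2 ^ ν < 2 ^ w) (hT : T < 2 ^ w) (hj : j < 2 ^ w)
    (hz : ∀ r, 29 < r → r < 40 → σ.var r = 0) :
    Det E reflectP σ ((σ.act (reflect (extraAngle j ν T) ν m)).tick (700 * m + 400)) := by
  have h32 := hz 32 (by norm_num) (by norm_num)
  have h37 := hz 37 (by norm_num) (by norm_num)
  refine Det.le (Det.seq (det_rotNegP (ν := ν) (j := j) (T := T) (m := m) hS ?_ ?_ ?_ ?_ ?_ hν hT hj) <|
    Det.seq (det_hadsP (ν := ν) hS ?_ ?_ ?_ ?_) <| Det.seq (det_set 1 2 ?_ ?_) <|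
    Det.seq (det_xP true (q := m) (by norm_num) (by norm_num) hS ?_ ?_ ?_) <|
    Det.seq (det_set 1 2 ?_ ?_) <| Det.seq (det_set ν 2 ?_ ?_) <|
    Det.seq (det_flipP (q := m) (base := m + 1) (c := 1) (d := ν) hS ?_ ?_ ?_ ?_ ?_ ?_ ?_ ?_ ?_) <|
    Det.seq (det_xP true (q := m) (by norm_num) (by norm_num) hS ?_ ?_ ?_) <|
    Det.seq (det_hadsP (ν := ν) hS ?_ ?_ ?_ ?_) <|
    Det.seq (det_rotP (ν := ν) (j := j) (T := T) (m := m) hS ?_ ?_ ?_ ?_ ?_ hν hT hj) <|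
    Det.seq (det_zero (by norm_num)) <| Det.seq (det_zero (by norm_num)) <| (det_zero (by norm_num)))
    ⟨?_, ?_, ?_, .inr ?_, ?_, ?_⟩
  all_goals first
    | omega
    | (simp only [View.time_tick, View.time_act, View.time_set, View.time_ask]; omega)
    | (simp [h5, h6, h8, h13, h23, h24, h32, h37]; done)
    | rfl
    | (intro r hr1 hr2
       simp only [View.var_tick, View.var_set, View.var_act, View.var_ask]
       rw [hz r (by omega) (by omega)]
       split_ifs <;> omega)
    | (intro r _
       simp only [View.var_tick, View.var_set, View.var_act, View.var_ask]
       split_ifs <;> simp_all)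

end

end HybridRAM

/-! ### Specifications of randomised programs, and the circuit of a search -/

namespace HybridRAM

set_option linter.unusedSimpArgs false

noncomputable section

open scoped ENNReal

variable {w S : ℕ} {E : Env}

/-! ## Programs with a random result -/

/-- Started in a state described by `σ`, the program `P` ends in one of the states described by
`st y` with `ok y`; and if `val y` bounds the cost of such a state, then `v` bounds the expected
cost. -/
def Spec {ι : Type*} (E : Env) (P : Program) (σ : View w S) (st : ι → View w S) (ok : ι → Prop)
    (val : ι → ℝ≥0∞) (v : ℝ≥0∞) : Prop :=
  ∀ f : View w S → ℝ≥0∞, (∀ y, ok y → f (st y) ≤ val y) → Tri E P σ f v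

theorem Spec.mono {ι : Type*} {P : Program} {σ : View w S} {st : ι → View w S} {ok ok' : ι → Prop}
    {val val' : ι → ℝ≥0∞} {v v' : ℝ≥0∞} (h : Spec E P σ st ok val v)
    (hok : ∀ y, ok y → ok' y ∧ val' y ≤ val y) (hv : v ≤ v') : Spec E P σ st ok' val' v' :=
  fun f hf => (h f fun y hy => (hf y (hok y hy).1).trans (hok y hy).2).mono (fun _ => le_rfl) hv

theorem Spec.ge {ι : Type*} {P : Program} {σ υ : View w S} {st : ι → View w S} {ok : ι → Prop}
    {val : ι → ℝ≥0∞} {v : ℝ≥0∞} (h : Spec E P σ st ok val v) (e : View.Le υ σ) :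
    Spec E P υ st ok val v := fun f hf => (h f hf).ge e

theorem Spec.seq {ι κ : Type*} {P Q : Program} {σ : View w S} {st : ι → View w S}
    {st' : κ → View w S} {ok : ι → Prop} {ok' : κ → Prop} {val : ι → ℝ≥0∞} {val' : κ → ℝ≥0∞}
    {v : ℝ≥0∞} (hP : Spec E P σ st ok val v)
    (hQ : ∀ y, ok y → Spec E Q (st y) st' ok' val' (val y)) :
    Spec E (P ;; Q) σ st' ok' val' v := fun f hf => by
  -- The intermediate cost is the weakest precondition: the least bound that holds for `Q` from the
  -- given view.
  refine Tri.seq (h := fun τ => sInf {v | Tri E Q τ f v}) (hP _ fun y hy => ?_)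
    fun τ s hs g hg => le_sInf fun _ hv => hv s hs g hg
  exact sInf_le (hQ y hy f hf)

theorem Det.spec {P : Program} {ι : Type*} {σ : View w S} {st : ι → View w S} {ok : ι → Prop}
    {val : ι → ℝ≥0∞} {v : ℝ≥0∞} (y : ι) (h : Det E P σ (st y)) (hy : ok y) (hv : val y ≤ v) :
    Spec E P σ st ok val v := fun f hf =>
  (h.tri f).mono (fun _ => le_rfl) ((hf y hy).trans hv)

theorem Det.seq_spec {ι : Type*} {P Q : Program} {σ τ : View w S} {st : ι → View w S}
    {ok : ι → Prop} {val : ι → ℝ≥0∞} {v : ℝ≥0∞} (hP : Det E P σ τ)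
    (hQ : Spec E Q τ st ok val v) : Spec E (P ;; Q) σ st ok val v :=
  fun f hf => hP.seq_tri (hQ f hf)

/-- Here the index `i` counts the rounds that are left, so values are propagated backwards from `val
0`. The result of a round is random, but the number of rounds is not. -/
theorem Spec.loop {ι : Type*} {P : Program} {r m : ℕ} (hr : r < 100) (hm : m ≤ 2 ^ w)
    (st : ℕ → ι → View w S) (ok : ℕ → ι → Prop) (val : ℕ → ι → ℝ≥0∞)
    (hs : ∀ i < m, ∀ y, ok (i + 1) y → (st (i + 1) y).var r % 2 ^ w ≠ 0 ∧
      Spec E P ((st (i + 1) y).tick 1) (st i) (ok i) (val i) (val (i + 1) y))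
    (h0 : ∀ y, ok 0 y → (st 0 y).var r % 2 ^ w = 0) (y : ι) (hy : ok m y) :
    Spec E (.loop r P) (st m y) (fun y => (st 0 y).tick 1) (ok 0) (val 0) (val m y) := by
  intro f hf s hrep G hG
  have key : ∀ i ≤ m, ∀ fuel, i < fuel → ∀ (s : State w S) (y : ι), ok i y → Rep E s (st i y) →
      expect (loopExec r (fun s' => P.exec E (fuelFor w) s') fuel s) (total G) ≤ val i y := by
    intro i
    induction i with
    | zero =>
      intro _ fuel hfuel s y hy hτ
      obtain ⟨fuel, rfl⟩ : ∃ k, fuel = k + 1 := ⟨fuel - 1, by omega⟩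
      have : s.reg r = 0 := by rw [hτ.reg r hr, ofNat_eq_zero_iff]; exact h0 y hy
      simp only [loopExec, this, ne_eq, not_true_eq_false, if_false]
      rw [expect_pure]
      exact (hG _ _ (rep_tick hτ 1)).trans (hf y hy)
    | succ i ih =>
      intro hi fuel hfuel s y hy hτ
      obtain ⟨h1, h2⟩ := hs i (by omega) y hy
      obtain ⟨fuel, rfl⟩ : ∃ k, fuel = k + 1 := ⟨fuel - 1, by omega⟩
      have hne : s.reg r ≠ 0 := by
        rw [hτ.reg r hr, Ne, ofNat_eq_zero_iff]; exact h1
      simp only [loopExec, hne, ne_eq, not_false_eq_true, if_true]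
      rw [expect_andThen]
      -- Different results may have the same view, so the cost of a view is the least value among
      -- the admissible results that it represents.
      refine h2 (fun τ => ⨅ y', ⨅ (_ : ok i y' ∧ τ = st i y'), val i y')
        (fun y' hy' => iInf₂_le y' ⟨hy', rfl⟩) _ (rep_tick hτ 1) _ fun s' τ' h' => ?_
      refine le_iInf₂ fun y' hy' => ?_
      obtain ⟨hy', rfl⟩ := hy'
      exact ih (by omega) fuel (by omega) s' y' hy' h'
  exact key m le_rfl _ (by unfold fuelFor; omega) s y hy hrep

/-! ## One search in a block -/

/-- The number of iterations. -/
def iters (N T : ℕ) : ℕ := sInf {j | N ≤ j * j * T}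

theorem le_iters {N T : ℕ} (hT : 1 ≤ T) : N ≤ iters N T * iters N T * T :=
  Nat.sInf_mem (s := {j | N ≤ j * j * T}) ⟨N, by
    show N ≤ N * N * T
    nlinarith [Nat.mul_le_mul (Nat.le_mul_self N) hT]⟩

theorem lt_of_lt_iters {N T i : ℕ} (h : i < iters N T) : i * i * T < N := by
  have := Nat.notMem_of_lt_sInf h
  simpa using this

theorem iters_le {N T : ℕ} (hT : 1 ≤ T) : iters N T ≤ N :=
  Nat.sInf_le (show N ≤ N * N * T by nlinarith [Nat.mul_le_mul (Nat.le_mul_self N) hT])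

/-- Keeps the product computed by `itersP` below the word size. For i ≥ 2 it follows from i ≤ 2(i -
1) and the minimality of `iters`; for smaller i from T ≤ N. -/
theorem sq_le_of_le_iters {N T i : ℕ} (hTN : T ≤ N) (h : i ≤ iters N T) :
    i * i * T ≤ 4 * N := by
  rcases Nat.lt_or_ge i 2 with h2 | h2
  · have : i * i ≤ 1 := by nlinarith
    nlinarith
  · have h3 := lt_of_lt_iters (i := i - 1) (by omega : i - 1 < iters N T)
    obtain ⟨k, rfl⟩ : ∃ k, i = k + 1 := ⟨i - 1, by omega⟩
    simp only [Nat.add_sub_cancel] at h3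
    have : (k + 1) * (k + 1) ≤ 4 * (k * k) := by nlinarith
    nlinarith

open Ex in
def itersP : Program :=
  assign 26 (lit 1) ;;
  .loop 26 (assign 24 (v 24 + lit 1) ;; assign 26 (bin .lt (v 24 * v 24 * v 23) (v 6)))

theorem det_itersP {σ : View w S} {N T : ℕ} (h6 : σ.var 6 = N) (h23 : σ.var 23 = T)
    (h24 : σ.var 24 = 0) (h26 : σ.var 26 = 0) (hT : 1 ≤ T) (hTN : T ≤ N) (hN : 4 * N < 2 ^ w) :
    Det E itersP σ ((σ.set 24 (iters N T)).tick (20 * iters N T + 10)) := by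
  have hj := iters_le (N := N) hT
  have hlt : ∀ i, i < iters N T → i * i * T < N := fun i => lt_of_lt_iters
  have hge : ¬ iters N T * iters N T * T < N := not_lt.2 (le_iters hT)
  have h1w : 1 % 2 ^ w = 1 := Nat.mod_eq_of_lt (by omega)
  have lp := Det.loop (E := E) (P := assign 24 (.v 24 + .lit 1) ;;
      assign 26 (.bin .lt (.v 24 * .v 24 * .v 23) (.v 6))) (r := 26) (m := iters N T) (by norm_num)
    (by omega)
    (fun i => ((σ.set 24 i).set 26 (if i * i * T < N then 1 else 0)).tick (2 + 20 * i))
    (fun i hi => by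
      have hb := sq_le_of_le_iters hTN (show i + 1 ≤ iters N T by omega)
      have hbw : (i + 1) * (i + 1) * T < 2 ^ w := by omega
      have hNw : N < 2 ^ w := by omega
      refine ⟨by simp [hlt i hi, h1w], ?_⟩
      refine Det.le (Det.seq (det_set (i + 1) 5 ?_ ?_) <|
        det_set (if (i + 1) * (i + 1) * T < N then 1 else 0) 10 ?_ ?_) ⟨?_, ?_, ?_, .inr ?_, ?_, ?_⟩
      all_goals first
        | (simp only [View.time_tick, View.time_act, View.time_set]; omega)
        | (simp [h6, h23, hbw, hNw]; done)
        | (intro r _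
           simp only [View.var_tick, View.var_set, View.var_act]
           split_ifs <;> simp_all)) (by simp [hge])
  refine Det.le (Det.seq (det_set 1 2 ?_ ?_) (lp.ge ⟨?_, ?_, ?_, .inr ?_, ?_, ?_⟩))
    ⟨?_, ?_, ?_, .inr ?_, ?_, ?_⟩
  all_goals first
    | (simp only [View.time_tick, View.time_act, View.time_set]; omega)
    | (simp; done)
    | (intro r _
       simp only [View.var_tick, View.var_set, View.var_act]
       split_ifs <;> simp_all <;> omega)

/-- The thresholds for the phase flips of the indices that belong to no element. -/
def clampLo (n z : ℕ) : ℕ := max z n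
def clampHi (n l y z : ℕ) : ℕ := max (clampLo n z) (min y (2 ^ l))

open Ex in
def clampP : Program :=
  assign 27 (bin .lt (v 21) (v 0) * v 0 + (lit 1 - bin .lt (v 21) (v 0)) * v 21) ;;
  assign 28 (bin .lt (v 22) (v 9) * v 22 + (lit 1 - bin .lt (v 22) (v 9)) * v 9) ;;
  assign 28 (bin .lt (v 28) (v 27) * v 27 + (lit 1 - bin .lt (v 28) (v 27)) * v 28)

theorem ite_mul_max (a b : ℕ) :
    (if a < b then 1 else 0) * b + (1 - if a < b then 1 else 0) * a = max a b := by
  split_ifs with h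
  · simp [h.le]
  · simp [not_lt.1 h]

theorem ite_mul_min (a b : ℕ) :
    (if a < b then 1 else 0) * a + (1 - if a < b then 1 else 0) * b = min a b := by
  split_ifs with h
  · simp [h.le]
  · simp [not_lt.1 h]

theorem ite_le_one (p : Prop) [Decidable p] : (if p then 1 else 0) ≤ 1 := by split_ifs <;> simp

theorem det_clampP {σ : View w S} {n l y z : ℕ} (h0 : σ.var 0 = n) (h9 : σ.var 9 = 2 ^ l)
    (h21 : σ.var 21 = z) (h22 : σ.var 22 = y) (hn : n < 2 ^ w) (hl : 2 ^ l < 2 ^ w)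
    (hy : y < 2 ^ w) (hz : z < 2 ^ w) :
    Det E clampP σ (((σ.set 27 (clampLo n z)).set 28 (clampHi n l y z)).tick 60) := by
  have hlo : clampLo n z < 2 ^ w := max_lt hz hn
  have hmin : min y (2 ^ l) < 2 ^ w := (min_le_left _ _).trans_lt hy
  have e1 := ite_mul_max z n
  have e2 := ite_mul_min y (2 ^ l)
  have e3 := ite_mul_max (min y (2 ^ l)) (clampLo n z)
  rw [max_comm (min y (2 ^ l))] at e3
  refine Det.le (Det.seq (det_set (clampLo n z) 20 ?_ ?_) <|
    Det.seq (det_set (min y (2 ^ l)) 20 ?_ ?_) <| det_set (clampHi n l y z) 20 ?_ ?_)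
    ⟨?_, ?_, ?_, .inr ?_, ?_, ?_⟩
  all_goals first
    | (simp only [View.time_tick, View.time_act, View.time_set]; omega)
    | (simp only [Ex.ev_add, Ex.ev_mul, Ex.ev_sub, Ex.ev_lt, Ex.ev_v, Ex.ev_lit, View.var_tick,
         View.var_set, h0, h9, h21, h22, reduceIte, Nat.reduceEqDiff]; exact e1)
    | (simp only [Ex.ev_add, Ex.ev_mul, Ex.ev_sub, Ex.ev_lt, Ex.ev_v, Ex.ev_lit, View.var_tick,
         View.var_set, h0, h9, h21, h22, reduceIte, Nat.reduceEqDiff]; exact e2)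
    | (simp only [Ex.ev_add, Ex.ev_mul, Ex.ev_sub, Ex.ev_lt, Ex.ev_v, Ex.ev_lit, View.var_tick,
         View.var_set, h0, h9, h21, h22, reduceIte, Nat.reduceEqDiff]; exact e3)
    | (simp [h0, h9, h21, h22, hn, hl, hy, hz, hlo, hmin, ite_le_one]; done)
    | (intro r _
       simp only [View.var_tick, View.var_set, View.var_act]
       split_ifs <;> simp_all)

/-- The state after `i` iterations. -/
def amp (E : Env) (θ : ℝ) (ν l m B y z c₁ c₂ : ℕ) : ℕ → Basis S → ℂ
  | 0 => prepared θ ν l m B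
  | i + 1 => reflect θ ν m (oracle E m y z c₁ c₂ (amp E θ ν l m B y z c₁ c₂ i))

theorem isEmb_amp {l b ν B y z c₁ c₂ : ℕ} {θ : ℝ} (L : Layout E S l b ν)
    (hB : 2 ^ ν * (B + 1) ≤ 2 ^ l)
    (hy : y < 2 ^ (l + b + 1)) (hz : z < 2 ^ (l + b + 1)) (h1 : c₁ < 2 ^ (l + b + 1))
    (h2 : c₂ < 2 ^ (l + b + 1)) (i : ℕ) :
    IsEmb (S := S) ν l (l + b + 1) B (amp E θ ν l (l + b + 1) B y z c₁ c₂ i)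
      (gAmp (phases E l ν B y z c₁ c₂) θ ν i) := by
  induction i with
  | zero => exact isEmb_prepared θ L
  | succ i ih => exact ih.step L hB hy hz h1 h2

open Ex in
/-- Write down the circuit of a search. -/
def circuitP : Program :=
  itersP ;; clampP ;; blockP ;; hadsP ;; rotP ;; assign 29 (v 24) ;;
  .loop 29 (oracleP ;; reflectP ;; assign 29 (v 29 - lit 1)) ;; queryP

/-- The last query is not undone, so the measurement shows the whole key and not only the index. It
is the additional query beyond two per iteration. -/
theorem det_circuitP {σ : View w S} {l b ν n B z y T : ℕ} (R : Ready E l b ν n σ)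
    (h20 : σ.var 20 = B) (h21 : σ.var 21 = z) (h22 : σ.var 22 = y) (h23 : σ.var 23 = T)
    (hpsi : σ.psi = psiInit) (hT : 1 ≤ T) (hTN : T ≤ 2 ^ ν) (hB : 2 ^ ν * (B + 1) ≤ 2 ^ l)
    (hy : y < 2 ^ (l + b + 1)) (hz : z < 2 ^ (l + b + 1)) :
    Det E circuitP σ ((((((σ.act fun _ x => amp E (extraAngle (iters (2 ^ ν) T) ν T) ν l (l + b + 1) B
      y z (clampLo n z) (clampHi n l y z) (iters (2 ^ ν) T) (queryMap E x)).set 24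
        (iters (2 ^ ν) T)).set 27 (clampLo n z)).set 28 (clampHi n l y z)).ask
        (2 * iters (2 ^ ν) T + 1)).tick
      ((3100 * (l + b + 1) + 950) * iters (2 ^ ν) T + 100 * (l + b + 1) + 200)) := by
  have L := R.layout
  have hS := R.hS
  have hle := L.le
  have hr := L.room
  have hbig := R.big
  set j := iters (2 ^ ν) T with hj
  set m := l + b + 1 with hm
  set θ := extraAngle j ν T with hθ
  have hνl : 2 ^ ν ≤ 2 ^ l := Nat.pow_le_pow_right (by norm_num) hle
  have hlm : 2 ^ l ≤ 2 ^ m := Nat.pow_le_pow_right (by norm_num) (by omega)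
  have hm3 : 2 ^ (l + b + 4) = 8 * 2 ^ m := by rw [hm]; ring
  have hjN : j ≤ 2 ^ ν := iters_le hT
  have hmpos := Nat.two_pow_pos m
  have hn := R.n_le
  have hyw : y < 2 ^ w := by omega
  have hzw : z < 2 ^ w := by omega
  have hTw : T < 2 ^ w := by omega
  have hNw : 2 ^ ν < 2 ^ w := by omega
  have hjw : j < 2 ^ w := by omega
  have hlw : 2 ^ l < 2 ^ w := by omega
  have hlo : clampLo n z < 2 ^ w := by unfold clampLo; omega
  have hhi : clampHi n l y z < 2 ^ w := by unfold clampHi clampLo; omega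
  have hBw : 2 ^ ν * B < 2 ^ w := by nlinarith
  have v0 := R.v0
  have v3 := R.v3
  have v5 := R.v5
  have v6 := R.v6
  have v8 := R.v8
  have v9 := R.v9
  have v13 := R.v13
  have hz0 := R.zero
  have h24 := hz0 24 (by norm_num) (by norm_num)
  have h26 := hz0 26 (by norm_num) (by norm_num)
  have h27 := hz0 27 (by norm_num) (by norm_num)
  have h28 := hz0 28 (by norm_num) (by norm_num)
  have h29 := hz0 29 (by norm_num) (by norm_num)
  have h32 := hz0 32 (by norm_num) (by norm_num)
  have h33 := hz0 33 (by norm_num) (by norm_num)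
  have h37 := hz0 37 (by norm_num) (by norm_num)
  have h39 := hz0 39 (by norm_num) (by norm_num)
  have hcost : (3100 * m + 950) * j = (3100 * m + 920) * j + 30 * j := by ring
  have lp := Det.loop (E := E) (P := oracleP ;; reflectP ;; assign 29 (.v 29 - .lit 1))
    (r := 29) (m := j) (by norm_num) hjw.le
    (fun i => ((((((σ.act fun _ => amp E θ ν l m B y z (clampLo n z) (clampHi n l y z) i).set 24
      j).set 27 (clampLo n z)).set 28 (clampHi n l y z)).set 29 (j - i)).ask (2 * i)).tick
        ((3100 * m + 920) * i + 20 * j + 100 * m + 190)) (fun i hi => by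
      refine ⟨by simp [Nat.mod_eq_of_lt (show j - i < 2 ^ w by omega)]; omega, ?_⟩
      refine Det.le (Det.seq (det_oracleP (m := m) (y := y) (z := z) (c₁ := clampLo n z)
          (c₂ := clampHi n l y z) hS hr ?_ ?_ ?_ ?_ ?_ ?_ hyw hzw hlo hhi ?_) <|
        Det.seq (det_reflectP (m := m) (ν := ν) (j := j) (T := T) hS hr (by omega) ?_ ?_ ?_ ?_ ?_ ?_
          hNw hTw hjw ?_) <| det_set (j - (i + 1)) 10 ?_ ?_)
        ⟨?_, ?_, ?_, .inr ?_, ?_, ?_⟩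
      all_goals first
        | omega
        | (simp only [View.time_tick, View.time_act, View.time_set, View.time_ask, Nat.mul_succ]; omega)
        | rfl
        | (simp [v5, v6, v8, v13, h21, h22, h23]; done)
        | (simp; omega)
        | (intro r hr1 hr2
           simp only [View.var_tick, View.var_set, View.var_act, View.var_ask]
           rw [hz0 r (by omega) (by omega)]
           split_ifs <;> omega)
        | (intro r _
           simp only [View.var_tick, View.var_set, View.var_act, View.var_ask]
           split_ifs <;> simp_all)) (by simp)
  refine Det.le (Det.seq (det_itersP (N := 2 ^ ν) (T := T) ?_ ?_ ?_ ?_ hT hTN ?_) <|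
    Det.seq (det_clampP (n := n) (l := l) (y := y) (z := z) ?_ ?_ ?_ ?_ (by omega) hlw hyw hzw) <|
    Det.seq (det_blockP (B := B) L hS ?_ ?_ ?_ ?_ ?_ ?_ ?_ hBw ?_) <|
    Det.seq (det_hadsP (ν := ν) hS ?_ ?_ ?_ ?_) <|
    Det.seq (det_rotP (ν := ν) (j := j) (T := T) (m := m) hS ?_ ?_ ?_ ?_ ?_ hNw hTw hjw) <|
    Det.seq (det_set j 2 ?_ ?_) <| Det.seq (lp.ge ⟨?_, ?_, ?_, .inr ?_, ?_, ?_⟩) <| det_queryP)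
    ⟨?_, ?_, ?_, .inr ?_, ?_, ?_⟩
  all_goals first
    | omega
    | (simp only [View.time_tick, View.time_act, View.time_set, View.time_ask, Nat.mul_zero]; omega)
    | rfl
    | (simp [v0, v3, v5, v6, v8, v9, v13, h20, h21, h22, h23, h24, h26, h32, h33, h37, h39, hpsi]; done)
    | (simp; omega)
    | (intro r _
       simp only [View.var_tick, View.var_set, View.var_act, View.var_ask]
       split_ifs <;> simp_all)

end

end HybridRAM

/-! ### Measurement, update of the best key, and the law of a search -/

namespace HybridRAM

set_option linter.unusedSimpArgs false

noncomputable section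

open scoped ENNReal

variable {w S : ℕ} {E : Env}

open Ex in
/-- Read as many bits of the measurement outcome as register `8` says. -/
def readP : Program :=
  assign 29 (v 8) ;;
  .loop 29 (.instr (.readOut 30 32) ;; assign 26 (v 26 + v 30 * bin .shl (lit 1) (v 32)) ;;
    assign 32 (v 32 + lit 1) ;; assign 29 (v 29 - lit 1)) ;; zero 30 ;; zero 32

theorem det_readP {σ : View w S} {m : ℕ} {x : Basis S} (hx : σ.out = some x) (h8 : σ.var 8 = m)
    (hm : m < 2 ^ w) (h26 : σ.var 26 = 0) (h29 : σ.var 29 = 0) (h30 : σ.var 30 = 0)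
    (h32 : σ.var 32 = 0) : Det E readP σ ((σ.set 26 (val x m)).tick (40 * m + 10)) := by
  have lp := Det.loop (E := E) (P := .instr (.readOut 30 32) ;;
      assign 26 (.v 26 + .v 30 * .bin .shl (.lit 1) (.v 32)) ;;
      assign 32 (.v 32 + .lit 1) ;; assign 29 (.v 29 - .lit 1)) (r := 29) (m := m) (by norm_num)
    hm.le
    (fun i => ((((σ.set 26 (val x i)).set 30 (if i = 0 then 0 else (bit x (i - 1)).toNat)).set 32
      i).set 29 (m - i)).tick (2 + 40 * i))
    (fun i hi => by
      have hiw : i < 2 ^ w := by omega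
      refine ⟨by simp [Nat.mod_eq_of_lt (show m - i < 2 ^ w by omega)]; omega, ?_⟩
      refine Det.le (Det.seq (det_readOut (x := x) (by norm_num) (by norm_num) ?_ ?_) <|
        Det.seq (det_set (val x (i + 1)) 12 ?_ ?_) <| Det.seq (det_set (i + 1) 5 ?_ ?_) <|
        det_set (m - (i + 1)) 5 ?_ ?_) ⟨?_, ?_, ?_, .inr ?_, ?_, ?_⟩
      all_goals first
        | (simp only [View.time_tick, View.time_act, View.time_set]; omega)
        | (simp [hx, hiw, val]; done)
        | (simp; omega)
        | (intro r _
           simp only [View.var_tick, View.var_set, View.var_act]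
           split_ifs <;> simp_all)) (by simp)
  refine Det.le (Det.seq (det_set m 2 ?_ ?_) <| Det.seq (lp.ge ⟨?_, ?_, ?_, .inr ?_, ?_, ?_⟩) <|
    Det.seq (det_zero (by norm_num)) (det_zero (by norm_num)))
    ⟨?_, ?_, ?_, .inr ?_, ?_, ?_⟩
  all_goals first
    | (simp only [View.time_tick, View.time_act, View.time_set]; omega)
    | (simp [h8]; done)
    | (intro r _
       simp only [View.var_tick, View.var_set, View.var_act]
       split_ifs <;> simp_all [val])

/-- Is the element with number `i` eligible, and its key in `[z, y)`? -/
def marks (E : Env) (n l z y i : ℕ) : Bool := decide (z ≤ E.key l i ∧ E.key l i < y ∧ i < n)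

/-- The new best key if `i` was measured. -/
def improve (E : Env) (n l z y i : ℕ) : ℕ := if marks E n l z y i = true then E.key l i else y

open Ex in
/-- Update the best key in register `22`. -/
def updateP : Program :=
  assign 30 (bin .lt (v 26) (v 22) * bin .lt (v 21) (v 26 + lit 1) * bin .lt (v 26 % v 9) (v 0)) ;;
  assign 22 (v 30 * v 26 + (lit 1 - v 30) * v 22) ;;
  zero 24 ;; zero 26 ;; zero 27 ;; zero 28 ;; zero 30

theorem key_mod {l i : ℕ} (hi : i < 2 ^ l) : E.key l i % 2 ^ l = i := by
  rw [Env.key, Nat.mul_add_mod, Nat.mod_eq_of_lt hi]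

/-- The residue of the measured key modulo `2 ^ l` is the index, so padding is recognised without a
further query. The selection is arithmetic and takes the same time for every outcome. -/
theorem det_updateP {σ : View w S} {n l z y i : ℕ} (h0 : σ.var 0 = n) (h9 : σ.var 9 = 2 ^ l)
    (h21 : σ.var 21 = z) (h22 : σ.var 22 = y) (h26 : σ.var 26 = E.key l i) (hi : i < 2 ^ l)
    (hz : z < 2 ^ w) (hy : y < 2 ^ w) (hn : n < 2 ^ w) (hl : 2 ^ l < 2 ^ w)
    (hk : E.key l i + 1 < 2 ^ w) (h30 : σ.var 30 = 0) :
    Det E updateP σ ((((((σ.set 22 (improve E n l z y i)).set 24 0).set 26 0).set 27 0).set 28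
      0).tick 40) := by
  have hkw : E.key l i < 2 ^ w := by omega
  have hmod := key_mod (E := E) hi
  have hiw : i < 2 ^ w := by omega
  have e1 : (if E.key l i < y then 1 else 0) * (if z < E.key l i + 1 then 1 else 0) *
      (if i < n then 1 else 0) = (marks E n l z y i).toNat := by
    unfold marks
    by_cases h1 : E.key l i < y <;> by_cases h2 : z ≤ E.key l i <;> by_cases h3 : i < n <;>
      simp [h1, h2, h3, Nat.lt_succ_iff]
  have e2 : (marks E n l z y i).toNat * E.key l i + (1 - (marks E n l z y i).toNat) * y =
      improve E n l z y i := by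
    unfold improve
    cases marks E n l z y i <;> simp
  have hb : (marks E n l z y i).toNat ≤ 1 := Bool.toNat_le _
  refine Det.le (Det.seq (det_set (marks E n l z y i).toNat 20 ?_ ?_) <|
    Det.seq (det_set (improve E n l z y i) 12 ?_ ?_) <| Det.seq (det_zero (by norm_num)) <|
    Det.seq (det_zero (by norm_num)) <| Det.seq (det_zero (by norm_num)) <|
    Det.seq (det_zero (by norm_num)) <| det_zero (by norm_num))
    ⟨?_, ?_, ?_, .inr ?_, ?_, ?_⟩
  all_goals first
    | (simp only [View.time_tick, View.time_act, View.time_set]; omega)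
    | (simp only [Ex.ev_add, Ex.ev_mul, Ex.ev_mod, Ex.ev_sub, Ex.ev_lt, Ex.ev_v, Ex.ev_lit,
         View.var_tick, View.var_set, h0, h9, h21, h22, h26, hmod, reduceIte, Nat.reduceEqDiff]
       first | exact e1 | exact e2)
    | (simp [h0, h9, h21, h22, h26, hmod, hz, hy, hn, hl, hk, hkw, hiw, hb]; done)
    | (intro r _
       simp only [View.var_tick, View.var_set, View.var_act]
       split_ifs <;> simp_all)

theorem det_read_updateP {σ : View w S} {n l b y z i : ℕ} {x : Basis S} (hx : σ.out = some x)
    (h0 : σ.var 0 = n) (h8 : σ.var 8 = l + b + 1) (h9 : σ.var 9 = 2 ^ l)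
    (h21 : σ.var 21 = z) (h22 : σ.var 22 = y) (hval : val x (l + b + 1) = E.key l i)
    (hi : i < 2 ^ l) (hk : E.key l i < 2 ^ (l + b)) (hz : z < 2 ^ w) (hy : y < 2 ^ w)
    (hn : n ≤ 2 ^ l) (hbig : 2 ^ (l + b + 4) ≤ 2 ^ w)
    (h26 : σ.var 26 = 0) (h29 : σ.var 29 = 0) (h30 : σ.var 30 = 0) (h32 : σ.var 32 = 0) :
    Det E (readP ;; updateP) σ ((((((σ.set 22 (improve E n l z y i)).set 24 0).set 27 0).set 28
      0)).tick (40 * (l + b + 1) + 50)) := by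
  have hlm : 2 ^ l ≤ 2 ^ (l + b) := Nat.pow_le_pow_right (by norm_num) (by omega)
  have hm3 : 2 ^ (l + b + 4) = 16 * 2 ^ (l + b) := by ring
  have hmpos := Nat.two_pow_pos (l + b)
  have hm := (Nat.lt_two_pow_self (n := l + b + 4))
  refine Det.le (Det.seq (det_readP (m := l + b + 1) hx h8 (by omega) h26 h29 h30 h32)
    (det_updateP (n := n) (l := l) (z := z) (y := y) (i := i) ?_ ?_ ?_ ?_ ?_ hi hz hy (by omega)
      (by omega) (by omega) ?_)) ⟨?_, ?_, ?_, .inr ?_, ?_, ?_⟩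
  all_goals first
    | (simp only [View.time_tick, View.time_act, View.time_set]; omega)
    | (simp [h0, h9, h21, h22, h30, hval]; done)
    | (intro r _
       simp only [View.var_tick, View.var_set, View.var_act]
       split_ifs <;> simp_all)

/-- Search once in the block. -/
def searchP : Program := circuitP ;; .instr .run ;; readP ;; updateP

/-- What is known before a search in a block. -/
structure Search (E : Env) (l b ν n B z : ℕ) (σ : View w S) : Prop extends Ready E l b ν n σ where
  hB : 2 ^ ν * (B + 1) ≤ 2 ^ l
  hz : z < 2 ^ (l + b + 1)
  dummy : ∀ i, n ≤ i → E.table i = 0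
  v20 : σ.var 20 = B
  v21 : σ.var 21 = z
  psi : σ.psi = psiInit
  out : σ.out = none

/-- A state with best key `y`, when `q` queries and `t` time steps have been made. -/
def View.upto (σ : View w S) (T q t y : ℕ) : View w S := (((σ.set 23 T).set 22 y).ask q).tick t

/-- The time for a search that expects `T` marked elements. -/
def searchTime (S m N T : ℕ) : ℕ := 4000 * m * (iters N T + 1) + S
def searchQueries (N T : ℕ) : ℕ := 2 * iters N T + 1

/-- The probability to measure the element `u` of the block. -/
def hit (E : Env) (l ν n B z y T u : ℕ) (a : Bool) : ℝ :=
  gAmp (phases E l ν B y z (clampLo n z) (clampHi n l y z)) (extraAngle (iters (2 ^ ν) T) ν T) ν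
    (iters (2 ^ ν) T) u a ^ 2

/-- Reduces a search to the classical distribution `hit` on the block. Time and queries are the same
for all outcomes; in the final view only the best key is random. Normalisation is passed on as a
hypothesis. -/
theorem spec_searchP {σ : View w S} {l b ν n B z : ℕ} (R : Search E l b ν n B z σ)
    {T y q t : ℕ} (hT : 1 ≤ T) (hTN : T ≤ 2 ^ ν) (hy : y < 2 ^ (l + b + 1)) (ok : ℕ → Prop)
    (hok : ∀ i, 2 ^ ν * B ≤ i → i < 2 ^ ν * (B + 1) → ok (improve E n l z y i)) (G : ℕ → ℝ≥0∞)
    {p : ℝ≥0∞}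
    (h : ∑ u ∈ Finset.range (2 ^ ν), ∑ a, hit E l ν n B z y T u a = 1 →
      ∑ u ∈ Finset.range (2 ^ ν), ∑ a, ENNReal.ofReal (hit E l ν n B z y T u a) *
        G (improve E n l z y (2 ^ ν * B + u)) ≤ p) :
    Spec E searchP (σ.upto T q t y)
      (σ.upto T (q + searchQueries (2 ^ ν) T) (t + searchTime S (l + b + 1) (2 ^ ν) T)) ok G p := by
  intro f hf
  have L := R.layout
  have hle := L.le
  have hr := L.room
  have hbig := R.big
  have hνl : 2 ^ ν ≤ 2 ^ l := Nat.pow_le_pow_right (by norm_num) hle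
  have hlm : 2 ^ l ≤ 2 ^ (l + b) := Nat.pow_le_pow_right (by norm_num) (by omega)
  have hpow : 2 ^ (l + b + 1) = 2 * 2 ^ (l + b) := by ring
  have hm3 : 2 ^ (l + b + 4) = 8 * 2 ^ (l + b + 1) := by ring
  have hmpos := Nat.two_pow_pos (l + b + 1)
  have hz := R.hz
  have hS := R.hS
  have hn := R.n_le
  have hzz := R.zero
  have R' : Ready E l b ν n (σ.upto T q t y) :=
    ⟨L, R.hS, R.big, R.n_le, by simp [View.upto, R.v0], by simp [View.upto, R.v3],
      by simp [View.upto, R.v5], by simp [View.upto, R.v6], by simp [View.upto, R.v8],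
      by simp [View.upto, R.v9], by simp [View.upto, R.v13], fun r h1 h2 => by
        simp only [View.upto, View.var_tick, View.var_ask, View.var_set]
        rw [if_neg (by omega), if_neg (by omega), R.zero r h1 h2]⟩
  refine Det.seq_tri (det_circuitP (B := B) (z := z) (y := y) (T := T) R' ?_ ?_ ?_ ?_ ?_ hT hTN R.hB
    hy R.hz) ?_
  · simp [View.upto, R.v20]
  · simp [View.upto, R.v21]
  · simp [View.upto]
  · simp [View.upto]
  · simp [View.upto, R.psi]
  set j := iters (2 ^ ν) T with hj
  set ψ : Basis S → ℂ := amp E (extraAngle j ν T) ν l (l + b + 1) B y z (clampLo n z)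
    (clampHi n l y z) j with hψ
  have hemb := isEmb_amp (S := S) (θ := extraAngle j ν T) L R.hB hy R.hz
    (c₁ := clampLo n z) (c₂ := clampHi n l y z) (by unfold clampLo; omega)
    (by unfold clampHi clampLo; omega) j
  rw [← hψ] at hemb
  -- The final query permutes the basis states, so it disappears by a change of variables; what
  -- remains is supported on the block.
  have hre : ∀ F : Basis S → ℂ → ℝ≥0∞, (∀ x, F x 0 = 0) →
      ∑ x, F x (ψ (queryMap E x)) = ∑ u ∈ Finset.range (2 ^ ν), ∑ a,
        F (queryMap E (pt ν l (l + b + 1) B u a)) (ψ (pt ν l (l + b + 1) B u a)) := by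
    intro F hF
    rw [← sum_block (b := b) (B := B) L (f := fun x => F (queryMap E x) (ψ x))
      fun x hx => by rw [hemb.2 x hx, hF]]
    rw [← Equiv.sum_comp (queryMap_involutive E).toPerm]
    refine Finset.sum_congr rfl fun x _ => ?_
    simp only [Function.Involutive.coe_toPerm]
    rw [queryMap_involutive E x]
  have hreR : ∑ x, ‖ψ (queryMap E x)‖ ^ 2 = ∑ u ∈ Finset.range (2 ^ ν), ∑ a,
      hit E l ν n B z y T u a := by
    have e1 : ∑ x, ‖ψ (queryMap E x)‖ ^ 2 = ∑ x, ‖ψ x‖ ^ 2 :=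
      Equiv.sum_comp (queryMap_involutive E).toPerm fun x => ‖ψ x‖ ^ 2
    rw [e1, sum_block (b := b) (B := B) L fun x hx => by rw [hemb.2 x hx]; simp]
    refine Finset.sum_congr rfl fun u hu => Finset.sum_congr rfl fun a _ => ?_
    rw [hemb.1 u (Finset.mem_range.1 hu) a, Complex.norm_real, Real.norm_eq_abs, sq_abs, hit]
  -- The weakest precondition of reading and updating is evaluated separately at each measured
  -- state.
  refine Tri.seq (h := fun τ => sInf {v | Tri E (readP ;; updateP) τ f v}) (v := p) ?_
    fun τ s hs g hg => le_sInf fun _ hv => hv s hs g hg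
  refine tri_run fun hnorm => ?_
  have hnorm' : ∑ x, ‖ψ (queryMap E x)‖ ^ 2 = 1 := hnorm
  refine le_trans ?_ (h (hreR ▸ hnorm'))
  simp only [View.psi_tick, View.psi_ask, View.psi_set, View.psi_act]
  rw [hre (fun x c => ENNReal.ofReal (‖c‖ ^ 2) * _) (by simp)]
  refine Finset.sum_le_sum fun u hu => Finset.sum_le_sum fun a _ => ?_
  have hu := Finset.mem_range.1 hu
  rw [hemb.1 u hu a, Complex.norm_real, Real.norm_eq_abs, sq_abs]
  gcongr ?_ * ?_
  · rfl
  have hi : 2 ^ ν * B + u < 2 ^ l := by have := R.hB; nlinarith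
  have hkey : E.key l (2 ^ ν * B + u) < 2 ^ (l + b) := key_lt L hi
  have hpow : 2 ^ (l + b + 1) = 2 * 2 ^ (l + b) := by ring
  refine le_trans (sInf_le ((Det.tri (Det.le (υ := σ.upto T (q + searchQueries (2 ^ ν) T)
      (t + searchTime S (l + b + 1) (2 ^ ν) T) (improve E n l z y (2 ^ ν * B + u)))
    (det_read_updateP (x := queryMap E (pt ν l (l + b + 1) B u a)) (n := n) (l := l) (b := b)
      (z := z) (y := y) (i := 2 ^ ν * B + u) rfl ?_ ?_ ?_ ?_ ?_ (val_queryMap_pt L hu hi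
        (by omega) le_rfl) hi hkey (by omega) (by omega) hn hbig ?_ ?_ ?_ ?_)
    ⟨?_, ?_, ?_, .inl ?_, ?_, ?_⟩) f))) (hf _ (hok _ (by omega) (by rw [mul_add]; omega)))
  all_goals try
    simp [View.upto, R.v0, R.v8, R.v9, R.v20, R.v21, hzz]
    done
  · intro r _
    simp only [View.upto, View.var_tick, View.var_set, View.var_act, View.var_ask]
    split_ifs <;> simp_all
  · exact R.psi.symm
  · exact R.out
  · simp only [View.time_tick, View.time_act, View.time_set, View.time_ask, View.upto, searchTime]
    have e : 4000 * (l + b + 1) * (j + 1) = 4000 * ((l + b + 1) * j) + 4000 * (l + b + 1) := by ring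
    have e2 : (3100 * (l + b + 1) + 950) * j = 3100 * ((l + b + 1) * j) + 950 * j := by ring
    -- Since l + b + 1 ≥ 2, the lower-order term 950 j fits into the difference between 3100 and
    -- 4000.
    have e3 : 2 * j ≤ (l + b + 1) * j := Nat.mul_le_mul_right _ (by have := L.one_le; omega)
    rw [← hj, e, e2]
    have := L.one_le
    omega
  · simp [View.upto, searchQueries]; omega

end

end HybridRAM

/-! ### How a search changes the rank of the best key -/

namespace HybridRAM

set_option linter.unusedSimpArgs false

noncomputable section

open scoped ENNReal

variable {w S : ℕ} {E : Env}

/-! ## The effect of a search -/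

/-- Flips below `y` and below `z` leave a sign on the keys in [z, y). Padding indices have value 0,
so their keys are the numbers in [n, 2^l), where no genuine key lies: it is below `n` for value 0
and at least 2^l otherwise. The clamped thresholds delimit [z, y) ∩ [n, 2^l), so the other two flips
cancel the sign on exactly the padding. -/
theorem phases_eq_marking {l n ν B y z u : ℕ} (hzy : z ≤ y)
    (hd : ∀ i, n ≤ i → E.table i = 0) (hi : 2 ^ ν * B + u < 2 ^ l) (a : Bool) :
    phases E l ν B y z (clampLo n z) (clampHi n l y z) u a =
      marking (fun u => marks E n l z y (2 ^ ν * B + u)) u a := by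
  unfold phases marking marks below clampHi clampLo
  cases a
  · simp
  simp only [Bool.true_and, and_true, decide_eq_true_eq]
  set i := 2 ^ ν * B + u
  have hkey : E.key l i = 2 ^ l * E.table i + i := rfl
  set x := E.key l i
  by_cases hin : i < n
  · have hx : x < n ∨ 2 ^ l ≤ x := by
      rcases Nat.eq_zero_or_pos (E.table i) with h | h
      · left; rw [hkey, h]; omega
      · right; rw [hkey]; nlinarith
    by_cases h1 : x < z <;> by_cases h2 : x < y
    · have e1 : x < max z n := by omega
      have e2 : x < max (max z n) (min y (2 ^ l)) := by omega
      have e3 : ¬ (z ≤ x ∧ x < y ∧ i < n) := by omega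
      simp [h1, h2, e1, e2, e3]
    · omega
    · have e3 : z ≤ x ∧ x < y ∧ i < n := by omega
      by_cases e1 : x < max z n
      · have e2 : x < max (max z n) (min y (2 ^ l)) := by omega
        simp only [h1, h2, e1, e2, e3, if_true, if_false, and_self]; norm_num
      · have e2 : ¬ x < max (max z n) (min y (2 ^ l)) := by omega
        simp only [h1, h2, e1, e2, e3, if_true, if_false, and_self]; norm_num
    · have e3 : ¬ (z ≤ x ∧ x < y ∧ i < n) := by omega
      by_cases e1 : x < max z n
      · have e2 : x < max (max z n) (min y (2 ^ l)) := by omega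
        simp only [h1, h2, e1, e2, e3, if_true, if_false]; norm_num
      · have e2 : ¬ x < max (max z n) (min y (2 ^ l)) := by omega
        simp only [h1, h2, e1, e2, e3, if_true, if_false]; norm_num
  · have hx : x = i := by rw [hkey, hd i (by omega)]; omega
    have e3 : ¬ (z ≤ x ∧ x < y ∧ i < n) := by omega
    by_cases h1 : x < z
    · have h2 : x < y := by omega
      have e1 : x < max z n := by omega
      have e2 : x < max (max z n) (min y (2 ^ l)) := by omega
      simp only [h1, h2, e1, e2, e3, if_true, if_false]; norm_num; omega
    · have e1 : ¬ x < max z n := by omega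
      by_cases h2 : x < y
      · have e2 : x < max (max z n) (min y (2 ^ l)) := by omega
        simp only [h1, h2, e1, e2, e3, if_true, if_false]; norm_num; omega
      · have e2 : ¬ x < max (max z n) (min y (2 ^ l)) := by omega
        simp only [h1, h2, e1, e2, e3, if_true, if_false]; norm_num

/-- The elements of the block with keys in `[z, y)`. -/
def marked (E : Env) (n l ν B z y : ℕ) : Finset ℕ :=
  (Finset.range (2 ^ ν)).filter fun u => marks E n l z y (2 ^ ν * B + u) = true

/-- The number of elements of the block with keys in `[z, y)`. -/
def rank (E : Env) (n l ν B z y : ℕ) : ℕ := (marked E n l ν B z y).card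

theorem mem_marked {n l ν B z y u : ℕ} : u ∈ marked E n l ν B z y ↔ u < 2 ^ ν ∧
    z ≤ E.key l (2 ^ ν * B + u) ∧ E.key l (2 ^ ν * B + u) < y ∧ 2 ^ ν * B + u < n := by
  simp [marked, marks]

theorem rank_mono {n l ν B z y y' : ℕ} (h : y ≤ y') :
    rank E n l ν B z y ≤ rank E n l ν B z y' :=
  Finset.card_le_card fun u => by simp only [mem_marked]; omega

theorem rank_le {n l ν B z y : ℕ} : rank E n l ν B z y ≤ 2 ^ ν :=
  (Finset.card_filter_le _ _).trans_eq (Finset.card_range _)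

/-- A marked element is not below its own key, so it no longer counts itself. -/
theorem rank_key_lt {n l ν B z y u : ℕ} (hu : u ∈ marked E n l ν B z y) :
    rank E n l ν B z (E.key l (2 ^ ν * B + u)) < rank E n l ν B z y := by
  refine Finset.card_lt_card (Finset.ssubset_iff_subset_ne.2 ⟨fun v => ?_, fun h => ?_⟩)
  · simp only [mem_marked] at *; omega
  · rw [← h] at hu
    simp [mem_marked] at hu

theorem key_injective {l i j : ℕ} (hi : i < 2 ^ l) (hj : j < 2 ^ l) (h : E.key l i = E.key l j) :
    i = j := by rw [← key_mod (E := E) hi, h, key_mod hj]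

/-- At least half of the marked elements have small rank, if the bound is large enough. -/
theorem card_low {n l ν B z y s : ℕ} (hB : 2 ^ ν * (B + 1) ≤ 2 ^ l)
    (hs : rank E n l ν B z y ≤ 2 * s + 1) :
    rank E n l ν B z y ≤ 2 * ((marked E n l ν B z y).filter fun u =>
      rank E n l ν B z (E.key l (2 ^ ν * B + u)) ≤ s).card := by
  set A := marked E n l ν B z y with hA
  set f : ℕ → ℕ := fun u => rank E n l ν B z (E.key l (2 ^ ν * B + u)) with hf
  have hlt : ∀ u ∈ A, 2 ^ ν * B + u < 2 ^ l := fun u hu => by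
    have := (mem_marked.1 hu).1; nlinarith
  have hmem : ∀ u ∈ A, ∀ v ∈ A, E.key l (2 ^ ν * B + u) < E.key l (2 ^ ν * B + v) → f u < f v := by
    intro u hu v hv h
    refine rank_key_lt ?_
    rw [mem_marked] at hu hv ⊢; omega
  have hinj : Set.InjOn f A := by
    intro u hu v hv h
    rcases Nat.lt_trichotomy (E.key l (2 ^ ν * B + u)) (E.key l (2 ^ ν * B + v)) with h1 | h1 | h1
    · exact absurd h (hmem u hu v hv h1).ne
    · have := key_injective (hlt u hu) (hlt v hv) h1; omega
    · exact absurd h (hmem v hv u hu h1).ne'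
  -- The ranks of the marked keys are distinct and smaller than their number, so they are exactly 0,
  -- …, `A.card` - 1.
  have himg : A.image f = Finset.range A.card := by
    refine Finset.eq_of_subset_of_card_le (fun x hx => ?_) ?_
    · obtain ⟨u, hu, rfl⟩ := Finset.mem_image.1 hx
      exact Finset.mem_range.2 (rank_key_lt hu)
    · rw [Finset.card_range, Finset.card_image_of_injOn hinj]
  have hcard : (A.filter fun u => f u ≤ s).card = ((Finset.range A.card).filter (· ≤ s)).card := by
    rw [← himg, Finset.filter_image, Finset.card_image_of_injOn]
    exact hinj.mono (by intro u hu; exact (Finset.mem_filter.1 hu).1)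
  -- Ranks at most `s` belong to the first `s + 1` elements, or to all of them; either is at least
  -- half of `2 * s + 1`.
  have hmin : (Finset.range A.card).filter (· ≤ s) = Finset.range (min A.card (s + 1)) := by
    ext x; simp [Nat.lt_succ_iff]
  change A.card ≤ _
  rw [hcard, hmin, Finset.card_range]
  have : A.card ≤ 2 * s + 1 := hs
  omega

theorem hit_nonneg {l ν n B z y T u : ℕ} {a : Bool} : 0 ≤ hit E l ν n B z y T u a := sq_nonneg _

theorem sum_ofReal_hit {l ν n B z y T : ℕ}
    (h : ∑ u ∈ Finset.range (2 ^ ν), ∑ a, hit E l ν n B z y T u a = 1) :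
    ∑ u ∈ Finset.range (2 ^ ν), ∑ a, ENNReal.ofReal (hit E l ν n B z y T u a) = 1 := by
  rw [← ENNReal.ofReal_one, ← h, ENNReal.ofReal_sum_of_nonneg
    fun _ _ => Finset.sum_nonneg fun _ _ => hit_nonneg]
  exact Finset.sum_congr rfl fun u _ => (ENNReal.ofReal_sum_of_nonneg fun _ _ => hit_nonneg).symm

theorem improve_eq_or {n l ν B z y u : ℕ} (hu : u < 2 ^ ν) :
    (u ∉ marked E n l ν B z y ∧ improve E n l z y (2 ^ ν * B + u) = y) ∨
      (u ∈ marked E n l ν B z y ∧ improve E n l z y (2 ^ ν * B + u) = E.key l (2 ^ ν * B + u)) := by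
  by_cases h : marks E n l z y (2 ^ ν * B + u) = true
  · exact .inr ⟨by simp [marked, hu, h], by simp [improve, h]⟩
  · exact .inl ⟨by simp [marked, h], by simp [improve, h]⟩

variable {σ : View w S} {l b ν n B z T y q t : ℕ} {G : ℕ → ℝ≥0∞}

/-- The results that a search can have. -/
def Result (E : Env) (n l ν B z y y' : ℕ) : Prop :=
  y' = y ∨ ∃ u ∈ marked E n l ν B z y, y' = E.key l (2 ^ ν * B + u)

theorem result_improve {i : ℕ} (h1 : 2 ^ ν * B ≤ i) (h2 : i < 2 ^ ν * (B + 1)) :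
    Result E n l ν B z y (improve E n l z y i) := by
  obtain ⟨u, rfl⟩ := Nat.exists_eq_add_of_le h1
  rcases improve_eq_or (E := E) (n := n) (l := l) (B := B) (z := z) (y := y)
    (show u < 2 ^ ν by rw [mul_add] at h2; omega) with h | h
  · exact .inl h.2
  · exact .inr ⟨u, h.1, h.2⟩

theorem Result.le {y' : ℕ} (h : Result E n l ν B z y y') : y' ≤ y := by
  rcases h with rfl | ⟨u, hu, rfl⟩
  · exact le_rfl
  · exact (mem_marked.1 hu).2.2.1.le

/-- Nothing relates `T` to the rank here; the bound is a plain average over the possible results. It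
covers searches that are tuned wrongly. -/
theorem spec_search (R : Search E l b ν n B z σ) (hT : 1 ≤ T) (hTN : T ≤ 2 ^ ν)
    (hy : y < 2 ^ (l + b + 1)) {p : ℝ≥0∞} (h : ∀ y', Result E n l ν B z y y' → G y' ≤ p) :
    Spec E searchP (σ.upto T q t y)
      (σ.upto T (q + searchQueries (2 ^ ν) T) (t + searchTime S (l + b + 1) (2 ^ ν) T))
      (Result E n l ν B z y) G p := by
  refine spec_searchP R hT hTN hy _ (fun i => result_improve) G fun h1 => ?_
  rw [← one_mul p, ← sum_ofReal_hit h1, Finset.sum_mul]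
  refine Finset.sum_le_sum fun u hu => ?_
  rw [Finset.sum_mul]
  refine Finset.sum_le_sum fun a _ => ?_
  gcongr
  exact h _ (result_improve (by omega) (by rw [mul_add]; have := Finset.mem_range.1 hu; omega))

/-- By `gAmp_exact` the outcomes that would leave `y` unchanged have probability zero. -/
theorem spec_search_exact (R : Search E l b ν n B z σ) (hT : 1 ≤ T)
    (hy : y < 2 ^ (l + b + 1)) (hzy : z ≤ y) (hr : rank E n l ν B z y = T) {p : ℝ≥0∞}
    (h : ∀ u ∈ marked E n l ν B z y, G (E.key l (2 ^ ν * B + u)) ≤ p) :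
    Spec E searchP (σ.upto T q t y)
      (σ.upto T (q + searchQueries (2 ^ ν) T) (t + searchTime S (l + b + 1) (2 ^ ν) T))
      (Result E n l ν B z y) G p := by
  refine spec_searchP R hT (hr ▸ rank_le) hy _ (fun i => result_improve) G fun h1 => ?_
  rw [← one_mul p, ← sum_ofReal_hit h1, Finset.sum_mul]
  refine Finset.sum_le_sum fun u hu => ?_
  rw [Finset.sum_mul]
  refine Finset.sum_le_sum fun a _ => ?_
  have hu := Finset.mem_range.1 hu
  rcases improve_eq_or (E := E) (n := n) (l := l) (B := B) (z := z) (y := y) hu with hm | hm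
  · have hi : ∀ u < 2 ^ ν, 2 ^ ν * B + u < 2 ^ l := fun u hu => by have := R.hB; nlinarith
    have : hit E l ν n B z y T u a = 0 := by
      rw [hit, gAmp_exact (mk := fun u => marks E n l z y (2 ^ ν * B + u)) (T := T) hr hT
        (le_iters hT) (fun u hu a => phases_eq_marking hzy R.dummy (hi u hu) a) hu ?_]
      · simp
      · have := hm.1
        simp only [marked, Finset.mem_filter, Finset.mem_range, hu, true_and] at this
        simp [this]
    simp [this]
  · rw [hm.2]
    gcongr
    exact h u hm.1

/-- By `card_low` at least half of the marked elements have rank at most T/2, and by `gAmp_half`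
each is measured with probability at least 1/(2r) for `r` marked elements. So the better value is
earned with probability at least 1/4. -/
theorem spec_search_half (R : Search E l b ν n B z σ) (hT : 1 ≤ T) (hTN : T ≤ 2 ^ ν)
    (hy : y < 2 ^ (l + b + 1)) (hzy : z ≤ y) (hr1 : T / 2 < rank E n l ν B z y)
    (hr2 : rank E n l ν B z y ≤ T) {p₁ p₂ : ℝ≥0∞}
    (h1 : ∀ y', Result E n l ν B z y y' → G y' ≤ p₁)
    (h2 : ∀ u ∈ marked E n l ν B z y, rank E n l ν B z (E.key l (2 ^ ν * B + u)) ≤ T / 2 →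
      G (E.key l (2 ^ ν * B + u)) ≤ p₂) (hp : p₂ ≤ p₁) :
    Spec E searchP (σ.upto T q t y)
      (σ.upto T (q + searchQueries (2 ^ ν) T) (t + searchTime S (l + b + 1) (2 ^ ν) T))
      (Result E n l ν B z y) G (1 / 4 * p₂ + 3 / 4 * p₁) := by
  refine spec_searchP R hT hTN hy _ (fun i => result_improve) G fun hsum => ?_
  have hsum' := sum_ofReal_hit hsum
  have hi : ∀ u < 2 ^ ν, 2 ^ ν * B + u < 2 ^ l := fun u hu => by have := R.hB; nlinarith
  set r := rank E n l ν B z y with hr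
  set low := (marked E n l ν B z y).filter fun u =>
      rank E n l ν B z (E.key l (2 ^ ν * B + u)) ≤ T / 2 with hlow
  have hcard : r ≤ 2 * low.card := card_low R.hB (by omega)
  have hsub : low ⊆ Finset.range (2 ^ ν) := (Finset.filter_subset _ _).trans (Finset.filter_subset _ _)
  set α := ∑ u ∈ low, ENNReal.ofReal (hit E l ν n B z y T u true) with hα
  set β := ∑ u ∈ Finset.range (2 ^ ν), ENNReal.ofReal (hit E l ν n B z y T u false) +
    ∑ u ∈ Finset.range (2 ^ ν) \ low, ENNReal.ofReal (hit E l ν n B z y T u true) with hβ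
  have hαβ : α + β = 1 := by
    rw [← hsum', hα, hβ]
    simp only [Fintype.sum_bool, Finset.sum_add_distrib]
    rw [← Finset.sum_sdiff (f := fun u => ENNReal.ofReal (hit E l ν n B z y T u true)) hsub]
    ring
  have hα4 : 1 / 4 ≤ α := by
    have hpos : (0 : ℝ) < r := by exact_mod_cast (show 0 < r by omega)
    have e : ∀ u ∈ low, ENNReal.ofReal (1 / (2 * r)) ≤ ENNReal.ofReal (hit E l ν n B z y T u true) := by
      intro u hu
      refine ENNReal.ofReal_le_ofReal ?_
      have hu2 := Finset.mem_range.1 (hsub hu)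
      have hu3 := (Finset.mem_filter.1 (Finset.mem_filter.1 hu).1).2
      exact gAmp_half (mk := fun u => marks E n l z y (2 ^ ν * B + u)) (t := r) rfl (by omega) hr2
        (by omega) (le_iters hT) (fun u hu a => phases_eq_marking hzy R.dummy (hi u hu) a)
        hu2 hu3
    calc (1 / 4 : ℝ≥0∞) = ENNReal.ofReal (1 / 4) := by
          rw [ENNReal.ofReal_div_of_pos (by norm_num)]; simp
      _ ≤ ENNReal.ofReal (low.card * (1 / (2 * r))) := by
          refine ENNReal.ofReal_le_ofReal ?_
          have : (r : ℝ) ≤ 2 * low.card := by exact_mod_cast hcard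
          rw [mul_one_div, div_le_div_iff₀ (by norm_num) (by positivity)]
          linarith
      _ = low.card • ENNReal.ofReal (1 / (2 * r)) := by
          rw [ENNReal.ofReal_mul (by positivity), ENNReal.ofReal_natCast, nsmul_eq_mul]
      _ ≤ α := Finset.card_nsmul_le_sum _ _ _ e
  have hle : ∑ u ∈ Finset.range (2 ^ ν), ∑ a, ENNReal.ofReal (hit E l ν n B z y T u a) *
      G (improve E n l z y (2 ^ ν * B + u)) ≤ α * p₂ + β * p₁ := by
    have hG : ∀ u ∈ Finset.range (2 ^ ν), G (improve E n l z y (2 ^ ν * B + u)) ≤ p₁ := fun u hu =>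
      h1 _ (result_improve (by omega) (by rw [mul_add]; have := Finset.mem_range.1 hu; omega))
    simp only [Fintype.sum_bool, Finset.sum_add_distrib]
    rw [← Finset.sum_sdiff (f := fun u => ENNReal.ofReal (hit E l ν n B z y T u true) *
      G (improve E n l z y (2 ^ ν * B + u))) hsub, hα, hβ, add_mul, Finset.sum_mul, Finset.sum_mul, Finset.sum_mul]
    have a1 : ∑ u ∈ low, ENNReal.ofReal (hit E l ν n B z y T u true) *
        G (improve E n l z y (2 ^ ν * B + u)) ≤
        ∑ u ∈ low, ENNReal.ofReal (hit E l ν n B z y T u true) * p₂ := by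
      refine Finset.sum_le_sum fun u hu => ?_
      have hu' := Finset.mem_filter.1 hu
      rcases improve_eq_or (E := E) (n := n) (l := l) (B := B) (z := z) (y := y)
        (Finset.mem_range.1 (hsub hu)) with hm | hm
      · exact absurd hu'.1 hm.1
      · rw [hm.2]
        gcongr
        exact h2 u hu'.1 hu'.2
    have a2 : ∑ u ∈ Finset.range (2 ^ ν), ENNReal.ofReal (hit E l ν n B z y T u false) *
        G (improve E n l z y (2 ^ ν * B + u)) ≤
        ∑ u ∈ Finset.range (2 ^ ν), ENNReal.ofReal (hit E l ν n B z y T u false) * p₁ :=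
      Finset.sum_le_sum fun u hu => by gcongr; exact hG u hu
    have a3 : ∑ u ∈ Finset.range (2 ^ ν) \ low, ENNReal.ofReal (hit E l ν n B z y T u true) *
        G (improve E n l z y (2 ^ ν * B + u)) ≤
        ∑ u ∈ Finset.range (2 ^ ν) \ low, ENNReal.ofReal (hit E l ν n B z y T u true) * p₁ :=
      Finset.sum_le_sum fun u hu => by gcongr; exact hG u (Finset.mem_sdiff.1 hu).1
    calc _ ≤ _ := add_le_add (add_le_add a3 a1) a2
      _ = _ := by ring
  refine hle.trans ?_
  -- The probability beyond 1/4 of a low result is charged the larger value, which leaves exactly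
  -- 3/4.
  have e34 : α - 1 / 4 + β = 3 / 4 := by
    have h4 : (1 / 4 : ℝ≥0∞) + (α - 1 / 4 + β) = 1 / 4 + 3 / 4 := by
      rw [← add_assoc, add_tsub_cancel_of_le hα4, hαβ, ENNReal.div_add_div_same]
      norm_num
      rw [ENNReal.div_self (by norm_num) (by norm_num)]
    exact (ENNReal.add_right_inj (by norm_num)).1 h4
  calc α * p₂ + β * p₁ = (1 / 4 + (α - 1 / 4)) * p₂ + β * p₁ := by rw [add_tsub_cancel_of_le hα4]
    _ = 1 / 4 * p₂ + ((α - 1 / 4) * p₂ + β * p₁) := by ring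
    _ ≤ 1 / 4 * p₂ + ((α - 1 / 4) * p₁ + β * p₁) := by gcongr
    _ = _ := by rw [← add_mul, e34]

end

end HybridRAM

/-! ### The minimum of a block: halving and countdown -/

namespace HybridRAM

set_option linter.unusedSimpArgs false

noncomputable section

open scoped ENNReal

variable {w S : ℕ} {E : Env}

/-! ## The smallest key of a block -/

theorem Search.set {σ : View w S} {l b ν n B z : ℕ} (R : Search E l b ν n B z σ) {r : ℕ}
    (hr : r = 18 ∨ r = 19 ∨ r = 22 ∨ r = 23) (x : ℕ) : Search E l b ν n B z (σ.set r x) := by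
  have h : ∀ r', (σ.set r x).var r' = if r' = r then x else σ.var r' := fun r' => by simp
  refine ⟨⟨R.layout, R.hS, R.big, R.n_le, ?_, ?_, ?_, ?_, ?_, ?_, ?_, fun r' h1 h2 => ?_⟩, R.hB, R.hz,
    R.dummy, ?_, ?_, R.psi, R.out⟩ <;> rw [h, if_neg (by omega)]
  exacts [R.v0, R.v3, R.v5, R.v6, R.v8, R.v9, R.v13, R.zero r' h1 h2, R.v20, R.v21]

variable {σ : View w S} {l b ν n B z T y q t : ℕ} {G : ℕ → ℝ≥0∞}

theorem Result.trans {y₀ y y' : ℕ} (h : Result E n l ν B z y₀ y) (h' : Result E n l ν B z y y') :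
    Result E n l ν B z y₀ y' := by
  have hle := h.le
  rcases h' with rfl | ⟨u, hu, rfl⟩
  · exact h
  · refine .inr ⟨u, ?_, rfl⟩
    rw [mem_marked] at *
    omega

theorem Result.ge {y₀ y : ℕ} (h : Result E n l ν B z y₀ y) (hz : z ≤ y₀) : z ≤ y := by
  rcases h with rfl | ⟨u, hu, rfl⟩
  · exact hz
  · exact (mem_marked.1 hu).2.1

open Ex in
/-- Search as many times as register `19` says. -/
def retryP : Program := .loop 19 (searchP ;; assign 19 (v 19 - lit 1))

/-- The rank never grows, so success persists, and before it each search fails with probability at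
most 3/4. All `r` searches are made in any case, which fixes the cost. If `z` exceeds the initial
key, which happens only after an earlier error, no more than `V` is claimed. -/
theorem spec_retryP (R : Search E l b ν n B z σ) {r y₀ : ℕ} (hr : r < 2 ^ w) (hT : 1 ≤ T)
    (hTN : T ≤ 2 ^ ν) (hy₀ : y₀ < 2 ^ (l + b + 1)) (hy : Result E n l ν B z y₀ y) {V v : ℝ≥0∞}
    (hvV : v ≤ V) :
    Spec E retryP ((σ.set 19 r).upto T q t y)
      ((σ.set 19 0).upto T (q + r * searchQueries (2 ^ ν) T)
        (t + r * (searchTime S (l + b + 1) (2 ^ ν) T + 10) + 1))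
      (Result E n l ν B z y₀)
      (fun y => if z ≤ y₀ ∧ rank E n l ν B z y ≤ T / 2 then v else V)
      (if z ≤ y₀ ∧ rank E n l ν B z y ≤ T then min V (v + (3 / 4) ^ r * V) else V) := by
  set Q := searchQueries (2 ^ ν) T
  set X := searchTime S (l + b + 1) (2 ^ ν) T
  -- With `i` searches left there are three cases: the rank is halved already, it can still be
  -- halved, or nothing is known.
  set val : ℕ → ℕ → ℝ≥0∞ := fun i y => if z ≤ y₀ ∧ rank E n l ν B z y ≤ T / 2 then v else
    if z ≤ y₀ ∧ rank E n l ν B z y ≤ T then min V (v + (3 / 4) ^ i * V) else V with hval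
  have hvalV : ∀ i y, val i y ≤ V := fun i y => by
    simp only [hval]; split_ifs
    exacts [hvV, min_le_left _ _, le_rfl]
  have lp := Spec.loop (E := E) (w := w) (S := S) (P := searchP ;; assign 19 (.v 19 - .lit 1))
    (r := 19) (m := r) (by norm_num) hr.le
    (fun i y => (σ.set 19 i).upto T (q + (r - i) * Q) (t + (r - i) * (X + 10)) y)
    (fun _ => Result E n l ν B z y₀) val (fun i hi y hy => by
      have hyl := hy.le
      refine ⟨by simp [View.upto, Nat.mod_eq_of_lt (show i + 1 < 2 ^ w by omega)], ?_⟩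
      have main : Spec E searchP ((σ.set 19 (i + 1)).upto T (q + (r - (i + 1)) * Q)
          (t + (r - (i + 1)) * (X + 10) + 1) y)
          ((σ.set 19 (i + 1)).upto T (q + (r - (i + 1)) * Q + Q)
            (t + (r - (i + 1)) * (X + 10) + 1 + X))
          (Result E n l ν B z y) (val i) (val (i + 1) y) := by
        have R' := R.set (r := 19) (by omega) (i + 1)
        by_cases h1 : z ≤ y₀ ∧ rank E n l ν B z y ≤ T / 2
        · refine spec_search R' hT hTN (by omega) fun y' hy' => ?_
          have := rank_mono (E := E) (n := n) (l := l) (ν := ν) (B := B) (z := z) hy'.le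
          simp only [hval]
          rw [if_pos ⟨h1.1, by omega⟩, if_pos h1]
        · by_cases h2 : z ≤ y₀ ∧ rank E n l ν B z y ≤ T
          · have h3 : T / 2 < rank E n l ν B z y := by
              by_contra h; exact h1 ⟨h2.1, by omega⟩
            have e : val (i + 1) y = min V (v + (3 / 4) ^ (i + 1) * V) := by
              simp only [hval]
              rw [if_neg h1, if_pos h2]
            rw [e]
            have sp := spec_search_half (q := q + (r - (i + 1)) * Q)
              (t := t + (r - (i + 1)) * (X + 10) + 1) (G := val i) R' hT hTN (by omega)
              (hy.ge h2.1) h3 h2.2 (p₁ := min V (v + (3 / 4) ^ i * V)) (p₂ := v)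
              (fun y' hy' => ?_) (fun u hu hu2 => ?_) (le_min hvV le_self_add)
            · refine sp.mono (fun y' hy' => ⟨hy', le_rfl⟩) ?_
              refine le_min ?_ ?_
              · calc (1 / 4 * v + 3 / 4 * min V (v + (3 / 4) ^ i * V) : ℝ≥0∞)
                    ≤ 1 / 4 * V + 3 / 4 * V := by gcongr; exact min_le_left _ _
                  _ = V := by
                    rw [← add_mul, ENNReal.div_add_div_same]
                    norm_num
                    rw [ENNReal.div_self (by norm_num) (by norm_num), one_mul]
              · calc (1 / 4 * v + 3 / 4 * min V (v + (3 / 4) ^ i * V) : ℝ≥0∞)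
                    ≤ 1 / 4 * v + 3 / 4 * (v + (3 / 4) ^ i * V) := by gcongr; exact min_le_right _ _
                  _ = (1 / 4 + 3 / 4) * v + (3 / 4) ^ (i + 1) * V := by ring
                  _ = _ := by
                    rw [ENNReal.div_add_div_same]
                    norm_num
                    rw [ENNReal.div_self (by norm_num) (by norm_num), one_mul]
            · have := rank_mono (E := E) (n := n) (l := l) (ν := ν) (B := B) (z := z) hy'.le
              simp only [hval]
              rw [if_pos (show z ≤ y₀ ∧ rank E n l ν B z y' ≤ T from ⟨h2.1, by omega⟩)]
              split_ifs
              exacts [le_min hvV le_self_add, le_rfl]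
            · simp only [hval]
              rw [if_pos ⟨h2.1, hu2⟩]
          · have e : val (i + 1) y = V := by
              simp only [hval]
              rw [if_neg h1, if_neg h2]
            rw [e]
            exact spec_search R' hT hTN (by omega) fun y' _ => hvalV i y'
      refine Spec.seq main fun y' hy' => ?_
      refine Det.spec y' (Det.le (det_set i 5 ?_ ?_) ⟨?_, ?_, ?_, .inr ?_, ?_, ?_⟩) (hy.trans hy')
        le_rfl
      all_goals have er : r - i = r - (i + 1) + 1 := by omega
      all_goals first
        | (simp [View.upto]; done)
        | (simp only [View.upto, View.time_tick, View.time_ask, View.time_set, View.queries_tick,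
            View.queries_set, View.queries_ask, er, Nat.succ_mul]; omega)
        | (intro r _
           simp only [View.upto, View.var_tick, View.var_set, View.var_act, View.var_ask]
           split_ifs <;> simp_all)) (fun y _ => by simp [View.upto]) y hy
  have lp' := lp.ge (υ := (σ.set 19 r).upto T q t y) ⟨fun _ _ => by simp [View.upto], rfl, rfl,
    .inr rfl, by simp [View.upto], by simp [View.upto]⟩
  refine fun f hf => (lp' f fun y' hy' => ?_).mono (fun _ => le_rfl) ?_
  · refine le_trans (le_of_eq ?_) ((hf y' hy').trans ?_)
    · simp [View.upto, View.tick, View.ask, View.set, add_assoc]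
    · simp only [hval]
      split_ifs <;> first | exact le_rfl | skip
      exact le_min le_rfl (by simp)
  · simp only [hval]
    split_ifs with h1 h2 h2
    exacts [le_min hvV le_self_add, absurd ⟨h1.1, h1.2.trans (Nat.div_le_self _ _)⟩ h2, le_rfl, le_rfl]

open Ex in
/-- Search with fewer and fewer expected elements, until there are as many as register `10` says. -/
def halvingP : Program :=
  assign 18 (bin .lt (v 10) (v 23)) ;;
  .loop 18 (assign 19 (v 11) ;; retryP ;; assign 23 (v 23 / lit 2) ;;
    assign 18 (bin .lt (v 10) (v 23)))

/-- The number of halvings. -/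
def halvings (N t₀ : ℕ) : ℕ := sInf {s | N / 2 ^ s ≤ t₀}

theorem halvings_le {ν t₀ : ℕ} (h : 1 ≤ t₀) : halvings (2 ^ ν) t₀ ≤ ν :=
  Nat.sInf_le (by simpa using h)

theorem le_of_halvings {ν t₀ : ℕ} (h : 1 ≤ t₀) : 2 ^ ν / 2 ^ halvings (2 ^ ν) t₀ ≤ t₀ :=
  Nat.sInf_mem (s := {s | 2 ^ ν / 2 ^ s ≤ t₀}) ⟨ν, by simpa using h⟩

theorem lt_of_lt_halvings {N t₀ s : ℕ} (h : s < halvings N t₀) : t₀ < N / 2 ^ s := by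
  simpa using Nat.notMem_of_lt_sInf h

def halvingTime (S m N r s : ℕ) : ℕ :=
  ∑ i ∈ Finset.range s, (r * (searchTime S m N (N / 2 ^ i) + 10) + 40)

def halvingQueries (N r s : ℕ) : ℕ := ∑ i ∈ Finset.range s, r * searchQueries N (N / 2 ^ i)

/-- The state before the halving with number `s`. -/
def View.halved (σ : View w S) (l b ν t₀ r q t s y : ℕ) : View w S :=
  (σ.set 18 (if t₀ < 2 ^ ν / 2 ^ s then 1 else 0)).upto (2 ^ ν / 2 ^ s)
    (q + halvingQueries (2 ^ ν) r s) (t + halvingTime S (l + b + 1) (2 ^ ν) r s + 9) y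

theorem spec_halving_step (R : Search E l b ν n B z σ) {r t₀ y₀ s : ℕ} (hr : r < 2 ^ w)
    (h10 : σ.var 10 = t₀) (h11 : σ.var 11 = r) (h19 : σ.var 19 = 0) (ht₀w : t₀ < 2 ^ w)
    (hNw : 2 ^ ν < 2 ^ w) (hy₀ : y₀ < 2 ^ (l + b + 1)) (hlt : t₀ < 2 ^ ν / 2 ^ s)
    (hy : Result E n l ν B z y₀ y) {V v v' : ℝ≥0∞}
    (hv : v ≤ V) (hv' : min V (v + (3 / 4) ^ r * V) ≤ v') :
    Spec E (assign 19 (.v 11) ;; retryP ;; assign 23 (.v 23 / .lit 2) ;;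
        assign 18 (.bin .lt (.v 10) (.v 23)))
      ((σ.halved l b ν t₀ r q t s y).tick 1) (σ.halved l b ν t₀ r q t (s + 1))
      (Result E n l ν B z y₀)
      (fun y => if z ≤ y₀ ∧ rank E n l ν B z y ≤ 2 ^ ν / 2 ^ (s + 1) then v else V)
      (if z ≤ y₀ ∧ rank E n l ν B z y ≤ 2 ^ ν / 2 ^ s then v' else V) := by
  have hdw : ∀ i, 2 ^ ν / 2 ^ i < 2 ^ w := fun i => (Nat.div_le_self _ _).trans_lt hNw
  have hw : 2 < 2 ^ w := by
    have := R.layout.one_le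
    have : 2 ^ 1 ≤ 2 ^ ν := Nat.pow_le_pow_right (by norm_num) this
    omega
  have ed : 2 ^ ν / 2 ^ s / 2 = 2 ^ ν / 2 ^ (s + 1) := by rw [Nat.div_div_eq_div_mul, pow_succ]
  have hdle : 2 ^ ν / 2 ^ s ≤ 2 ^ ν := Nat.div_le_self _ _
  have e1 : halvingTime S (l + b + 1) (2 ^ ν) r (s + 1) = halvingTime S (l + b + 1) (2 ^ ν) r s +
      (r * (searchTime S (l + b + 1) (2 ^ ν) (2 ^ ν / 2 ^ s) + 10) + 40) :=
    Finset.sum_range_succ _ s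
  have e2 : halvingQueries (2 ^ ν) r (s + 1) = halvingQueries (2 ^ ν) r s +
      r * searchQueries (2 ^ ν) (2 ^ ν / 2 ^ s) := Finset.sum_range_succ _ s
  have sp := spec_retryP (q := q + halvingQueries (2 ^ ν) r s)
    (t := t + halvingTime S (l + b + 1) (2 ^ ν) r s + 9 + 1 + 3)
    (R.set (r := 18) (by omega) 1) hr (T := 2 ^ ν / 2 ^ s) (by omega) hdle hy₀ hy hv
  have sp' : Spec E retryP _ _ _ _ (if z ≤ y₀ ∧ rank E n l ν B z y ≤ 2 ^ ν / 2 ^ s then v' else V) :=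
    sp.mono (fun y' hy' => ⟨hy', le_rfl⟩) (by
      split_ifs with h
      exacts [hv', le_rfl])
  refine Det.seq_spec (det_set r 3 ?_ ?_) <|
    Spec.seq (sp'.ge ⟨?_, rfl, rfl, .inr rfl, ?_, ?_⟩) fun y' hy' =>
    Det.seq_spec (det_set (2 ^ ν / 2 ^ (s + 1)) 5 ?_ ?_) <|
    Det.spec y' (Det.le (det_set (if t₀ < 2 ^ ν / 2 ^ (s + 1) then 1 else 0) 5 ?_ ?_)
      ⟨?_, rfl, rfl, .inr rfl, ?_, ?_⟩) hy' (by rw [ed])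
  all_goals first
    | (simp [View.halved, View.upto, h10, h11, hdw, ht₀w, ed, hw]; done)
    | (simp only [View.halved, View.upto, View.time_tick, View.time_ask, View.time_set,
        View.queries_tick, View.queries_set, View.queries_ask]; omega)
    | (simp only [View.halved, View.upto, View.time_tick, View.time_ask, View.time_set,
        View.queries_tick, View.queries_set, View.queries_ask, e1, e2]; omega)
    | (intro r _
       simp only [View.halved, View.upto, View.var_tick, View.var_set, View.var_act, View.var_ask]
       split_ifs <;> simp_all)

/-- The first bound, 2^ν, holds for every rank. Each halving loses at most (3/4)^r V, and these
losses add up. -/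
theorem spec_halvingP (R : Search E l b ν n B z σ) {r t₀ y₀ : ℕ} (hr : r < 2 ^ w)
    (h10 : σ.var 10 = t₀) (h11 : σ.var 11 = r) (h18 : σ.var 18 = 0) (h19 : σ.var 19 = 0)
    (ht₀ : 1 ≤ t₀) (ht₀w : t₀ < 2 ^ w) (hNw : 2 ^ ν < 2 ^ w) (hy₀ : y₀ < 2 ^ (l + b + 1))
    {V v : ℝ≥0∞} (hvV : v ≤ V) :
    Spec E halvingP (σ.upto (2 ^ ν) q t y₀)
      (σ.upto (2 ^ ν / 2 ^ halvings (2 ^ ν) t₀)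
        (q + halvingQueries (2 ^ ν) r (halvings (2 ^ ν) t₀))
        (t + halvingTime S (l + b + 1) (2 ^ ν) r (halvings (2 ^ ν) t₀) + 10))
      (Result E n l ν B z y₀) (fun y => if z ≤ y₀ ∧ rank E n l ν B z y ≤ t₀ then v else V)
      (if z ≤ y₀ then min V (v + halvings (2 ^ ν) t₀ * ((3 / 4) ^ r * V)) else V) := by
  set s := halvings (2 ^ ν) t₀ with hs
  have hsν : s ≤ ν := halvings_le ht₀
  set δ : ℝ≥0∞ := (3 / 4) ^ r * V with hδ
  have hend := le_of_halvings (ν := ν) ht₀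
  rw [← hs] at hend
  have hpos := Nat.two_pow_pos ν
  have h1w : 1 % 2 ^ w = 1 := Nat.mod_eq_of_lt (by omega)
  have lp := Spec.loop (E := E) (w := w) (S := S) (P := assign 19 (.v 11) ;; retryP ;;
      assign 23 (.v 23 / .lit 2) ;; assign 18 (.bin .lt (.v 10) (.v 23)))
    (r := 18) (m := s) (by norm_num) (hsν.trans (Nat.lt_two_pow_self.le.trans hNw.le))
    (fun i => σ.halved l b ν t₀ r q t (s - i)) (fun _ => Result E n l ν B z y₀)
    (fun i y => if z ≤ y₀ ∧ rank E n l ν B z y ≤ 2 ^ ν / 2 ^ (s - i) then min V (v + i * δ) else V)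
    (fun i hi y hy => by
      have hlt := lt_of_lt_halvings (show s - (i + 1) < halvings (2 ^ ν) t₀ by omega)
      refine ⟨by simp [View.halved, View.upto, hlt, h1w], ?_⟩
      have er : s - i = s - (i + 1) + 1 := by omega
      rw [er]
      refine spec_halving_step R hr h10 h11 h19 ht₀w hNw hy₀ hlt hy (min_le_left _ _) ?_
      refine le_min (min_le_left _ _) ?_
      calc min V (min V (v + i * δ) + δ) ≤ (v + i * δ) + δ := by
            refine (min_le_right _ _).trans ?_
            gcongr
            exact min_le_right _ _
        _ = v + ((i + 1 : ℕ) : ℝ≥0∞) * δ := by push_cast; ring)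
    (fun y _ => by simp [View.halved, View.upto, not_lt.2 hend]) y₀ (.inl rfl)
  refine Det.seq_spec (det_set (if t₀ < 2 ^ ν then 1 else 0) 9 ?_ ?_) ?_
  · simp [View.upto, h10, hNw, ht₀w]
  · simp [View.upto, h10]
  intro f hf
  refine ((lp.ge ?_) f fun y hy => ?_).mono (fun _ => le_rfl) ?_
  · refine ⟨fun r _ => ?_, rfl, rfl, .inr rfl, ?_, ?_⟩
    · simp only [View.halved, View.upto, View.var_tick, View.var_set, View.var_act, View.var_ask,
        Nat.sub_self, pow_zero, Nat.div_one]
      split_ifs <;> simp_all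
    · simp [View.halved, View.upto, halvingTime, add_assoc]
    · simp [View.halved, View.upto, halvingQueries]
  · refine le_trans ?_ ((hf y hy).trans ?_)
    · refine le_of_eq (congrArg f ?_)
      simp only [Nat.sub_zero, if_neg (not_lt.2 hend), View.halved, View.upto]
      ext1
      · funext r
        simp only [View.var_tick, View.var_set, View.var_ask]
        split_ifs <;> simp_all
      all_goals simp [add_assoc]
    · simp only [Nat.sub_zero, Nat.cast_zero, zero_mul, add_zero]
      split_ifs <;> first | exact le_min hvV le_rfl | exact hvV | exact le_rfl | (exfalso; omega)
  · have hrank : rank E n l ν B z y₀ ≤ 2 ^ ν := rank_le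
    simp only [Nat.sub_self, pow_zero, Nat.div_one, hrank, and_true]
    exact le_rfl

open Ex in
/-- Search, expecting one element less each time. -/
def countdownP : Program := .loop 23 (searchP ;; assign 23 (v 23 - lit 1))

def countdownTime (S m N t₀ T : ℕ) : ℕ :=
  ∑ i ∈ Finset.range (t₀ - T), (searchTime S m N (t₀ - i) + 10)

def countdownQueries (N t₀ T : ℕ) : ℕ := ∑ i ∈ Finset.range (t₀ - T), searchQueries N (t₀ - i)

/-- Before the search for T elements the rank is at most T. If it equals T, the search is exact and
lowers it; otherwise it is at most T - 1 anyway. Hence the phase introduces no error. -/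
theorem spec_countdownP (R : Search E l b ν n B z σ) {t₀ y₀ : ℕ} (ht₀N : t₀ ≤ 2 ^ ν)
    (hNw : 2 ^ ν < 2 ^ w) (hy₀ : y₀ < 2 ^ (l + b + 1)) (hy : Result E n l ν B z y₀ y)
    {V v : ℝ≥0∞} (hvV : v ≤ V) :
    Spec E countdownP (σ.upto t₀ q t y)
      (σ.upto 0 (q + countdownQueries (2 ^ ν) t₀ 0)
        (t + countdownTime S (l + b + 1) (2 ^ ν) t₀ 0 + 1))
      (Result E n l ν B z y₀) (fun y => if z ≤ y₀ ∧ rank E n l ν B z y = 0 then v else V)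
      (if z ≤ y₀ ∧ rank E n l ν B z y ≤ t₀ then v else V) := by
  set val : ℕ → ℕ → ℝ≥0∞ := fun i y => if z ≤ y₀ ∧ rank E n l ν B z y ≤ i then v else V with hval
  have hvalV : ∀ i y, val i y ≤ V := fun i y => by
    simp only [hval]; split_ifs
    exacts [hvV, le_rfl]
  have lp := Spec.loop (E := E) (w := w) (S := S) (P := searchP ;; assign 23 (.v 23 - .lit 1))
    (r := 23) (m := t₀) (by norm_num) (ht₀N.trans hNw.le)
    (fun i y => σ.upto i (q + countdownQueries (2 ^ ν) t₀ i)
      (t + countdownTime S (l + b + 1) (2 ^ ν) t₀ i) y)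
    (fun _ => Result E n l ν B z y₀) val (fun i hi y hy => by
      have hyl := hy.le
      have er : t₀ - i = t₀ - (i + 1) + 1 := by omega
      have er2 : t₀ - (t₀ - (i + 1)) = i + 1 := by omega
      have e1 : countdownTime S (l + b + 1) (2 ^ ν) t₀ i =
          countdownTime S (l + b + 1) (2 ^ ν) t₀ (i + 1) +
            (searchTime S (l + b + 1) (2 ^ ν) (i + 1) + 10) := by
        rw [countdownTime, er, Finset.sum_range_succ, er2]; rfl
      have e2 : countdownQueries (2 ^ ν) t₀ i = countdownQueries (2 ^ ν) t₀ (i + 1) +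
          searchQueries (2 ^ ν) (i + 1) := by
        rw [countdownQueries, er, Finset.sum_range_succ, er2]; rfl
      refine ⟨by simp [View.upto, Nat.mod_eq_of_lt (show i + 1 < 2 ^ w by omega)], ?_⟩
      have main : Spec E searchP (σ.upto (i + 1) (q + countdownQueries (2 ^ ν) t₀ (i + 1))
          (t + countdownTime S (l + b + 1) (2 ^ ν) t₀ (i + 1) + 1) y)
          (σ.upto (i + 1) (q + countdownQueries (2 ^ ν) t₀ (i + 1) + searchQueries (2 ^ ν) (i + 1))
          (t + countdownTime S (l + b + 1) (2 ^ ν) t₀ (i + 1) + 1 +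
            searchTime S (l + b + 1) (2 ^ ν) (i + 1)))
          (Result E n l ν B z y) (val i) (val (i + 1) y) := by
        by_cases h1 : z ≤ y₀ ∧ rank E n l ν B z y ≤ i + 1
        · have e : val (i + 1) y = v := by simp only [hval]; rw [if_pos h1]
          rw [e]
          by_cases h2 : rank E n l ν B z y = i + 1
          · refine spec_search_exact R (by omega) (by omega) (hy.ge h1.1) h2 fun u hu => ?_
            have := rank_key_lt hu
            simp only [hval]
            rw [if_pos ⟨h1.1, by omega⟩]
          · refine spec_search R (by omega) (by omega) (by omega) fun y' hy' => ?_
            have := rank_mono (E := E) (n := n) (l := l) (ν := ν) (B := B) (z := z) hy'.le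
            simp only [hval]
            rw [if_pos ⟨h1.1, by omega⟩]
        · have e : val (i + 1) y = V := by simp only [hval]; rw [if_neg h1]
          rw [e]
          exact spec_search R (by omega) (by omega) (by omega) fun y' _ => hvalV i y'
      refine Spec.seq main fun y' hy' => ?_
      refine Det.spec y' (Det.le (det_set i 5 ?_ ?_) ⟨?_, ?_, ?_, .inr ?_, ?_, ?_⟩) (hy.trans hy')
        le_rfl
      all_goals first
        | (simp [View.upto]; done)
        | (simp only [View.upto, View.time_tick, View.time_ask, View.time_set, View.queries_tick,
            View.queries_set, View.queries_ask, e1, e2]; omega)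
        | (intro r _
           simp only [View.upto, View.var_tick, View.var_set, View.var_act, View.var_ask]
           split_ifs <;> simp_all)) (fun y _ => by simp [View.upto]) y hy
  refine fun f hf => ((lp.ge (υ := σ.upto t₀ q t y) ⟨fun _ _ => rfl, rfl, rfl, .inr rfl, ?_, ?_⟩) f fun y' hy' =>
    ?_).mono (fun _ => le_rfl) le_rfl
  · simp [View.upto, countdownTime]
  · simp [View.upto, countdownQueries]
  · refine le_trans (le_of_eq ?_) ((hf y' hy').trans ?_)
    · simp [View.upto, View.tick, View.ask, View.set, add_assoc]
    · simp only [hval, Nat.le_zero]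
      exact le_rfl

open Ex in
/-- Find the smallest key of the block that is at least as large as register `21` says. -/
def bestP : Program :=
  assign 22 (v 12) ;; assign 23 (v 6) ;; halvingP ;; assign 23 (v 10) ;; countdownP

def bestTime (S m N r t₀ : ℕ) : ℕ :=
  halvingTime S m N r (halvings N t₀) + 30 + countdownTime S m N t₀ 0 + 1

def bestQueries (N r t₀ : ℕ) : ℕ :=
  halvingQueries N r (halvings N t₀) + countdownQueries N t₀ 0

/-- Only the halving phase can fail. Both phases have a fixed schedule, so the cost does not depend
on the outcomes. -/
theorem spec_bestP (R : Search E l b ν n B z σ) {r t₀ y₀ : ℕ} (hr : r < 2 ^ w)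
    (h10 : σ.var 10 = t₀) (h11 : σ.var 11 = r) (h12 : σ.var 12 = y₀) (h18 : σ.var 18 = 0)
    (h19 : σ.var 19 = 0) (ht₀ : 1 ≤ t₀) (ht₀N : t₀ ≤ 2 ^ ν) (hNw : 2 ^ ν < 2 ^ w)
    (hy₀ : y₀ < 2 ^ (l + b + 1)) {V v : ℝ≥0∞} (hvV : v ≤ V) :
    Spec E bestP σ (σ.upto 0 (bestQueries (2 ^ ν) r t₀) (bestTime S (l + b + 1) (2 ^ ν) r t₀))
      (Result E n l ν B z y₀) (fun y => if z ≤ y₀ ∧ rank E n l ν B z y = 0 then v else V)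
      (if z ≤ y₀ then min V (v + halvings (2 ^ ν) t₀ * ((3 / 4) ^ r * V)) else V) := by
  refine Det.seq_spec (det_set y₀ 2 ?_ ?_) <| Det.seq_spec (det_set (2 ^ ν) 2 ?_ ?_) <|
    Spec.seq ((spec_halvingP (q := 0) (t := 4) R hr h10 h11 h18 h19 ht₀ (ht₀N.trans_lt hNw) hNw hy₀
      hvV).ge ⟨?_, rfl, rfl, .inr rfl, ?_, ?_⟩) fun y hy =>
    Det.seq_spec (det_set t₀ 2 ?_ ?_) <| Spec.ge (fun f hf => (spec_countdownP
      (q := halvingQueries (2 ^ ν) r (halvings (2 ^ ν) t₀))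
      (t := halvingTime S (l + b + 1) (2 ^ ν) r (halvings (2 ^ ν) t₀) + 30) (σ := σ) R ht₀N hNw hy₀ hy
      hvV) f fun y' hy' => ?_) ⟨?_, rfl, rfl, .inr rfl, ?_, ?_⟩
  all_goals first
    | (simp [View.upto, h10, h12, R.v6]; done)
    | (intro r _
       simp only [View.upto, View.var_tick, View.var_set, View.var_act, View.var_ask]
       split_ifs <;> simp_all; done)
    | skip
  · exact hf y' hy'
  · simp only [View.upto, View.time_tick, View.time_ask, View.time_set]; omega

end

end HybridRAM

/-! ### The tournament tree in classical memory -/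

namespace HybridRAM

set_option linter.unusedSimpArgs false

noncomputable section

open scoped ENNReal

variable {w S : ℕ} {E : Env}

/-! ## The tournament tree -/

/-- The memory after the path from the leaf `v` up to its ancestor of order `i` was updated. -/
def climb (M v y : ℕ) (μ : ℕ → ℕ) : ℕ → ℕ → ℕ
  | 0 => Function.update μ (M + v) y
  | i + 1 => Function.update (climb M v y μ i) (M + v / 2 ^ (i + 1))
      (min (climb M v y μ i (M + 2 * (v / 2 ^ (i + 1)))) (climb M v y μ i (M + 2 * (v / 2 ^ (i + 1)) + 1)))

theorem climb_of_lt {M v y a : ℕ} {μ : ℕ → ℕ} (ha : a < M) (i : ℕ) : climb M v y μ i a = μ a := by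
  induction i with
  | zero => simp only [climb]; rw [Function.update_of_ne (by omega)]
  | succ i ih =>
    simp only [climb]
    rw [Function.update_of_ne (by generalize v / 2 ^ (i + 1) = q; omega), ih]

theorem climb_le {M v y c : ℕ} {μ : ℕ → ℕ} (hμ : ∀ a, μ a ≤ c) (hy : y ≤ c) (i a : ℕ) :
    climb M v y μ i a ≤ c := by
  induction i generalizing a with
  | zero => simp only [climb, Function.update_apply]; split_ifs; exacts [hy, hμ a]
  | succ i ih =>
    simp only [climb, Function.update_apply]
    split_ifs
    exacts [(min_le_left _ _).trans (ih _), ih a]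

/-- The inner nodes of the tree hold the minima of their children. -/
def IsTree (M K : ℕ) (μ : ℕ → ℕ) : Prop :=
  ∀ u, 1 ≤ u → u < K → μ (M + u) = min (μ (M + 2 * u)) (μ (M + 2 * u + 1))

theorem div_two_pow_succ (v i : ℕ) : v / 2 ^ i / 2 = v / 2 ^ (i + 1) := by
  rw [Nat.div_div_eq_div_mul, pow_succ]

/-- The update of a path can leave only those ancestors of the leaf inconsistent that were not
reached yet; they are exempted by the last two conditions on `u`. -/
theorem climb_consistent {M v y κ : ℕ} {μ : ℕ → ℕ} (h : IsTree M (2 ^ κ) μ)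
    (hv' : 2 ^ κ ≤ v) (i : ℕ) (hi : i ≤ κ) : ∀ u, 1 ≤ u → u < 2 ^ κ → u ≠ v / 2 ^ (i + 1) →
      (∀ j, i < j → u ≠ v / 2 ^ (j + 1)) → climb M v y μ i (M + u) =
        min (climb M v y μ i (M + 2 * u)) (climb M v y μ i (M + 2 * u + 1)) := by
  induction i with
  | zero =>
    intro u h1 h2 h3 _
    have h3' : u ≠ v / 2 := by simpa using h3
    simp only [climb]
    rw [Function.update_of_ne (by omega), Function.update_of_ne (by omega),
      Function.update_of_ne (by omega)]
    exact h u h1 h2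
  | succ i ih =>
    intro u h1 h2 h3 h4
    have hd := div_two_pow_succ v (i + 1)
    have hpos : 0 < v / 2 ^ (i + 1) := by
      refine Nat.div_pos (le_trans ?_ hv') (Nat.two_pow_pos _)
      exact Nat.pow_le_pow_right (by norm_num) hi
    simp only [climb]
    rw [Function.update_of_ne (a := M + 2 * u) (by omega),
      Function.update_of_ne (a := M + 2 * u + 1) (by omega)]
    by_cases hu : u = v / 2 ^ (i + 1)
    · subst hu
      rw [Function.update_self]
    · rw [Function.update_of_ne (by omega)]
      refine ih (by omega) u h1 h2 hu fun j hj => ?_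
      rcases Nat.eq_or_lt_of_le hj with rfl | hj
      · exact h3
      · exact h4 j hj

/-- After `κ` levels the root is reached. The remaining "ancestors" are 0, which is no node, so no
exemption is left. -/
theorem isTree_climb {M v y κ : ℕ} {μ : ℕ → ℕ} (h : IsTree M (2 ^ κ) μ) (hv : v < 2 * 2 ^ κ)
    (hv' : 2 ^ κ ≤ v) : IsTree M (2 ^ κ) (climb M v y μ κ) := by
  intro u h1 h2
  have hz : ∀ j, κ ≤ j → v / 2 ^ (j + 1) = 0 := fun j hj => by
    refine Nat.div_eq_of_lt (hv.trans_le ?_)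
    rw [pow_succ, mul_comm]
    have := Nat.pow_le_pow_right (n := 2) (by norm_num) hj
    omega
  refine climb_consistent h hv' κ le_rfl u h1 h2 ?_ fun j hj => ?_
  · rw [hz κ le_rfl]; omega
  · rw [hz j hj.le]; omega

theorem climb_leaf {M v y κ B : ℕ} {μ : ℕ → ℕ} (hv : v < 2 * 2 ^ κ) (i : ℕ) :
    climb M v y μ i (M + (2 ^ κ + B)) = if 2 ^ κ + B = v then y else μ (M + (2 ^ κ + B)) := by
  induction i with
  | zero =>
    simp only [climb, Function.update_apply]
    split_ifs <;> first | rfl | omega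
  | succ i ih =>
    simp only [climb]
    rw [Function.update_of_ne, ih]
    have h1 : v / 2 ^ (i + 1) ≤ v / 2 ^ 1 :=
      Nat.div_le_div_left (Nat.pow_le_pow_right (by norm_num) (by omega)) (by norm_num)
    omega

theorem root_le {M κ B : ℕ} {μ : ℕ → ℕ} (h : IsTree M (2 ^ κ) μ) (hB : B < 2 ^ κ) :
    μ (M + 1) ≤ μ (M + (2 ^ κ + B)) := by
  have key : ∀ i ≤ κ, μ (M + (2 ^ κ + B) / 2 ^ i) ≤ μ (M + (2 ^ κ + B)) := by
    intro i
    induction i with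
    | zero => intro _; simp
    | succ i ih =>
      intro hi
      refine le_trans ?_ (ih (by omega))
      have hd := div_two_pow_succ (2 ^ κ + B) i
      set u := (2 ^ κ + B) / 2 ^ i
      have h2 : 2 ^ (i + 1) ≤ 2 ^ κ := Nat.pow_le_pow_right (by norm_num) hi
      have hpos : 0 < (2 ^ κ + B) / 2 ^ (i + 1) := Nat.div_pos (by omega) (Nat.two_pow_pos _)
      have hlt : (2 ^ κ + B) / 2 ^ (i + 1) < 2 ^ κ := by
        have : (2 ^ κ + B) / 2 ^ (i + 1) ≤ (2 ^ κ + B) / 2 ^ 1 :=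
          Nat.div_le_div_left (Nat.pow_le_pow_right (by norm_num) (by omega)) (by norm_num)
        omega
      rw [h _ hpos hlt]
      rcases Nat.mod_two_eq_zero_or_one u with hm | hm
      · refine (min_le_left _ _).trans (le_of_eq ?_)
        congr 1; omega
      · refine (min_le_right _ _).trans (le_of_eq ?_)
        congr 1; omega
  have := key κ le_rfl
  rwa [show (2 ^ κ + B) / 2 ^ κ = 1 by
    rw [Nat.add_div_left _ (Nat.two_pow_pos _), Nat.div_eq_of_lt hB]] at this

theorem exists_root_eq {M κ : ℕ} {μ : ℕ → ℕ} (h : IsTree M (2 ^ κ) μ) :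
    ∃ B < 2 ^ κ, μ (M + 1) = μ (M + (2 ^ κ + B)) := by
  -- Children have larger numbers than their parent, so descending from the root is an induction on
  -- the distance of `u` from the end of the array.
  have key : ∀ d u, 1 ≤ u → u < 2 * 2 ^ κ → 2 * 2 ^ κ - u ≤ d →
      ∃ B < 2 ^ κ, μ (M + u) = μ (M + (2 ^ κ + B)) := by
    intro d
    induction d with
    | zero => intro u _ _ _; omega
    | succ d ih =>
      intro u h1 h2 h3
      by_cases hu : u < 2 ^ κ
      · obtain ⟨B, hB, e⟩ := ih (2 * u) (by omega) (by omega) (by omega)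
        obtain ⟨B', hB', e'⟩ := ih (2 * u + 1) (by omega) (by omega) (by omega)
        rw [h u h1 hu]
        rcases min_choice (μ (M + 2 * u)) (μ (M + 2 * u + 1)) with hm | hm
        · exact ⟨B, hB, by rw [hm, e]⟩
        · exact ⟨B', hB', by rw [hm, ← e', add_assoc]⟩
      · exact ⟨u - 2 ^ κ, by omega, by congr 2; omega⟩
  exact key _ 1 le_rfl (by have := Nat.two_pow_pos κ; omega) le_rfl

/-- Replace the memory. -/
def View.withMem (σ : View w S) (μ : ℕ → ℕ) : View w S := { σ with mem := μ }

@[simp] theorem View.var_withMem (σ : View w S) (μ : ℕ → ℕ) : (σ.withMem μ).var = σ.var := rfl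
@[simp] theorem View.mem_withMem (σ : View w S) (μ : ℕ → ℕ) : (σ.withMem μ).mem = μ := rfl
@[simp] theorem View.psi_withMem (σ : View w S) (μ : ℕ → ℕ) : (σ.withMem μ).psi = σ.psi := rfl
@[simp] theorem View.out_withMem (σ : View w S) (μ : ℕ → ℕ) : (σ.withMem μ).out = σ.out := rfl
@[simp] theorem View.time_withMem (σ : View w S) (μ : ℕ → ℕ) : (σ.withMem μ).time = σ.time := rfl
@[simp] theorem View.queries_withMem (σ : View w S) (μ : ℕ → ℕ) :
    (σ.withMem μ).queries = σ.queries := rfl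

open Ex in
/-- Go to the parent of the node in register `25`, and update it. -/
def nodeP : Program :=
  assign 25 (v 25 / lit 2) ;; assign 30 (v 9 + lit 2 * v 25) ;; .instr (.load 26 30) ;;
  assign 30 (v 30 + lit 1) ;; .instr (.load 27 30) ;;
  assign 26 (bin .lt (v 26) (v 27) * v 26 + (lit 1 - bin .lt (v 26) (v 27)) * v 27) ;;
  assign 30 (v 9 + v 25) ;; .instr (.store 30 26) ;; zero 26 ;; zero 27 ;; zero 30

theorem det_nodeP {σ : View w S} {M v : ℕ} (h9 : σ.var 9 = M) (h25 : σ.var 25 = v)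
    (hM : M + v + 1 < 2 ^ w) (hw2 : 2 < 2 ^ w) (hμ : ∀ a, σ.mem a < 2 ^ w)
    (h26 : σ.var 26 = 0) (h27 : σ.var 27 = 0) (h30 : σ.var 30 = 0) :
    Det E nodeP σ (((σ.set 25 (v / 2)).setMem (M + v / 2)
      (min (σ.mem (M + 2 * (v / 2))) (σ.mem (M + 2 * (v / 2) + 1)))).tick 60) := by
  have emin := ite_mul_min (σ.mem (M + 2 * (v / 2))) (σ.mem (M + 2 * (v / 2) + 1))
  have b1 : M + 2 * (v / 2) < 2 ^ w := by omega
  have b2 : M + 2 * (v / 2) + 1 < 2 ^ w := by omega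
  have b3 : M + v / 2 < 2 ^ w := by omega
  have b4 : v < 2 ^ w := by omega
  refine Det.le (Det.seq (det_set (v / 2) 5 ?_ ?_) <|
    Det.seq (det_set (M + 2 * (v / 2)) 8 ?_ ?_) <|
    Det.seq (det_load (by norm_num) (by norm_num) ?_) <|
    Det.seq (det_set (M + 2 * (v / 2) + 1) 5 ?_ ?_) <|
    Det.seq (det_load (by norm_num) (by norm_num) ?_) <|
    Det.seq (det_set (min (σ.mem (M + 2 * (v / 2))) (σ.mem (M + 2 * (v / 2) + 1))) 20 ?_ ?_) <|
    Det.seq (det_set (M + v / 2) 5 ?_ ?_) <|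
    Det.seq (det_store (by norm_num) (by norm_num) ?_) <| Det.seq (det_zero (by norm_num)) <|
    Det.seq (det_zero (by norm_num)) <| det_zero (by norm_num)) ⟨?_, ?_, ?_, .inr ?_, ?_, ?_⟩
  all_goals first
    | (simp only [Ex.ev_add, Ex.ev_mul, Ex.ev_mod, Ex.ev_sub, Ex.ev_lt, Ex.ev_v, Ex.ev_lit,
         View.var_tick, View.var_set, View.mem_tick, View.mem_set, reduceIte, Nat.reduceEqDiff]
       exact emin)
    | (simp only [View.time_tick, View.time_set, View.time_setMem]; omega)
    | (simp [h9, h25, b1, b2, b3, b4, hμ, hw2, ite_le_one]; done)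
    | (intro r _
       simp only [View.var_tick, View.var_set, View.var_setMem]
       split_ifs <;> simp_all)

open Ex in
/-- Store register `22` in the leaf with number in register `20` and update the tree. -/
def climbP : Program :=
  assign 25 (v 7 + v 20) ;; assign 30 (v 9 + v 25) ;; .instr (.store 30 22) ;; zero 30 ;;
  assign 29 (v 4) ;; .loop 29 (nodeP ;; assign 29 (v 29 - lit 1)) ;; zero 25

theorem det_climbP {σ : View w S} {M κ B y c : ℕ} (h4 : σ.var 4 = κ) (h7 : σ.var 7 = 2 ^ κ)
    (h9 : σ.var 9 = M) (h20 : σ.var 20 = B) (h22 : σ.var 22 = y) (hB : B < 2 ^ κ)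
    (hM : M + 2 * 2 ^ κ < 2 ^ w) (hμ : ∀ a, σ.mem a ≤ c) (hy : y ≤ c) (hc : c < 2 ^ w)
    (hz : ∀ r, 24 ≤ r → r < 40 → σ.var r = 0) :
    Det E climbP σ ((σ.withMem (climb M (2 ^ κ + B) y σ.mem κ)).tick (80 * κ + 30)) := by
  have hκ2 : κ < 2 ^ κ := Nat.lt_two_pow_self
  set v := 2 ^ κ + B with hv
  have h25 := hz 25 (by norm_num) (by norm_num)
  have h26 := hz 26 (by norm_num) (by norm_num)
  have h27 := hz 27 (by norm_num) (by norm_num)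
  have h29 := hz 29 (by norm_num) (by norm_num)
  have h30 := hz 30 (by norm_num) (by norm_num)
  have hle : ∀ i a, climb M v y σ.mem i a < 2 ^ w := fun i a => (climb_le hμ hy i a).trans_lt hc
  have lp := Det.loop (E := E) (P := nodeP ;; assign 29 (.v 29 - .lit 1))
    (r := 29) (m := κ) (by norm_num) (by omega)
    (fun i => (((σ.withMem (climb M v y σ.mem i)).set 25 (v / 2 ^ i)).set 29 (κ - i)).tick
      (20 + 80 * i))
    (fun i hi => by
      have hd := div_two_pow_succ v i
      have hvi : v / 2 ^ i ≤ v := Nat.div_le_self _ _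
      refine ⟨by simp [Nat.mod_eq_of_lt (show κ - i < 2 ^ w by omega)]; omega, ?_⟩
      refine Det.le (Det.seq (det_nodeP (M := M) (v := v / 2 ^ i) ?_ ?_ (by omega) (by omega) ?_ ?_ ?_ ?_) <|
        det_set (κ - (i + 1)) 5 ?_ ?_) ⟨?_, ?_, ?_, .inr ?_, ?_, ?_⟩
      all_goals first
        | (simp only [View.time_tick, View.time_set, View.time_setMem, View.time_withMem]; omega)
        | (simp [h9, hd, h26, h27, h30, climb]; done)
        | (simp; omega)
        | exact hle i
        | (intro r _
           simp only [View.var_tick, View.var_set, View.var_withMem, View.var_setMem]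
           split_ifs <;> simp_all)) (by simp)
  refine Det.le (Det.seq (det_set v 5 ?_ ?_) <| Det.seq (det_set (M + v) 5 ?_ ?_) <|
    Det.seq (det_store (by norm_num) (by norm_num) ?_) <| Det.seq (det_zero (by norm_num)) <|
    Det.seq (det_set κ 2 ?_ ?_) <| Det.seq (lp.ge ⟨?_, ?_, ?_, .inr ?_, ?_, ?_⟩) <|
    det_zero (by norm_num)) ⟨?_, ?_, ?_, .inr ?_, ?_, ?_⟩
  all_goals first
    | (simp only [View.time_tick, View.time_set, View.time_setMem, View.time_withMem]; omega)
    | (simp [h4, h7, h9, h20, h22, climb]; done)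
    | (simp [h4, h7, h9, h20, h22, climb]; omega)
    | (intro r _
       simp only [View.var_tick, View.var_set, View.var_withMem, View.var_setMem]
       split_ifs <;> simp_all)

end

end HybridRAM

/-! ### Invariants of the tree and of the output -/

namespace HybridRAM

set_option linter.unusedSimpArgs false

noncomputable section

open scoped ENNReal

variable {w S : ℕ} {E : Env}

/-! ## The main loops -/

/-- What holds throughout the main loops. -/
structure Setup (E : Env) (l b κ ν n k t₀ r : ℕ) (σ : View w S) : Prop where
  layout : Layout E S l b ν
  hS : S < 2 ^ w
  big : 2 ^ (l + b + 4) ≤ 2 ^ w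
  n_le : n ≤ 2 ^ l
  hk : k < 2 ^ w
  hr : r < 2 ^ w
  ht₀ : 1 ≤ t₀
  ht₀N : t₀ ≤ 2 ^ ν
  hκ : κ + ν = l
  dummy : ∀ i, n ≤ i → E.table i = 0
  v0 : σ.var 0 = n
  v1 : σ.var 1 = k
  v3 : σ.var 3 = l
  v4 : σ.var 4 = κ
  v5 : σ.var 5 = ν
  v6 : σ.var 6 = 2 ^ ν
  v7 : σ.var 7 = 2 ^ κ
  v8 : σ.var 8 = l + b + 1
  v9 : σ.var 9 = 2 ^ l
  v10 : σ.var 10 = t₀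
  v11 : σ.var 11 = r
  v12 : σ.var 12 = 2 ^ (l + b)
  v13 : σ.var 13 = l + b + 1 + 1
  zero : ∀ r, 18 ≤ r → r < 40 → σ.var r = 0
  psi : σ.psi = psiInit
  out : σ.out = none

variable {σ : View w S} {l b κ ν n k t₀ r B z : ℕ}

theorem Setup.set (R : Setup E l b κ ν n k t₀ r σ) {i : ℕ} (hi : 14 ≤ i) (hi' : i < 18) (x : ℕ) :
    Setup E l b κ ν n k t₀ r (σ.set i x) := by
  have h : ∀ r', (σ.set i x).var r' = if r' = i then x else σ.var r' := fun r' => by simp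
  refine ⟨R.layout, R.hS, R.big, R.n_le, R.hk, R.hr, R.ht₀, R.ht₀N, R.hκ, R.dummy, ?_, ?_, ?_, ?_, ?_,
    ?_, ?_, ?_, ?_, ?_, ?_, ?_, ?_, fun r' h1 h2 => ?_, R.psi, R.out⟩ <;> rw [h, if_neg (by omega)]
  exacts [R.v0, R.v1, R.v3, R.v4, R.v5, R.v6, R.v7, R.v8, R.v9, R.v10, R.v11, R.v12, R.v13,
    R.zero r' h1 h2]

theorem Setup.withMem (R : Setup E l b κ ν n k t₀ r σ) (μ : ℕ → ℕ) :
    Setup E l b κ ν n k t₀ r (σ.withMem μ) := { R with }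

theorem Setup.tick (R : Setup E l b κ ν n k t₀ r σ) (t : ℕ) :
    Setup E l b κ ν n k t₀ r (σ.tick t) := { R with }

theorem Setup.ask (R : Setup E l b κ ν n k t₀ r σ) (t : ℕ) :
    Setup E l b κ ν n k t₀ r (σ.ask t) := { R with }

/-- The lower threshold can be one more than the sentinel `2 ^ (l + b)`, namely when the root is the
sentinel. It still has at most `l + b + 1` digits, so the search is legal even after an error. -/
theorem Setup.search (R : Setup E l b κ ν n k t₀ r σ) (hB : B < 2 ^ κ) (hz : z ≤ 2 ^ (l + b) + 1) :
    Search E l b ν n B z ((σ.set 20 B).set 21 z) where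
  layout := R.layout
  hS := R.hS
  big := R.big
  n_le := R.n_le
  v0 := by simp [R.v0]
  v3 := by simp [R.v3]
  v5 := by simp [R.v5]
  v6 := by simp [R.v6]
  v8 := by simp [R.v8]
  v9 := by simp [R.v9]
  v13 := by simp [R.v13]
  zero := fun r h1 h2 => by
    simp only [View.var_set]
    rw [if_neg (by omega), if_neg (by omega), R.zero r (by omega) h2]
  hB := by
    rw [← R.hκ, pow_add, mul_comm (2 ^ κ)]
    exact Nat.mul_le_mul_left _ hB
  hz := by
    have : 2 ^ 1 ≤ 2 ^ (l + b) := Nat.pow_le_pow_right (by norm_num) (by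
      have := R.layout.one_le; have := R.layout.le; omega)
    rw [pow_succ]
    omega
  dummy := R.dummy
  v20 := by simp
  v21 := by simp
  psi := R.psi
  out := R.out

/-- Recompute the leaf of the block in register `20`. -/
def refreshP : Program := bestP ;; climbP ;; zero 20 ;; zero 21 ;; zero 22

def refreshTime (S m N r t₀ κ : ℕ) : ℕ := bestTime S m N r t₀ + (80 * κ + 30) + 3

/-- Here `v` is the value of a right leaf and `V` that of a wrong one. For a threshold beyond the
sentinel no right leaf is promised, but the resource bounds remain. -/
theorem spec_refreshP (R : Setup E l b κ ν n k t₀ r σ) (hB : B < 2 ^ κ)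
    (hz : z ≤ 2 ^ (l + b) + 1) (hμ : ∀ a, σ.mem a ≤ 2 ^ (l + b)) {V v : ℝ≥0∞} (hvV : v ≤ V) :
    Spec E refreshP ((σ.set 20 B).set 21 z)
      (fun y => ((σ.withMem (climb (2 ^ l) (2 ^ κ + B) y σ.mem κ)).ask (bestQueries (2 ^ ν) r t₀)).tick
        (refreshTime S (l + b + 1) (2 ^ ν) r t₀ κ))
      (Result E n l ν B z (2 ^ (l + b)))
      (fun y => if z ≤ 2 ^ (l + b) ∧ rank E n l ν B z y = 0 then v else V)
      (if z ≤ 2 ^ (l + b) then min V (v + halvings (2 ^ ν) t₀ * ((3 / 4) ^ r * V)) else V) := by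
  have hz18 := R.zero 18 (by norm_num) (by norm_num)
  have hz19 := R.zero 19 (by norm_num) (by norm_num)
  have hz20 := R.zero 20 (by norm_num) (by norm_num)
  have hz21 := R.zero 21 (by norm_num) (by norm_num)
  have hz22 := R.zero 22 (by norm_num) (by norm_num)
  have hz23 := R.zero 23 (by norm_num) (by norm_num)
  have hle := R.layout.le
  have hκ := R.hκ
  have p1 : 2 ^ ν ≤ 2 ^ (l + b) := Nat.pow_le_pow_right (by norm_num) (by omega)
  have p2 : 2 ^ κ ≤ 2 ^ (l + b) := Nat.pow_le_pow_right (by norm_num) (by omega)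
  have p3 : 2 ^ l ≤ 2 ^ (l + b) := Nat.pow_le_pow_right (by norm_num) (by omega)
  have p4 : 2 ^ (l + b + 4) = 16 * 2 ^ (l + b) := by ring
  have p5 : 2 ^ (l + b + 1) = 2 * 2 ^ (l + b) := by ring
  have hbig := R.big
  have hpos := Nat.two_pow_pos (l + b)
  refine Spec.seq (spec_bestP (R.search hB hz) (t₀ := t₀) R.hr ?_ ?_ ?_ ?_ ?_ R.ht₀ R.ht₀N (by omega)
    (by omega) hvV) fun y hy => ?_
  rotate_left 5
  · refine Det.spec y (Det.le (Det.seq (det_climbP (M := 2 ^ l) (κ := κ) (B := B) (y := y)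
      (c := 2 ^ (l + b)) ?_ ?_ ?_ ?_ ?_ hB (by omega) ?_ hy.le (by omega) ?_) <|
      Det.seq (det_zero (by norm_num)) <| Det.seq (det_zero (by norm_num)) <|
      det_zero (by norm_num)) ⟨?_, ?_, ?_, .inr ?_, ?_, ?_⟩) hy le_rfl
    all_goals first
      | (simp [View.upto, R.v4, R.v7, R.v9]; done)
      | exact hμ
      | (simp [View.upto, refreshTime, add_assoc]; done)
      | (intro r h1 h2
         simp only [View.upto, View.var_tick, View.var_ask, View.var_set]
         rw [if_neg (by omega), if_neg (by omega), if_neg (by omega), if_neg (by omega),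
           R.zero r (by omega) h2])
      | (intro r _
         simp only [View.upto, View.var_tick, View.var_set, View.var_withMem, View.var_ask]
         split_ifs <;> simp_all)
  all_goals simp [R.v10, R.v11, R.v12, hz18, hz19]

/-- `y` is the smallest key in `[z, ∞)` in the block, or the sentinel if there is none. -/
def IsBest (E : Env) (n l b ν z B y : ℕ) : Prop :=
  Result E n l ν B z (2 ^ (l + b)) y ∧ rank E n l ν B z y = 0

theorem IsBest.le_key {y i : ℕ} (h : IsBest E n l b ν z (i / 2 ^ ν) y) (hi : i < n)
    (hz : z ≤ E.key l i) : y ≤ E.key l i := by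
  by_contra hlt
  have h0 := Finset.card_eq_zero.1 h.2
  have : i % 2 ^ ν ∈ marked E n l ν (i / 2 ^ ν) z y := by
    rw [mem_marked, Nat.div_add_mod]
    exact ⟨Nat.mod_lt _ (Nat.two_pow_pos _), hz, by omega, hi⟩
  rw [h0] at this
  exact absurd this (Finset.notMem_empty _)

/-- Raising the threshold removes keys only; the old minimum survives unless it is among those
removed. -/
theorem IsBest.mono {y z' : ℕ} (h : IsBest E n l b ν z B y) (hz : z ≤ z')
    (hy : y = 2 ^ (l + b) ∨ z' ≤ y) : IsBest E n l b ν z' B y := by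
  have hsub : ∀ y, marked E n l ν B z' y ⊆ marked E n l ν B z y := fun y u => by
    simp only [mem_marked]; omega
  refine ⟨?_, ?_⟩
  · rcases h.1 with rfl | ⟨u, hu, rfl⟩
    · exact .inl rfl
    · rcases hy with hy | hy
      · exact .inl hy
      · refine .inr ⟨u, ?_, rfl⟩
        rw [mem_marked] at *
        omega
  · exact Nat.le_zero.1 (h.2 ▸ Finset.card_le_card (hsub y))

/-- The cells `0, …, j - 1` hold the indices of the keys below `z`, in increasing order of the
keys. -/
structure Listed (E : Env) (n l z j : ℕ) (μ : ℕ → ℕ) : Prop where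
  lt : ∀ i < j, μ i < n
  mono : ∀ i i', i < i' → i' < j → E.key l (μ i) < E.key l (μ i')
  below : ∀ i < j, E.key l (μ i) < z
  all : ∀ i < n, E.key l i < z → ∃ i' < j, μ i' = i

/-- All leaves and all output cells are right after `j` outputs. -/
def Good (E : Env) (n l b κ ν j : ℕ) (μ : ℕ → ℕ) : Prop :=
  ∃ z, Listed E n l z j μ ∧ ∀ B < 2 ^ κ, IsBest E n l b ν z B (μ (2 ^ l + (2 ^ κ + B)))

/-- Pigeonhole: `j < n` output cells cannot list all `n` indices. -/
theorem Listed.exists_ge {j : ℕ} {μ : ℕ → ℕ} (h : Listed E n l z j μ) (hj : j < n) :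
    ∃ i < n, z ≤ E.key l i := by
  by_contra! hne
  have hsub : Finset.range n ⊆ (Finset.range j).image μ := fun i hi => by
    obtain ⟨i', h1, h2⟩ := h.all i (Finset.mem_range.1 hi) (hne i (Finset.mem_range.1 hi))
    exact Finset.mem_image.2 ⟨i', Finset.mem_range.2 h1, h2⟩
  have := (Finset.card_le_card hsub).trans Finset.card_image_le
  simp at this
  omega

/-- The root of the tree is the next key, and after its index was output, only the leaf of its
block is affected. -/
theorem Good.next {j : ℕ} {μ : ℕ → ℕ} (L : Layout E S l b ν) (hκ : κ + ν = l) (hn : n ≤ 2 ^ l)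
    (h : Good E n l b κ ν j μ) (hT : IsTree (2 ^ l) (2 ^ κ) μ) (hj : j < n) :
    μ (2 ^ l + 1) < 2 ^ (l + b) ∧ ∀ y, IsBest E n l b ν (μ (2 ^ l + 1) + 1)
      (μ (2 ^ l + 1) % 2 ^ l / 2 ^ ν) y → Good E n l b κ ν (j + 1)
        (climb (2 ^ l) (2 ^ κ + μ (2 ^ l + 1) % 2 ^ l / 2 ^ ν) y
          (Function.update μ j (μ (2 ^ l + 1) % 2 ^ l)) κ) := by
  obtain ⟨z, hL, hB⟩ := h
  obtain ⟨i₁, hi₁, hz₁⟩ := hL.exists_ge hj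
  have hblock : ∀ i < n, i / 2 ^ ν < 2 ^ κ := fun i hi => by
    rw [Nat.div_lt_iff_lt_mul (Nat.two_pow_pos _), ← pow_add, hκ]; omega
  have hmin : ∀ i < n, z ≤ E.key l i → μ (2 ^ l + 1) ≤ E.key l i := fun i hi hz =>
    (root_le hT (hblock i hi)).trans ((hB _ (hblock i hi)).le_key hi hz)
  have hkey₁ : E.key l i₁ < 2 ^ (l + b) := key_lt L (by omega)
  have hlt : μ (2 ^ l + 1) < 2 ^ (l + b) := (hmin i₁ hi₁ hz₁).trans_lt hkey₁
  refine ⟨hlt, fun y hy => ?_⟩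
  -- The root equals some leaf. It is below the sentinel, because an unlisted key exists, so it is a
  -- genuine key of that block.
  obtain ⟨B', hB', hroot⟩ := exists_root_eq hT
  set ρ := μ (2 ^ l + 1) with hρ
  obtain ⟨u, hu, hk⟩ : ∃ u ∈ marked E n l ν B' z (2 ^ (l + b)), ρ = E.key l (2 ^ ν * B' + u) := by
    rcases (hB B' hB').1 with h | ⟨u, hu, h⟩
    · omega
    · exact ⟨u, hu, hroot.trans h⟩
  rw [mem_marked] at hu
  set i := 2 ^ ν * B' + u with hi
  have hil : i < 2 ^ l := by omega
  have hmod : ρ % 2 ^ l = i := by rw [hk, key_mod hil]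
  have hdiv : i / 2 ^ ν = B' := by
    rw [hi, Nat.mul_add_div (Nat.two_pow_pos _), Nat.div_eq_of_lt hu.1, add_zero]
  rw [hmod, hdiv] at hy ⊢
  have hjl : j < 2 ^ l := by omega
  set μ' := climb (2 ^ l) (2 ^ κ + B') y (Function.update μ j i) κ with hμ'
  have e1 : ∀ a < 2 ^ l, μ' a = if a = j then i else μ a := fun a ha => by
    rw [hμ', climb_of_lt ha, Function.update_apply]
  have e2 : ∀ B, μ' (2 ^ l + (2 ^ κ + B)) = if B = B' then y else μ (2 ^ l + (2 ^ κ + B)) := fun B => by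
    rw [hμ', climb_leaf (by omega), Function.update_of_ne (by omega)]
    simp
  refine ⟨ρ + 1, ⟨fun a ha => ?_, fun a a' h1 h2 => ?_, fun a ha => ?_, fun a ha h1 => ?_⟩,
    fun B hB1 => ?_⟩
  · rw [e1 a (by omega)]
    split_ifs with h
    · exact hu.2.2.2
    · exact hL.lt a (by omega)
  · rw [e1 a (by omega), e1 a' (by omega), if_neg (by omega)]
    split_ifs with h
    · exact (hL.below a (by omega)).trans_le hu.2.1
    · exact hL.mono a a' h1 (by omega)
  · rw [e1 a (by omega)]
    split_ifs with h
    · omega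
    · have := hL.below a (by omega)
      omega
  · by_cases hz : E.key l a < z
    · obtain ⟨a', h2, h3⟩ := hL.all a ha hz
      refine ⟨a', by omega, ?_⟩
      rw [e1 a' (by omega), if_neg (by omega), h3]
    -- A key that is not below `z` is at least ρ; being below ρ + 1 it equals ρ, so the index is the
    -- one just output.
    · have := hmin a ha (by omega)
      refine ⟨j, by omega, ?_⟩
      rw [e1 j hjl, if_pos rfl]
      exact key_injective hil (by omega) (by rw [← hk]; omega)
  · rw [e2]
    split_ifs with h
    · rw [h]; exact hy
    · refine (hB B hB1).mono (by omega) ?_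
      rcases (hB B hB1).1 with h' | ⟨v, hv, h'⟩
      · exact .inl h'
      · right
        -- Keys determine indices, so the leaf of another block cannot equal ρ; it exceeds ρ and
        -- remains right for the new threshold.
        have h3 : ρ ≤ μ (2 ^ l + (2 ^ κ + B)) := root_le hT hB1
        rcases Nat.eq_or_lt_of_le h3 with h4 | h4
        · exfalso
          rw [mem_marked] at hv
          have h5 := key_injective (E := E) hil (show 2 ^ ν * B + v < 2 ^ l by omega)
            (by rw [← hk, h4, h'])
          apply h
          rw [← hdiv, h5, Nat.mul_add_div (Nat.two_pow_pos _), Nat.div_eq_of_lt hv.1, add_zero]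
        · exact h4

theorem isTree_update {M K j x : ℕ} {μ : ℕ → ℕ} (h : IsTree M K μ) (hj : j < M) :
    IsTree M K (Function.update μ j x) := fun u h1 h2 => by
  rw [Function.update_of_ne (by omega), Function.update_of_ne (by omega),
    Function.update_of_ne (by omega)]
  exact h u h1 h2

end

end HybridRAM

/-! ### The main loops and their failure probability -/

namespace HybridRAM

set_option linter.unusedSimpArgs false

noncomputable section

open scoped ENNReal

variable {w S : ℕ} {E : Env} {σ : View w S} {l b κ ν n k t₀ r : ℕ}

/-- The bounds for the memory that hold in every execution. -/
def Sound (l b κ : ℕ) (μ : ℕ → ℕ) : Prop := (∀ a, μ a ≤ 2 ^ (l + b)) ∧ IsTree (2 ^ l) (2 ^ κ) μ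

theorem Sound.climb {μ : ℕ → ℕ} (h : Sound l b κ μ) {B y : ℕ} (hB : B < 2 ^ κ)
    (hy : y ≤ 2 ^ (l + b)) : Sound l b κ (climb (2 ^ l) (2 ^ κ + B) y μ κ) :=
  ⟨climb_le h.1 hy κ, isTree_climb h.2 (by omega) (by omega)⟩

/-- The first leaves are right. -/
def Built (E : Env) (n l b κ ν j : ℕ) (μ : ℕ → ℕ) : Prop :=
  ∀ B < j, IsBest E n l b ν 0 B (μ (2 ^ l + (2 ^ κ + B)))

theorem Built.next {j y : ℕ} {μ : ℕ → ℕ} (h : Built E n l b κ ν j μ) (hj : j < 2 ^ κ)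
    (hy : IsBest E n l b ν 0 j y) :
    Built E n l b κ ν (j + 1) (climb (2 ^ l) (2 ^ κ + j) y μ κ) := fun B hB => by
  rw [climb_leaf (by omega)]
  split_ifs with h'
  · rwa [show B = j by omega]
  · exact h B (by omega)

theorem good_of_built {μ : ℕ → ℕ} (h : Built E n l b κ ν (2 ^ κ) μ) : Good E n l b κ ν 0 μ :=
  ⟨0, ⟨by omega, by omega, by omega, by omega⟩, h⟩

/-- The state in the main loops, when `j` of `m` rounds that take time `X` are over. -/
def View.round (σ : View w S) (m Q X j : ℕ) (μ : ℕ → ℕ) : View w S :=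
  ((((σ.withMem μ).set 15 j).set 17 (m - j)).ask (j * Q)).tick (j * X + 3)

open Ex in
def buildStepP : Program := 
  assign 20 (v 15) ;; refreshP ;; assign 15 (v 15 + lit 1) ;; assign 17 (v 17 - lit 1)

-- A union bound in the language of values: `u` bounds the failure probability after a right step, 1
-- bounds it after any error, and δ is what one block minimum may lose. After an error only `Sound`
-- is kept, which is all that the time and address bounds need.
open Classical in
theorem spec_buildStepP (R : Setup E l b κ ν n k t₀ r σ) {Q X j : ℕ} {μ : ℕ → ℕ}
    (hQ : bestQueries (2 ^ ν) r t₀ = Q) (hX : refreshTime S (l + b + 1) (2 ^ ν) r t₀ κ = X)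
    (hj : j < 2 ^ κ) (hμ : Sound l b κ μ) {δ u u' : ℝ≥0∞}
    (hδ : halvings (2 ^ ν) t₀ * (3 / 4) ^ r ≤ δ) (hu : u ≤ 1) (hu' : min 1 (u + δ) ≤ u') :
    Spec E buildStepP ((σ.round (2 ^ κ) Q (X + 20) j μ).tick 1)
      (σ.round (2 ^ κ) Q (X + 20) (j + 1)) (Sound l b κ)
      (fun μ => if Built E n l b κ ν (j + 1) μ then u else 1)
      (if Built E n l b κ ν j μ then u' else 1) := by
  subst hQ hX
  have hz20 := R.zero 20 (by norm_num) (by norm_num)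
  have hz21 := R.zero 21 (by norm_num) (by norm_num)
  have hκw : 2 ^ κ < 2 ^ w := by
    refine lt_of_lt_of_le (Nat.pow_lt_pow_right (by norm_num) ?_) R.big
    have := R.hκ
    omega
  have hjw : 2 ^ κ - j < 2 ^ w := by omega
  set Q := bestQueries (2 ^ ν) r t₀
  set X := refreshTime S (l + b + 1) (2 ^ ν) r t₀ κ
  have R' : Setup E l b κ ν n k t₀ r ((σ.round (2 ^ κ) Q (X + 20) j μ).tick 5) :=
    ((((((R.withMem μ).set (i := 15) (by norm_num) (by norm_num) j).set (i := 17) (by norm_num)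
      (by norm_num) (2 ^ κ - j)).ask (j * Q)).tick (j * (X + 20) + 3))).tick 5
  have sp := spec_refreshP (B := j) (z := 0) R' hj (Nat.zero_le _) hμ.1
    (v := if Built E n l b κ ν j μ then u else 1) (V := 1)
    (by split_ifs; exacts [hu, le_rfl])
  unfold buildStepP
  refine Det.seq_spec (det_set j 2 ?_ ?_) <| Spec.seq ((sp.mono (fun y hy => ⟨hy, le_rfl⟩)
    (v' := if Built E n l b κ ν j μ then u' else 1) ?_).ge ⟨?_, rfl, rfl, .inr rfl, ?_, ?_⟩) fun y hy =>
    Det.seq_spec (det_set (j + 1) 5 ?_ ?_) <|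
    Det.spec (climb (2 ^ l) (2 ^ κ + j) y μ κ) (Det.le (det_set (2 ^ κ - (j + 1)) 5 ?_ ?_)
      ⟨?_, rfl, rfl, .inr rfl, ?_, ?_⟩) (hμ.climb hj hy.le) ?_
  all_goals first
    | (simp [View.round, hz20, hz21]; omega)
    | (simp [View.round, hz20, hz21]; done)
    | (simp only [View.round, View.time_tick, View.time_ask, View.time_set, View.time_withMem,
        View.queries_tick, View.queries_set, View.queries_ask, View.queries_withMem,
        Nat.succ_mul]; omega)
    | (intro r _
       simp only [View.round, View.var_tick, View.var_set, View.var_withMem, View.var_ask]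
       split_ifs <;> simp_all; done)
    | skip
  · simp only [Nat.zero_le, if_true]
    split_ifs
    · refine le_trans ?_ hu'
      rw [mul_one]
      gcongr
    · exact min_le_left _ _
  · by_cases hbst : rank E n l ν j 0 y = 0
    · by_cases hbu : Built E n l b κ ν j μ
      · rw [if_pos (hbu.next hj ⟨hy, hbst⟩), if_pos ⟨Nat.zero_le _, hbst⟩, if_pos hbu]
      · rw [if_pos (show 0 ≤ 2 ^ (l + b) ∧ _ from ⟨Nat.zero_le _, hbst⟩), if_neg hbu]
        split_ifs
        exacts [hu, le_rfl]
    · rw [if_neg (show ¬ (0 ≤ 2 ^ (l + b) ∧ rank E n l ν j 0 y = 0) from fun h => hbst h.2)]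
      split_ifs
      exacts [hu, le_rfl]

open Ex in
/-- Compute all leaves. -/
def buildP : Program := assign 17 (v 7) ;; .loop 17 buildStepP ;; zero 15

open Classical in
theorem spec_buildP (R : Setup E l b κ ν n k t₀ r σ) (h15 : σ.var 15 = 0) (h17 : σ.var 17 = 0)
    (hσ : Sound l b κ σ.mem) {v : ℝ≥0∞} (hv : v ≤ 1) :
    Spec E buildP σ (fun μ => ((σ.withMem μ).ask (2 ^ κ * bestQueries (2 ^ ν) r t₀)).tick
      (2 ^ κ * (refreshTime S (l + b + 1) (2 ^ ν) r t₀ κ + 20) + 10)) (Sound l b κ)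
      (fun μ => if Built E n l b κ ν (2 ^ κ) μ then v else 1)
      (min 1 (v + 2 ^ κ * (halvings (2 ^ ν) t₀ * (3 / 4) ^ r))) := by
  set Q := bestQueries (2 ^ ν) r t₀ with hQ
  set X := refreshTime S (l + b + 1) (2 ^ ν) r t₀ κ with hX
  have hκw : 2 ^ κ < 2 ^ w := by
    refine lt_of_lt_of_le (Nat.pow_lt_pow_right (by norm_num) ?_) R.big
    have := R.hκ
    omega
  set δ : ℝ≥0∞ := halvings (2 ^ ν) t₀ * (3 / 4) ^ r with hδ
  have lp := Spec.loop (E := E) (w := w) (S := S) (P := buildStepP) (r := 17) (m := 2 ^ κ)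
    (by norm_num) hκw.le (fun i => σ.round (2 ^ κ) Q (X + 20) (2 ^ κ - i)) (fun _ => Sound l b κ)
    (fun i μ => if Built E n l b κ ν (2 ^ κ - i) μ then min 1 (v + i * δ) else 1)
    (fun i hi μ hμ => by
      have ej : 2 ^ κ - i = 2 ^ κ - (i + 1) + 1 := by omega
      have ei : 2 ^ κ - (2 ^ κ - (i + 1)) = i + 1 := by omega
      refine ⟨by simp [View.round, ei, Nat.mod_eq_of_lt (show i + 1 < 2 ^ w by omega)], ?_⟩
      simp only [ej]
      refine spec_buildStepP R hQ.symm hX.symm (by omega) hμ hδ.ge (min_le_left _ _) ?_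
      refine le_min (min_le_left _ _) ?_
      calc min 1 (min 1 (v + i * δ) + δ) ≤ (v + i * δ) + δ := by
            refine (min_le_right _ _).trans ?_
            gcongr
            exact min_le_right _ _
        _ = v + ((i + 1 : ℕ) : ℝ≥0∞) * δ := by push_cast; ring)
    (fun μ _ => by simp [View.round]) σ.mem hσ
  refine Det.seq_spec (det_set (2 ^ κ) 2 ?_ ?_) <| Spec.seq ((lp.mono (fun μ hμ => ⟨hμ, le_rfl⟩)
    (v' := min 1 (v + 2 ^ κ * δ)) ?_).ge ⟨?_, rfl, rfl, .inr rfl, ?_, ?_⟩) fun μ hμ =>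
    Det.spec μ (Det.le (det_zero (by norm_num)) ⟨?_, rfl, rfl, .inr rfl, ?_, ?_⟩) hμ ?_
  all_goals first
    | (simp [View.round, R.v7]; done)
    | (simp only [View.round, View.time_tick, View.time_ask, View.time_set, View.time_withMem,
        View.queries_tick, View.queries_set, View.queries_ask, View.queries_withMem,
        Nat.sub_zero]; omega)
    | (intro r _
       simp only [View.round, View.var_tick, View.var_set, View.var_withMem, View.var_ask]
       split_ifs <;> simp_all; done)
    | skip
  · rw [Nat.sub_self, if_pos (show Built E n l b κ ν 0 _ from fun B hB => absurd hB (by omega))]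
    push_cast
    exact le_rfl
  · simp only [Nat.sub_zero, Nat.cast_zero, zero_mul, add_zero]
    split_ifs
    exacts [le_min hv le_rfl, le_rfl]

open Ex in
/-- Output the root, and load the number of its block and the bound for further keys. -/
def popP : Program :=
  assign 24 (v 9 + lit 1) ;; .instr (.load 26 24) ;; assign 27 (v 26 % v 9) ;;
  .instr (.store 15 27) ;; assign 20 (v 27 / v 6) ;; assign 21 (v 26 + lit 1) ;;
  zero 24 ;; zero 26 ;; zero 27

theorem det_popP {M N j ρ : ℕ} (h6 : σ.var 6 = N) (h9 : σ.var 9 = M) (h15 : σ.var 15 = j)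
    (hρ : σ.mem (M + 1) = ρ) (hM : M + 1 < 2 ^ w) (hN : N < 2 ^ w) (hj : j < 2 ^ w)
    (hρw : ρ < 2 ^ w) (h24 : σ.var 24 = 0) (h26 : σ.var 26 = 0) (h27 : σ.var 27 = 0) :
    Det E popP σ ((((σ.withMem (Function.update σ.mem j (ρ % M))).set 20 (ρ % M / N)).set 21
      (ρ + 1)).tick 40) := by
  subst hρ
  have hm : σ.mem (M + 1) % M < 2 ^ w := (Nat.mod_le _ _).trans_lt hρw
  have hMw : M < 2 ^ w := by omega
  refine Det.le (Det.seq (det_set (M + 1) 5 ?_ ?_) <|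
    Det.seq (det_load (by norm_num) (by norm_num) ?_) <|
    Det.seq (det_set (σ.mem (M + 1) % M) 5 ?_ ?_) <|
    Det.seq (det_store (by norm_num) (by norm_num) ?_) <|
    Det.seq (det_set (σ.mem (M + 1) % M / N) 5 ?_ ?_) <|
    Det.seq (det_set (σ.mem (M + 1) + 1) 5 ?_ ?_) <|
    Det.seq (det_zero (by norm_num)) <| Det.seq (det_zero (by norm_num)) <| det_zero (by norm_num))
    ⟨?_, ?_, ?_, .inr ?_, ?_, ?_⟩
  all_goals first
    | (simp only [View.time_tick, View.time_set, View.time_setMem, View.time_withMem]; omega)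
    | (simp [h6, h9, h15, hM, hMw, hN, hj, hρw, hm]; done)
    | (intro r _
       simp only [View.var_tick, View.var_set, View.var_withMem, View.var_setMem]
       split_ifs <;> simp_all)

open Ex in
def outputStepP : Program :=
  popP ;; refreshP ;; assign 15 (v 15 + lit 1) ;; assign 17 (v 17 - lit 1)

-- On good memory the root is a genuine key, so the new threshold does not exceed the sentinel and
-- the step loses only δ. On bad memory nothing beyond the value 1 is claimed, but reducing the root
-- modulo 2^l still names an existing block.
open Classical in
theorem spec_outputStepP (R : Setup E l b κ ν n k t₀ r σ) {Q X j : ℕ} {μ : ℕ → ℕ} (hkn : k ≤ n)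
    (hQ : bestQueries (2 ^ ν) r t₀ = Q) (hX : refreshTime S (l + b + 1) (2 ^ ν) r t₀ κ = X)
    (hj : j < k) (hμ : Sound l b κ μ) {δ u u' : ℝ≥0∞}
    (hδ : halvings (2 ^ ν) t₀ * (3 / 4) ^ r ≤ δ) (hu : u ≤ 1) (hu' : min 1 (u + δ) ≤ u') :
    Spec E outputStepP ((σ.round k Q (X + 60) j μ).tick 1)
      (σ.round k Q (X + 60) (j + 1)) (Sound l b κ)
      (fun μ => if Good E n l b κ ν (j + 1) μ then u else 1)
      (if Good E n l b κ ν j μ then u' else 1) := by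
  subst hQ hX
  have hz20 := R.zero 20 (by norm_num) (by norm_num)
  have hz21 := R.zero 21 (by norm_num) (by norm_num)
  have hz24 := R.zero 24 (by norm_num) (by norm_num)
  have hz26 := R.zero 26 (by norm_num) (by norm_num)
  have hz27 := R.zero 27 (by norm_num) (by norm_num)
  have hκ := R.hκ
  have hn := R.n_le
  have p1 : 2 ^ ν ≤ 2 ^ (l + b) := Nat.pow_le_pow_right (by norm_num) (by omega)
  have p3 : 2 ^ l ≤ 2 ^ (l + b) := Nat.pow_le_pow_right (by norm_num) (by omega)
  have p4 : 2 ^ (l + b + 4) = 16 * 2 ^ (l + b) := by ring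
  have hbig := R.big
  have hpos := Nat.two_pow_pos (l + b)
  have hposl := Nat.two_pow_pos l
  have hkw : k - j < 2 ^ w := by have := R.hk; omega
  set Q := bestQueries (2 ^ ν) r t₀
  set X := refreshTime S (l + b + 1) (2 ^ ν) r t₀ κ
  set ρ := μ (2 ^ l + 1) with hρ
  have hρle : ρ ≤ 2 ^ (l + b) := hμ.1 _
  have hmod : ρ % 2 ^ l < 2 ^ l := Nat.mod_lt _ (Nat.two_pow_pos _)
  have hB : ρ % 2 ^ l / 2 ^ ν < 2 ^ κ := by
    rw [Nat.div_lt_iff_lt_mul (Nat.two_pow_pos _), ← pow_add, hκ]; exact hmod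
  set μ₁ := Function.update μ j (ρ % 2 ^ l) with hμ₁
  have hs₁ : Sound l b κ μ₁ := ⟨fun a => by
    rw [hμ₁, Function.update_apply]
    split_ifs
    exacts [by omega, hμ.1 a], isTree_update hμ.2 (by omega)⟩
  have R' : Setup E l b κ ν n k t₀ r ((σ.round k Q (X + 60) j μ₁).tick 41) :=
    ((((((R.withMem μ₁).set (i := 15) (by norm_num) (by norm_num) j).set (i := 17) (by norm_num)
      (by norm_num) (k - j)).ask (j * Q)).tick (j * (X + 60) + 3))).tick 41
  have sp := spec_refreshP (B := ρ % 2 ^ l / 2 ^ ν) (z := ρ + 1) R' hB (by omega) hs₁.1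
    (v := if Good E n l b κ ν j μ then u else 1) (V := 1)
    (by split_ifs; exacts [hu, le_rfl])
  unfold outputStepP
  refine Det.seq_spec (det_popP (M := 2 ^ l) (N := 2 ^ ν) (j := j) (ρ := ρ) ?_ ?_ ?_ ?_ (by omega)
    (by omega) (by omega) (by omega) ?_ ?_ ?_) <| Spec.seq ((sp.mono (fun y hy => ⟨hy, le_rfl⟩)
    (v' := if Good E n l b κ ν j μ then u' else 1) ?_).ge ⟨?_, rfl, rfl, .inr rfl, ?_, ?_⟩) fun y hy =>
    Det.seq_spec (det_set (j + 1) 5 ?_ ?_) <|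
    Det.spec (climb (2 ^ l) (2 ^ κ + ρ % 2 ^ l / 2 ^ ν) y μ₁ κ) (Det.le (det_set (k - (j + 1)) 5 ?_ ?_)
      ⟨?_, rfl, rfl, .inr rfl, ?_, ?_⟩) (hs₁.climb hB hy.le) ?_
  all_goals first
    | (simp [View.round, hz24, hz26, hz27, R.v6, R.v9, ← hρ]; done)
    | (simp [View.round, hz24, hz26, hz27, R.v6, R.v9]; omega)
    | (simp only [View.round, View.time_tick, View.time_ask, View.time_set, View.time_withMem,
        View.queries_tick, View.queries_set, View.queries_ask, View.queries_withMem,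
        Nat.succ_mul]; omega)
    | (intro r _
       simp only [View.round, View.var_tick, View.var_set, View.var_withMem, View.var_ask]
       split_ifs <;> simp_all; done)
    | skip
  · by_cases hg : Good E n l b κ ν j μ
    · have hlt := (hg.next R.layout hκ hn hμ.2 (by omega)).1
      rw [if_pos hg, if_pos hg, if_pos (by omega)]
      refine le_trans ?_ hu'
      rw [mul_one]
      gcongr
    · rw [if_neg hg, if_neg hg]
      split_ifs
      exacts [min_le_left _ _, le_rfl]
  · by_cases hbst : ρ + 1 ≤ 2 ^ (l + b) ∧ rank E n l ν (ρ % 2 ^ l / 2 ^ ν) (ρ + 1) y = 0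
    · rw [if_pos hbst]
      by_cases hg : Good E n l b κ ν j μ
      · rw [if_pos hg, if_pos ((hg.next R.layout hκ hn hμ.2 (by omega)).2 y ⟨hy, hbst.2⟩)]
      · rw [if_neg hg]
        split_ifs
        exacts [hu, le_rfl]
    · rw [if_neg hbst]
      split_ifs
      exacts [hu, le_rfl]

open Ex in
/-- Output as many indices as register `1` says. -/
def outputP : Program := assign 17 (v 1) ;; .loop 17 outputStepP

open Classical in
theorem spec_outputP (R : Setup E l b κ ν n k t₀ r σ) (h15 : σ.var 15 = 0)
    (hkn : k ≤ n) {μ₀ : ℕ → ℕ} (hσ : Sound l b κ μ₀) :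
    Spec E outputP (σ.withMem μ₀) (fun μ => (σ.round k (bestQueries (2 ^ ν) r t₀)
      (refreshTime S (l + b + 1) (2 ^ ν) r t₀ κ + 60) k μ).tick 1) (Sound l b κ)
      (fun μ => if Good E n l b κ ν k μ then 0 else 1)
      (if Good E n l b κ ν 0 μ₀ then min 1 (k * (halvings (2 ^ ν) t₀ * (3 / 4) ^ r)) else 1) := by
  set Q := bestQueries (2 ^ ν) r t₀ with hQ
  set X := refreshTime S (l + b + 1) (2 ^ ν) r t₀ κ with hX
  set δ : ℝ≥0∞ := halvings (2 ^ ν) t₀ * (3 / 4) ^ r with hδ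
  have lp := Spec.loop (E := E) (w := w) (S := S) (P := outputStepP) (r := 17) (m := k) (by norm_num)
    R.hk.le (fun i => σ.round k Q (X + 60) (k - i)) (fun _ => Sound l b κ)
    (fun i μ => if Good E n l b κ ν (k - i) μ then min 1 (i * δ) else 1)
    (fun i hi μ hμ => by
      have := R.hk
      have ej : k - i = k - (i + 1) + 1 := by omega
      have ei : k - (k - (i + 1)) = i + 1 := by omega
      refine ⟨by simp [View.round, ei, Nat.mod_eq_of_lt (show i + 1 < 2 ^ w by omega)], ?_⟩
      simp only [ej]
      refine spec_outputStepP R hkn hQ.symm hX.symm (by omega) hμ hδ.ge (min_le_left _ _) ?_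
      refine le_min (min_le_left _ _) ?_
      calc min 1 (min 1 (i * δ) + δ) ≤ i * δ + δ := by
            refine (min_le_right _ _).trans ?_
            gcongr
            exact min_le_right _ _
        _ = ((i + 1 : ℕ) : ℝ≥0∞) * δ := by push_cast; ring)
    (fun μ _ => by simp [View.round]) μ₀ hσ
  refine Det.seq_spec (det_set k 2 ?_ ?_) <| (((lp.mono (fun μ hμ => ⟨hμ, ?_⟩) ?_).ge
    ⟨?_, rfl, rfl, .inr rfl, ?_, ?_⟩))
  all_goals first
    | (simp [View.round, R.v1]; done)
    | (simp only [View.round, View.time_tick, View.time_ask, View.time_set, View.time_withMem,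
        View.queries_tick, View.queries_set, View.queries_ask, View.queries_withMem,
        Nat.sub_zero]; omega)
    | (intro r _
       simp only [View.round, View.var_tick, View.var_set, View.var_withMem, View.var_ask]
       split_ifs <;> simp_all)

end

end HybridRAM

/-! ### Computing the parameters -/

namespace HybridRAM

set_option linter.unusedSimpArgs false

noncomputable section

open scoped ENNReal

variable {w S : ℕ} {E : Env} {σ : View w S}

/-! ## Initialization -/

open Ex in
/-- Count in register `r` as long as `C` puts `1` into register `14`. -/
def countP (r : ℕ) (C : Program) : Program := C ;; .loop 14 (assign r (v r + lit 1) ;; C)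

theorem det_countP {r m c : ℕ} {C : Program} (hm : m < 2 ^ w) (hr : r < 100) (hr' : r ≠ 14)
    (h : σ.var r = 0) (h14 : σ.var 14 = 0)
    (hC : ∀ i ≤ m, ∀ x T, Det E C (((σ.set r i).set 14 x).tick T)
      (((σ.set r i).set 14 (if i < m then 1 else 0)).tick (T + c))) :
    Det E (countP r C) σ ((σ.set r m).tick ((c + 6) * (m + 1))) := by
  have hr'' := hr'.symm
  have lp := Det.loop (E := E) (P := assign r (.v r + .lit 1) ;; C) (r := 14) (m := m) (by norm_num)
    hm.le (fun i => ((σ.set r i).set 14 (if i < m then 1 else 0)).tick (c + i * (c + 6)))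
    (fun i hi => by
      have h1w : 1 % 2 ^ w = 1 := Nat.mod_eq_of_lt (by omega)
      refine ⟨by simp [hi, h1w], ?_⟩
      refine Det.le (Det.seq (det_set (i + 1) 5 ?_ ?_ hr (show 4 ≤ 5 by norm_num)) <|
        (hC (i + 1) hi 1 (c + i * (c + 6) + 6)).ge ⟨?_, rfl, rfl, .inr rfl, ?_, le_rfl⟩)
        ⟨?_, rfl, rfl, .inr rfl, ?_, le_rfl⟩
      all_goals first
        | (simp only [View.time_tick, View.time_set, Nat.succ_mul]; omega)
        | (simp [hr, hr']; done)
        | (intro r _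
           simp only [View.var_tick, View.var_set]
           split_ifs <;> simp_all)) (by simp)
  refine Det.le (Det.seq ((hC 0 (Nat.zero_le _) 0 0).ge (υ := σ) ⟨?_, rfl, rfl, .inr rfl, ?_, le_rfl⟩)
    (lp.ge ⟨fun _ _ => rfl, rfl, rfl, .inr rfl, ?_, le_rfl⟩)) ⟨?_, rfl, rfl, .inr rfl, ?_, le_rfl⟩
  all_goals first
    | (simp only [View.time_tick, View.time_set, Nat.mul_succ, Nat.succ_mul, Nat.mul_comm]; omega)
    | (intro r _
       simp only [View.var_tick, View.var_set]
       split_ifs <;> simp_all)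

open Ex in
/-- Test whether `2 ^ (x + j)` is smaller than the number in register `s`, where `x` is in
register `r`. -/
def powLtP (r s j : ℕ) : Program := assign 14 (bin .lt (bin .shl (lit 1) (v r + lit j)) (v s))

theorem det_powLt {r s j m x : ℕ} (hr : r < 100) (hs : s < 100) (hr' : r ≠ 14) (hs' : s ≠ 14)
    (hrs : s ≠ r) (h : σ.var r = 0) (h14 : σ.var 14 = 0) (hx : σ.var s = x)
    (hm : ∀ i ≤ m, 2 ^ (i + j) < x ↔ i < m) (hmw : 2 ^ (m + j) < 2 ^ w) (hxw : x < 2 ^ w) :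
    Det E (countP r (powLtP r s j)) σ ((σ.set r m).tick (16 * (m + 1))) := by
  have hr'' := hr'.symm
  have hmj : m + j < 2 ^ w := Nat.lt_two_pow_self.trans hmw
  refine det_countP (c := 10) (by omega) hr hr' h h14 fun i hi y T => ?_
  have hp : 2 ^ (i + j) < 2 ^ w := (Nat.pow_le_pow_right (by norm_num) (by omega)).trans_lt hmw
  have hij : i + j < 2 ^ w := by omega
  refine Det.le (det_set (if i < m then 1 else 0) 10 ?_ ?_ (by norm_num) (show 8 ≤ 10 by norm_num))
    ⟨?_, rfl, rfl, .inr rfl, ?_, le_rfl⟩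
  all_goals first
    | (simp [hr, hs, hr', hs', hrs, hx, hp, hij, hxw, hm i hi]; done)
    | (intro r _
       simp only [View.var_tick, View.var_set]
       split_ifs <;> simp_all; done)
    | (simp only [View.time_tick, View.time_set]; omega)

/-- The number of leading zeros among the first binary digits. -/
def leading (ε : ℝ) (N : ℕ) : ℕ := sInf {j | epsDigit ε j ≠ 0 ∨ N ≤ j}

theorem leading_le (ε : ℝ) (N : ℕ) : leading ε N ≤ N := Nat.sInf_le (.inr le_rfl)

theorem lt_leading {ε : ℝ} {N i : ℕ} (h : i < leading ε N) : epsDigit ε i = 0 ∧ i < N := by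
  simpa using Nat.notMem_of_lt_sInf h

theorem leading_spec (ε : ℝ) (N : ℕ) : epsDigit ε (leading ε N) ≠ 0 ∨ N ≤ leading ε N :=
  Nat.sInf_mem (s := {j | epsDigit ε j ≠ 0 ∨ N ≤ j}) ⟨N, .inr le_rfl⟩

open Ex in
def digitP : Program :=
  .instr (.readEps 24 16) ;; assign 14 (bin .lt (v 24) (bin .lt (v 16) (v 6))) ;; zero 24

theorem epsDigit_lt_two (ε : ℝ) (i : ℕ) : epsDigit ε i < 2 := Nat.mod_lt _ (by norm_num)

theorem det_leading {N : ℕ} (h16 : σ.var 16 = 0) (h14 : σ.var 14 = 0) (h24 : σ.var 24 = 0)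
    (h6 : σ.var 6 = N) (hN : N < 2 ^ w) (hw : 2 ≤ 2 ^ w) :
    Det E (countP 16 digitP) σ
      ((σ.set 16 (leading E.eps N)).tick (26 * (leading E.eps N + 1))) := by
  have hle := leading_le E.eps N
  refine det_countP (c := 20) (by omega) (by norm_num) (by norm_num) h16 h14 fun i hi y T => ?_
  have hd := epsDigit_lt_two E.eps i
  -- A single comparison makes both tests: the digit is below the indicator of i < N only if the
  -- digit is 0 and the indicator is 1.
  have hiff : epsDigit E.eps i < (if i < N then 1 else 0) ↔ i < leading E.eps N := by
    constructor
    · intro h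
      refine lt_of_le_of_ne hi fun he => ?_
      rcases leading_spec E.eps N with h' | h' <;> rw [← he] at h' <;> split_ifs at h <;> omega
    · intro h
      obtain ⟨h1, h2⟩ := lt_leading h
      rw [h1, if_pos h2]; exact one_pos
  have hiw : i < 2 ^ w := by omega
  have hdw : epsDigit E.eps i < 2 ^ w := by omega
  have h1w : (if i < N then 1 else 0) < 2 ^ w := by split_ifs <;> omega
  refine Det.le (Det.seq (det_readEps (by norm_num) (by norm_num) ?_) <|
    Det.seq (det_set (if i < leading E.eps N then 1 else 0) 10 ?_ ?_) <| det_zero (by norm_num))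
    ⟨?_, rfl, rfl, .inr rfl, ?_, le_rfl⟩
  all_goals first
    | (simp [h6, hN, hiw, hdw, h1w, hiff]; done)
    | (simp only [View.time_tick, View.time_set]; omega)
    | (intro r _
       simp only [View.var_tick, View.var_set]
       split_ifs <;> simp_all)

/-- The initial state. -/
def View.init (n k b : ℕ) : View w S where
  var := fun r => if r = 0 then n else if r = 1 then k else if r = 2 then b else 0
  mem := fun _ => 0
  psi := psiInit
  out := none
  time := 0
  queries := 0

theorem rep_init (n k b : ℕ) : Rep E (initState w S n k b) (View.init n k b) where
  reg := fun r _ => by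
    simp only [initState, View.init]
    split_ifs <;> rfl
  mem := fun _ _ => rfl
  psi := rfl
  out := fun _ h => by cases h
  time := le_rfl
  queries := le_rfl

/-- The binary logarithm of the number of blocks of an array that is searched for the `k` smallest
elements. -/
def blockLog (k : ℕ) : ℕ := Nat.clog 2 k - 1

/-- The binary logarithm of the accuracy. -/
def budget (ε : ℝ) (N κ l : ℕ) : ℕ := leading ε N + κ + Nat.clog 2 l + 3

open Ex in
def sizesP : Program :=
  countP 3 (powLtP 3 0 0) ;; countP 4 (powLtP 4 1 1) ;; countP 15 (powLtP 15 3 0) ;;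
  assign 5 (v 3 - v 4) ;; assign 6 (bin .shl (lit 1) (v 5)) ;; assign 7 (bin .shl (lit 1) (v 4)) ;;
  assign 8 (v 3 + v 2 + lit 1) ;; assign 9 (bin .shl (lit 1) (v 3)) ;;
  assign 12 (bin .shl (lit 1) (v 3 + v 2)) ;; assign 13 (v 8 + lit 1)

open Ex in
def budgetP : Program :=
  countP 16 digitP ;; assign 10 (v 16 + v 4 + v 15 + lit 3) ;; assign 11 (lit 3 * v 10) ;;
  assign 10 (bin .lt (v 10) (v 6) * v 10 + (lit 1 - bin .lt (v 10) (v 6)) * v 6) ;;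
  zero 15 ;; zero 16

def initP : Program := sizesP ;; budgetP

/-- The state after the sizes are computed. -/
def View.sized (σ : View w S) (b l κ ν cl : ℕ) : View w S :=
  (((((((((σ.set 3 l).set 4 κ).set 15 cl).set 5 ν).set 6 (2 ^ ν)).set 7 (2 ^ κ)).set 8
    (l + b + 1)).set 9 (2 ^ l)).set 12 (2 ^ (l + b))).set 13 (l + b + 1 + 1)

theorem det_sizesP {n k b l κ : ℕ} (hl : Nat.clog 2 n = l) (hκ : blockLog k = κ) (hkn : k ≤ n)
    (hn : 3 ≤ n) (hbig : 2 ^ (l + b + 4) ≤ 2 ^ w) :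
    Det E sizesP (View.init n k b : View w S) (((View.init n k b).sized b l κ (l - κ)
      (Nat.clog 2 l)).tick (16 * (l + κ + Nat.clog 2 l) + 150)) := by
  have hnl : n ≤ 2 ^ l := hl ▸ Nat.le_pow_clog (by norm_num) n
  have hlog : Nat.clog 2 k ≤ l := hl ▸ Nat.clog_mono_right 2 hkn
  have hl1 : 1 ≤ l := hl ▸ Nat.clog_pos (by norm_num) (by omega)
  have hκl : κ ≤ l := by rw [← hκ, blockLog]; omega
  have hκl' : κ + 1 ≤ l := by rw [← hκ, blockLog]; omega
  have hll : Nat.clog 2 l ≤ l := Nat.clog_le_of_le_pow Nat.lt_two_pow_self.le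
  have hpw : ∀ i ≤ l + b + 1, 2 ^ i < 2 ^ w := fun i hi =>
    (Nat.pow_lt_pow_right (by norm_num) (by omega)).trans_le hbig
  have hiw : ∀ i ≤ l + b + 1, i < 2 ^ w := fun i hi => Nat.lt_two_pow_self.trans (hpw i hi)
  have hnw : n < 2 ^ w := hnl.trans_lt (hpw l (by omega))
  have hkw : k < 2 ^ w := by omega
  have a1 := hpw κ (by omega)
  have a2 := hpw (κ + 1) (by omega)
  have a3 := hpw (l - κ) (by omega)
  have a4 := hpw l (by omega)
  have a5 := hpw (l + b) (by omega)
  have a6 := hpw (Nat.clog 2 l) (by omega)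
  have b1 := hiw κ (by omega)
  have b2 := hiw (l - κ) (by omega)
  have b3 := hiw l (by omega)
  have b4 := hiw (l + b) (by omega)
  refine Det.le (Det.seq (det_powLt (x := n) (m := l) (by norm_num) (by norm_num) (by norm_num)
      (by norm_num) (by norm_num) ?_ ?_ ?_ (fun i _ => ?_) ?_ hnw) <|
    Det.seq (det_powLt (x := k) (m := κ) (by norm_num) (by norm_num) (by norm_num)
      (by norm_num) (by norm_num) ?_ ?_ ?_ (fun i _ => ?_) ?_ hkw) <|
    Det.seq (det_powLt (x := l) (m := Nat.clog 2 l) (by norm_num) (by norm_num) (by norm_num)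
      (by norm_num) (by norm_num) ?_ ?_ ?_ (fun i _ => ?_) ?_ b3) <|
    Det.seq (det_set (l - κ) 5 ?_ ?_) <| Det.seq (det_set (2 ^ (l - κ)) 5 ?_ ?_) <|
    Det.seq (det_set (2 ^ κ) 5 ?_ ?_) <| Det.seq (det_set (l + b + 1) 8 ?_ ?_) <|
    Det.seq (det_set (2 ^ l) 5 ?_ ?_) <| Det.seq (det_set (2 ^ (l + b)) 8 ?_ ?_) <|
    det_set (l + b + 1 + 1) 5 ?_ ?_) ⟨fun _ _ => rfl, rfl, rfl, .inr rfl, ?_, le_rfl⟩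
  all_goals first
    | (simp [View.init, a1, a2, a3, a4, a5, a6, b1, b2, b3, b4, hκl]; done)
    | (simp only [View.time_tick, View.time_set, View.sized, View.init]; omega)
    | skip
  · rw [← Nat.lt_clog_iff_pow_lt (by norm_num), hl, add_zero]
  -- The offset 1 in `powLtP` produces the subtraction in `blockLog`, including its truncation for k
  -- = 1.
  · rw [← Nat.lt_clog_iff_pow_lt (by norm_num), ← hκ, blockLog]; omega
  · rw [← Nat.lt_clog_iff_pow_lt (by norm_num), add_zero]

theorem det_budgetP {n k b l κ ν t₀ r : ℕ} (T : ℕ) (hκν : κ + ν = l) (hbig : 2 ^ (l + b + 4) ≤ 2 ^ w)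
    (ht₀ : min (budget E.eps (2 ^ ν) κ l) (2 ^ ν) = t₀) (hr : 3 * budget E.eps (2 ^ ν) κ l = r)
    (hrw : r < 2 ^ w) :
    Det E budgetP (((View.init n k b : View w S).sized b l κ ν (Nat.clog 2 l)).tick T)
      (((((((View.init n k b).sized b l κ ν (Nat.clog 2 l)).set 10 t₀).set 11 r).set 15 0).set 16 0).tick
        (T + (26 * leading E.eps (2 ^ ν) + 100))) := by
  have hlw : l + b + 4 < 2 ^ w := Nat.lt_two_pow_self.trans_le hbig
  have hN : 2 ^ ν < 2 ^ w := (Nat.pow_lt_pow_right (by norm_num) (by omega)).trans_le hbig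
  have hΛ : budget E.eps (2 ^ ν) κ l < 2 ^ w := by omega
  have e := ite_mul_min (budget E.eps (2 ^ ν) κ l) (2 ^ ν)
  rw [ht₀] at e
  refine Det.le (Det.seq (det_leading (N := 2 ^ ν) ?_ ?_ ?_ ?_ hN (by omega)) <|
    Det.seq (det_set (budget E.eps (2 ^ ν) κ l) 10 ?_ ?_) <| Det.seq (det_set r 5 ?_ ?_) <|
    Det.seq (det_set t₀ 20 ?_ ?_) <| Det.seq (det_zero (by norm_num)) <| det_zero (by norm_num))
    ⟨?_, rfl, rfl, .inr rfl, ?_, le_rfl⟩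
  all_goals first
    | (simp [View.init, View.sized, hN, hΛ, hr, ite_le_one]; done)
    | (simp [View.init, View.sized, budget]; done)
    | (simp only [Ex.ev_add, Ex.ev_mul, Ex.ev_sub, Ex.ev_lt, Ex.ev_v, Ex.ev_lit, View.var_tick,
         View.var_set, View.sized, reduceIte, Nat.reduceEqDiff]; exact e)
    | (simp only [View.time_tick, View.time_set, View.sized, View.init]; omega)
    | (intro r _
       simp only [View.var_tick, View.var_set]
       split_ifs <;> simp_all)

/-- The numbers that the algorithm works with. -/
structure Sizes (E : Env) (w S n k b l κ ν t₀ r : ℕ) : Prop where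
  hl : Nat.clog 2 n = l
  hκ : blockLog k = κ
  hκν : κ + ν = l
  ht₀ : min (budget E.eps (2 ^ ν) κ l) (2 ^ ν) = t₀
  hr : 3 * budget E.eps (2 ^ ν) κ l = r
  three_le : 3 ≤ n
  one_le : 1 ≤ k
  hkn : k ≤ n
  big : 2 ^ (l + b + 4) ≤ 2 ^ w
  hrw : r < 2 ^ w
  hS : S < 2 ^ w
  room : 2 * (l + b + 1) + 1 < S
  idx : E.idxBits = l
  vals : E.valBits = b
  table_lt : ∀ i, E.table i < 2 ^ b
  dummy : ∀ i, n ≤ i → E.table i = 0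

theorem det_initP {n k b l κ ν t₀ r : ℕ} (Z : Sizes E w S n k b l κ ν t₀ r) :
    ∃ σ : View w S, Det E initP (View.init n k b) σ ∧ Setup E l b κ ν n k t₀ r σ ∧ σ.var 15 = 0 ∧
      σ.var 17 = 0 ∧ σ.mem = (fun _ => 0) ∧ σ.queries = 0 ∧
      σ.time = 16 * (l + κ + Nat.clog 2 l) + 26 * leading E.eps (2 ^ ν) + 250 := by
  obtain ⟨hl, hκ, hκν, ht₀, hr, hn, hk, hkn, hbig, hrw, hS, room, hidx, hvals, htab, hdum⟩ := Z
  have hnl : n ≤ 2 ^ l := hl ▸ Nat.le_pow_clog (by norm_num) n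
  have hl2 : 2 ^ l < 2 ^ w := (Nat.pow_lt_pow_right (by norm_num) (by omega)).trans_le hbig
  have hlog : Nat.clog 2 k ≤ l := hl ▸ Nat.clog_mono_right 2 hkn
  have hl1 : 1 ≤ l := hl ▸ Nat.clog_pos (by norm_num) (by omega)
  -- The subtraction in `blockLog` leaves at least one qubit to a block, as the reflection requires,
  -- even for k = n.
  have hν : 1 ≤ ν := by rw [blockLog] at hκ; omega
  have d1 := det_sizesP (E := E) (w := w) (S := S) hl hκ hkn hn hbig
  rw [show l - κ = ν by omega] at d1
  have d2 := (det_budgetP (E := E) (w := w) (S := S) (n := n) (k := k) (b := b)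
    (16 * (l + κ + Nat.clog 2 l) + 150) hκν hbig ht₀ hr hrw)
  refine ⟨_, Det.seq d1 d2, ?_, ?_, ?_, rfl, rfl, ?_⟩
  · refine ⟨⟨hidx, hvals, htab, hν, by omega, room⟩, hS, hbig, hnl, by omega, hrw, ?_, ?_, hκν, hdum,
      ?_, ?_, ?_, ?_, ?_, ?_, ?_, ?_, ?_, ?_, ?_, ?_, ?_, fun r h1 h2 => ?_, rfl, rfl⟩
    · rw [← ht₀]
      exact le_min (by unfold budget; omega) Nat.one_le_two_pow
    · rw [← ht₀]
      exact min_le_right _ _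
    all_goals first
      | (simp [View.init, View.sized]; done)
      | skip
    simp only [View.init, View.sized, View.var_tick, View.var_set]
    repeat rw [if_neg (by omega)]
  · simp [View.init, View.sized]
  · simp [View.init, View.sized]
  · simp only [View.time_tick, View.time_set, View.sized, View.init]
    omega

end

end HybridRAM

/-! ### The whole program: from specifications to supports and probabilities -/

namespace HybridRAM

set_option linter.unusedSimpArgs false

noncomputable section

open scoped ENNReal

variable {w S : ℕ} {E : Env}

/-! ## The whole program -/

/-- Find the `k` smallest elements. -/
def minimaP : Program := initP ;; buildP ;; outputP

def minimaQueries (k κ ν t₀ r : ℕ) : ℕ := (2 ^ κ + k) * bestQueries (2 ^ ν) r t₀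

def minimaTime (E : Env) (S k b l κ ν t₀ r : ℕ) : ℕ :=
  16 * (l + κ + Nat.clog 2 l) + 26 * leading E.eps (2 ^ ν) + 300 +
    (2 ^ κ + k) * (refreshTime S (l + b + 1) (2 ^ ν) r t₀ κ + 60)

open Classical in
theorem spec_minimaP {n k b l κ ν t₀ r : ℕ} (Z : Sizes E w S n k b l κ ν t₀ r) :
    ∃ st : (ℕ → ℕ) → View w S, (∀ μ, (st μ).mem = μ ∧ (st μ).queries = minimaQueries k κ ν t₀ r ∧
      (st μ).time ≤ minimaTime E S k b l κ ν t₀ r) ∧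
      Spec E minimaP (View.init n k b) st (Sound l b κ) (fun μ => if Good E n l b κ ν k μ then 0 else 1)
        (min 1 ((2 ^ κ + k) * (halvings (2 ^ ν) t₀ * (3 / 4) ^ r))) := by
  obtain ⟨σ, hdet, R, h15, h17, hmem, hq, ht⟩ := det_initP Z
  set Q := bestQueries (2 ^ ν) r t₀ with hQ
  set X := refreshTime S (l + b + 1) (2 ^ ν) r t₀ κ with hX
  set T := 2 ^ κ * (X + 20) + 10 with hT
  set τ := (σ.ask (2 ^ κ * Q)).tick T with hτ
  have R' : Setup E l b κ ν n k t₀ r τ := (R.ask _).tick _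
  refine ⟨fun μ => (τ.round k Q (X + 60) k μ).tick 1, fun μ => ⟨rfl, ?_, ?_⟩, ?_⟩
  · simp only [hτ, View.round, View.queries_tick, View.queries_set, View.queries_ask,
      View.queries_withMem, hq, minimaQueries, ← hQ]
    ring
  · simp only [hτ, hT, View.round, View.time_tick, View.time_set, View.time_ask,
      View.time_withMem, ht, minimaTime, ← hX, add_mul]
    have : 2 ^ κ * (X + 20) ≤ 2 ^ κ * (X + 60) := Nat.mul_le_mul_left _ (by omega)
    omega
  · refine Det.seq_spec hdet ?_
    refine Spec.seq ((spec_buildP R h15 h17 (v := min 1 (k * (halvings (2 ^ ν) t₀ * (3 / 4) ^ r)))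
      ?_ (min_le_left _ _)).mono (ok' := Sound l b κ)
      (val' := fun μ => if Good E n l b κ ν 0 μ then min 1 (k * (halvings (2 ^ ν) t₀ * (3 / 4) ^ r))
        else 1) (fun μ hμ => ⟨hμ, ?_⟩) ?_) fun μ hμ => ?_
    · rw [hmem]
      exact ⟨fun _ => Nat.zero_le _, fun _ _ _ => by simp⟩
    · by_cases h : Built E n l b κ ν (2 ^ κ) μ
      · rw [if_pos h, if_pos (good_of_built h)]
      · rw [if_neg h]
        split_ifs
        exacts [min_le_left _ _, le_rfl]
    · refine min_le_min le_rfl ?_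
      rw [add_mul, add_comm]
      gcongr
      exact min_le_right _ _
    · exact spec_outputP R' (by simpa [hτ] using h15) Z.hkn hμ

/-- Use the cost 0 on the described final states and `⊤` elsewhere, including exhausted fuel. A
finite expected cost forces everything else to have probability zero. -/
theorem Spec.support {ι : Type*} {P : Program} {σ : View w S} {st : ι → View w S} {ok : ι → Prop}
    {val : ι → ℝ≥0∞} {v : ℝ≥0∞} (h : Spec E P σ st ok val v) (hv : v ≠ ⊤) {s : State w S}
    (hs : Rep E s σ) : ∀ o ∈ (P.exec E (fuelFor w) s).support,
      ∃ s', o = some s' ∧ ∃ y, ok y ∧ Rep E s' (st y) := by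
  classical
  intro o ho
  by_contra hne
  have key := h (fun τ => if ∃ y, ok y ∧ τ = st y then 0 else ⊤) (fun y hy => by
    rw [if_pos ⟨y, hy, rfl⟩]; exact bot_le) s hs
    (fun s' => if ∃ y, ok y ∧ Rep E s' (st y) then 0 else ⊤) (fun s' τ hτ => by
      by_cases h2 : ∃ y, ok y ∧ τ = st y
      · obtain ⟨y, hy, rfl⟩ := h2
        rw [if_pos ⟨y, hy, hτ⟩]
        exact bot_le
      · beta_reduce
        rw [if_neg h2]
        exact le_top)
  have : (P.exec E (fuelFor w) s) o * ⊤ ≤ v := by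
    refine le_trans ?_ key
    unfold expect
    refine le_trans (le_of_eq ?_) (ENNReal.le_tsum o)
    congr 1
    cases o with
    | none => rfl
    | some s' =>
      simp only [total]
      rw [if_neg fun ⟨y, h1, h2⟩ => hne ⟨s', rfl, y, h1, h2⟩]
  rw [ENNReal.mul_top ((PMF.mem_support_iff _ _).1 ho), top_le_iff] at this
  exact hv this

/-- Values 0 and at least 1 stand for success and failure. The indicator of failure is then an
admissible cost, so `v` bounds the probability of failure. -/
theorem Spec.prob {ι : Type*} {P : Program} {σ : View w S} {st : ι → View w S} {ok : ι → Prop}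
    {val : ι → ℝ≥0∞} {v : ℝ≥0∞} (h : Spec E P σ st ok val v) (hval : ∀ y, val y = 0 ∨ 1 ≤ val y)
    {s : State w S} (hs : Rep E s σ) : 1 - v ≤ (P.exec E (fuelFor w) s).toOuterMeasure
      {o | ∃ s', o = some s' ∧ ∃ y, ok y ∧ val y = 0 ∧ Rep E s' (st y)} := by
  classical
  set p := P.exec E (fuelFor w) s
  set good : Set (Option (State w S)) :=
    {o | ∃ s', o = some s' ∧ ∃ y, ok y ∧ val y = 0 ∧ Rep E s' (st y)} with hgood
  have key := h (fun τ => if ∃ y, ok y ∧ val y = 0 ∧ τ = st y then 0 else if ∃ y, ok y ∧ τ = st y then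
      1 else ⊤) (fun y hy => by
    split_ifs with h1 h2
    · exact bot_le
    · exact (hval y).resolve_left fun h0 => h1 ⟨y, hy, h0, rfl⟩
    · exact absurd ⟨y, hy, rfl⟩ h2) s hs
    (fun s' => if some s' ∈ good then 0 else 1) (fun s' τ hτ => by
      by_cases h2 : ∃ y, ok y ∧ val y = 0 ∧ τ = st y
      · obtain ⟨y, hy, h0, rfl⟩ := h2
        rw [if_pos (show some s' ∈ good from ⟨s', rfl, y, hy, h0, hτ⟩)]
        exact bot_le
      · beta_reduce
        rw [if_neg h2]
        split_ifs
        exacts [bot_le, bot_le, le_rfl, le_top])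
  rw [tsub_le_iff_right, ← PMF.tsum_coe p, PMF.toOuterMeasure_apply]
  refine le_trans ?_ (add_le_add_right key _)
  unfold expect
  rw [← ENNReal.tsum_add]
  refine ENNReal.tsum_le_tsum fun o => ?_
  by_cases ho : o ∈ good
  · rw [Set.indicator_of_mem ho]
    exact le_self_add
  · rw [Set.indicator_of_notMem ho, zero_add]
    cases o with
    | none => exact le_mul_of_one_le_right' (by simp [total])
    | some s' => simp [total, ho, p]

/-- In base 2^l the value is the leading part and the index the last digit, so the order of keys is
lexicographic; the encoding preserves the order of `A`. -/
theorem key_lt_key_iff {A : Type*} [LinearOrder A] {n b : ℕ} {a : Fin n → A} {enc : A ↪o Fin (2 ^ b)}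
    {ε : ℝ} {l : ℕ} (hn : n ≤ 2 ^ l) (i i' : Fin n) :
    (arrayEnv a enc ε).key l i < (arrayEnv a enc ε).key l i' ↔
      toLex (a i, i) < toLex (a i', i') := by
  have hi := i.2
  have hi' := i'.2
  rw [Prod.Lex.toLex_lt_toLex, ← enc.lt_iff_lt, ← enc.injective.eq_iff, Fin.lt_def, Fin.ext_iff,
    Fin.lt_def]
  simp only [Env.key, arrayEnv, i.2, i'.2, dif_pos, Fin.eta]
  generalize (enc (a i) : ℕ) = x
  generalize (enc (a i') : ℕ) = y
  rcases lt_trichotomy x y with h | h | h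
  · have : 2 ^ l * (x + 1) ≤ 2 ^ l * y := Nat.mul_le_mul_left _ h
    rw [mul_add] at this
    constructor
    · exact fun _ => .inl h
    · intro _; omega
  · subst h
    simp
  · have : 2 ^ l * (y + 1) ≤ 2 ^ l * x := Nat.mul_le_mul_left _ h
    rw [mul_add] at this
    constructor
    · intro _; omega
    · rintro (h' | ⟨h', _⟩) <;> omega

theorem Good.correct {A : Type*} [LinearOrder A] {n b k l κ ν : ℕ} {a : Fin n → A}
    {enc : A ↪o Fin (2 ^ b)} {ε : ℝ} {μ : ℕ → ℕ} (h : Good (arrayEnv a enc ε) n l b κ ν k μ)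
    (hn : n ≤ 2 ^ l) (hlw : 2 ^ l ≤ 2 ^ w) (hkn : k ≤ n) {s : State w S}
    (hs : ∀ a < 2 ^ w, s.mem (BitVec.ofNat w a) = BitVec.ofNat w (μ a)) : s.Correct a k := by
  obtain ⟨z, hL, -⟩ := h
  refine ⟨fun j => ⟨μ j, hL.lt j j.2⟩, ⟨fun j j' hj => ?_, fun m hm j => ?_⟩, fun j => ?_⟩
  · exact (key_lt_key_iff (enc := enc) (ε := ε) hn _ _).1 (hL.mono j j' hj j'.2)
  · refine (key_lt_key_iff (enc := enc) (ε := ε) hn _ _).1 ((hL.below j j.2).trans_le ?_)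
    by_contra hlt
    obtain ⟨i', h1, h2⟩ := hL.all m m.2 (by simpa using hlt)
    exact hm ⟨i', h1⟩ (Fin.ext h2)
  · have := hL.lt j j.2
    have := j.2
    rw [hs j (by omega), BitVec.toNat_ofNat, Nat.mod_eq_of_lt (by omega)]

end

end HybridRAM

/-! ### Estimates of the failure probability and of the costs -/

namespace HybridRAM

set_option linter.unusedSimpArgs false

noncomputable section

open scoped ENNReal

/-! ## The probability of failure -/

/-- While the digits vanish, the integer part of ε 2^i stays 0: doubling can only append the next
digit. -/
theorem two_pow_leading_mul_lt {ε : ℝ} (hε : 0 < ε) (hε1 : ε < 1) (N : ℕ) :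
    ε * 2 ^ leading ε N < 1 := by
  have key : ∀ i ≤ leading ε N, ⌊ε * 2 ^ i⌋₊ = 0 := by
    intro i
    induction i with
    | zero => intro _; rw [Nat.floor_eq_zero]; simpa using hε1
    | succ i ih =>
      intro hi
      have h0 := (lt_leading (show i < leading ε N by omega)).1
      have h1 := Nat.floor_eq_zero.1 (ih (by omega))
      have h2 : ⌊ε * 2 ^ (i + 1)⌋₊ < 2 := by
        rw [Nat.floor_lt (by positivity), pow_succ]
        push_cast
        linarith
      unfold epsDigit at h0
      omega
  exact Nat.floor_eq_zero.1 (key _ le_rfl)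

theorem one_le_two_pow_leading_mul {ε : ℝ} {N : ℕ} (h : leading ε N < N) :
    1 ≤ ε * 2 ^ (leading ε N + 1) := by
  have h1 := (leading_spec ε N).resolve_right (by omega)
  unfold epsDigit at h1
  by_contra hlt
  exact h1 (by rw [Nat.floor_eq_zero.2 (not_le.1 hlt)])

/-- Two cases. If a non-zero digit of ε was found, then 2^(-leading - 1) ≤ ε, and the summands of
the budget pay for ε, for the blocks and for the halvings. If ε is too small for its digits to be
read, the budget exceeds the block size, so there are no halvings and no errors. -/
theorem failure_le {ε : ℝ} {k κ ν l t₀ r : ℕ} (hε : 0 < ε) (hκν : κ + ν = l) (hk : k ≤ 2 * 2 ^ κ)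
    (ht₀ : min (budget ε (2 ^ ν) κ l) (2 ^ ν) = t₀) (hr : 3 * budget ε (2 ^ ν) κ l = r) :
    ((2 ^ κ + k) * (halvings (2 ^ ν) t₀ * (3 / 4) ^ r) : ℝ≥0∞) ≤ ENNReal.ofReal ε := by
  have e : ((2 ^ κ + k) * (halvings (2 ^ ν) t₀ * (3 / 4) ^ r) : ℝ≥0∞) =
      ENNReal.ofReal ((2 ^ κ + k) * (halvings (2 ^ ν) t₀ * (3 / 4) ^ r)) := by
    rw [ENNReal.ofReal_mul (by positivity), ENNReal.ofReal_mul (by positivity),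
      ENNReal.ofReal_add (by positivity) (by positivity), ENNReal.ofReal_pow (by positivity),
      ENNReal.ofReal_pow (by positivity), ENNReal.ofReal_div_of_pos (by norm_num)]
    simp
  rw [e]
  refine ENNReal.ofReal_le_ofReal ?_
  have hlead := leading_le ε (2 ^ ν)
  rcases hlead.lt_or_eq with h | h
  · have h1 := one_le_two_pow_leading_mul h
    have ht1 : 1 ≤ t₀ := by
      rw [← ht₀]; exact le_min (by unfold budget; omega) Nat.one_le_two_pow
    have hs : halvings (2 ^ ν) t₀ ≤ 2 ^ Nat.clog 2 l :=
      ((halvings_le ht1).trans (by omega)).trans (Nat.le_pow_clog (by norm_num) l)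
    have hs' : (halvings (2 ^ ν) t₀ : ℝ) ≤ 2 ^ Nat.clog 2 l := by exact_mod_cast hs
    have hk' : (k : ℝ) ≤ 2 * 2 ^ κ := by exact_mod_cast hk
    -- The factor 3 in the number of searches is due to (3/4)³ ≤ 1/2.
    have hq : ((3 / 4 : ℝ)) ^ r ≤ (1 / 2) ^ budget ε (2 ^ ν) κ l := by
      rw [← hr, pow_mul]
      exact pow_le_pow_left₀ (by norm_num) (by norm_num) _
    calc ((2 : ℝ) ^ κ + k) * (halvings (2 ^ ν) t₀ * (3 / 4) ^ r)
        ≤ (4 * 2 ^ κ) * (2 ^ Nat.clog 2 l * (1 / 2) ^ budget ε (2 ^ ν) κ l) := by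
          gcongr
          have : (0 : ℝ) < 2 ^ κ := by positivity
          linarith
      _ = (1 / 2) ^ (leading ε (2 ^ ν) + 1) := by
          unfold budget
          simp only [pow_add, one_div, inv_pow]
          field_simp
          norm_num
      _ ≤ ε := by
          rw [one_div, inv_pow, inv_le_iff_one_le_mul₀ (by positivity)]
          exact h1
  -- The countdown starts at the full block size.
  · have ht : 2 ^ ν ≤ t₀ := by
      rw [← ht₀]; exact le_min (by unfold budget; omega) le_rfl
    have h0 : halvings (2 ^ ν) t₀ = 0 := Nat.sInf_eq_zero.2 (.inl (by simpa using ht))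
    rw [h0]
    simpa using hε.le

/-! ## The cost -/

/-- Minimality of j = `iters` gives j - 1 ≤ √(N/T), and the two missing units are absorbed by √(N/T)
≥ 1. -/
theorem iters_add_one_le {N T : ℕ} (hT : 1 ≤ T) (hTN : T ≤ N) :
    (iters N T + 1 : ℝ) ≤ 3 * √(N / T) := by
  have hT' : (0 : ℝ) < T := by exact_mod_cast hT
  have h1 : 1 ≤ √((N : ℝ) / T) := by
    rw [Real.one_le_sqrt, one_le_div hT']; exact_mod_cast hTN
  rcases Nat.eq_zero_or_pos (iters N T) with h | h
  · rw [h]; push_cast; linarith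
  · have h2 := lt_of_lt_iters (show iters N T - 1 < iters N T by omega)
    have h3 : ((iters N T - 1 : ℕ) : ℝ) ≤ √((N : ℝ) / T) := by
      refine Real.le_sqrt_of_sq_le ?_
      rw [le_div_iff₀ hT', sq]
      exact_mod_cast h2.le
    rw [Nat.cast_sub h] at h3
    push_cast at h3
    linarith

theorem sum_sqrt_two_pow (s : ℕ) : ∑ i ∈ Finset.range s, √(2 ^ i : ℝ) ≤ 3 * √(2 ^ s) := by
  induction s with
  | zero => simp
  | succ s ih =>
    rw [Finset.sum_range_succ, pow_succ, Real.sqrt_mul (by positivity)]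
    -- The constant 3 reproduces itself because 3 + 1 ≤ 3√2.
    have h2 : (4 / 3 : ℝ) ≤ √2 := Real.le_sqrt_of_sq_le (by norm_num)
    nlinarith [Real.sqrt_nonneg ((2 : ℝ) ^ s)]

theorem sum_sqrt_div_add_one (N t : ℕ) :
    ∑ i ∈ Finset.range t, √((N : ℝ) / ((i + 1 : ℕ) : ℝ)) ≤ 2 * √(N * t) := by
  induction t with
  | zero => simp
  | succ t ih =>
    rw [Finset.sum_range_succ]
    refine (add_le_add_left ih _).trans ?_
    rw [Real.sqrt_div (by positivity), Real.sqrt_mul (by positivity), Real.sqrt_mul (by positivity)]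
    set a := √((t + 1 : ℕ) : ℝ)
    set b := √(t : ℝ)
    have ha : a * a = t + 1 := by rw [Real.mul_self_sqrt (by positivity)]; push_cast; rfl
    have hb : b * b = t := Real.mul_self_sqrt (by positivity)
    have ha0 : 0 < a := Real.sqrt_pos.2 (by positivity)
    have hb0 : 0 ≤ b := Real.sqrt_nonneg _
    -- Telescoping: 1/√(t+1) ≤ 2(√(t+1) - √t).
    have hle : 1 / a ≤ 2 * (a - b) := by
      rw [div_le_iff₀ ha0]
      nlinarith [sq_nonneg (a - b)]
    have := mul_le_mul_of_nonneg_left hle (Real.sqrt_nonneg (N : ℝ))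
    rw [mul_one_div] at this
    linarith

theorem sum_sqrt_div (N t : ℕ) :
    ∑ i ∈ Finset.range t, √((N : ℝ) / ((t - i : ℕ) : ℝ)) ≤ 2 * √(N * t) := by
  refine le_of_eq_of_le ?_ (sum_sqrt_div_add_one N t)
  rw [← Finset.sum_range_reflect]
  refine Finset.sum_congr rfl fun i hi => ?_
  have := Finset.mem_range.1 hi
  rw [show t - (t - 1 - i) = i + 1 by omega]

/-- The cost of finding the best key in a block, when a search for `T` keys costs `f T`. -/
theorem sum_cost_le {ν Λ t₀ r : ℕ} (hΛ : 1 ≤ Λ) (ht₀ : min Λ (2 ^ ν) = t₀) (hr : 3 * Λ = r) {f : ℕ → ℝ}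
    {W : ℝ} (hW : 0 ≤ W) (hf : ∀ T, 1 ≤ T → T ≤ 2 ^ ν → f T ≤ W * √((2 ^ ν : ℕ) / T)) :
    ∑ i ∈ Finset.range (halvings (2 ^ ν) t₀), r * f (2 ^ ν / 2 ^ i) +
      ∑ i ∈ Finset.range (t₀ - 0), f (t₀ - i) ≤ 20 * W * √((2 ^ ν : ℕ) * Λ) := by
  have hpos : 1 ≤ 2 ^ ν := Nat.one_le_two_pow
  have h1 : 1 ≤ t₀ := ht₀ ▸ le_min hΛ hpos
  have hN : t₀ ≤ 2 ^ ν := ht₀ ▸ min_le_right _ _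
  have htΛ : t₀ ≤ Λ := ht₀ ▸ min_le_left _ _
  set s := halvings (2 ^ ν) t₀ with hs
  have hsν : s ≤ ν := halvings_le h1
  have hΛ0 : (0 : ℝ) < Λ := by exact_mod_cast hΛ
  have second : ∑ i ∈ Finset.range (t₀ - 0), f (t₀ - i) ≤ 2 * W * √((2 ^ ν : ℕ) * Λ) := by
    calc ∑ i ∈ Finset.range (t₀ - 0), f (t₀ - i)
        ≤ ∑ i ∈ Finset.range t₀, W * √((2 ^ ν : ℕ) / ((t₀ - i : ℕ) : ℝ)) := by
          rw [Nat.sub_zero]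
          refine Finset.sum_le_sum fun i hi => ?_
          have := Finset.mem_range.1 hi
          exact hf _ (by omega) (by omega)
      _ ≤ W * (2 * √((2 ^ ν : ℕ) * t₀)) := by
          rw [← Finset.mul_sum]
          exact mul_le_mul_of_nonneg_left (sum_sqrt_div _ _) hW
      _ ≤ W * (2 * √((2 ^ ν : ℕ) * Λ)) := by gcongr
      _ = _ := by ring
  have first : ∑ i ∈ Finset.range s, r * f (2 ^ ν / 2 ^ i) ≤ 18 * W * √((2 ^ ν : ℕ) * Λ) := by
    rcases Nat.eq_zero_or_pos s with h0 | h0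
    · rw [h0, Finset.sum_range_zero]; positivity
    have hlt := lt_of_lt_halvings (show 0 < halvings (2 ^ ν) t₀ by omega)
    have hlt' := lt_of_lt_halvings (show s - 1 < halvings (2 ^ ν) t₀ by omega)
    -- If any halving takes place, the minimum defining t₀ is Λ.
    have htΛ : t₀ = Λ := by
      rw [pow_zero, Nat.div_one] at hlt
      rw [← ht₀] at hlt ⊢
      exact min_eq_left (by by_contra h; rw [min_eq_right (by omega)] at hlt; omega)
    -- Before the last halving the expected number still exceeded Λ.
    have h2s : 2 ^ s * Λ ≤ 2 * 2 ^ ν := by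
      have h3 := (Nat.le_div_iff_mul_le (Nat.two_pow_pos _)).1 hlt'.le
      obtain ⟨s', hs'⟩ : ∃ s', s = s' + 1 := ⟨s - 1, by omega⟩
      rw [hs'] at h3 ⊢
      rw [htΛ, Nat.add_sub_cancel] at h3
      rw [pow_succ]
      nlinarith
    have h2s' : (2 : ℝ) ^ s * Λ ≤ 2 * (2 ^ ν : ℕ) := by exact_mod_cast h2s
    have hterm : ∀ i ∈ Finset.range s, r * f (2 ^ ν / 2 ^ i) ≤ r * W * √(2 ^ i : ℝ) := fun i hi => by
      have hi := Finset.mem_range.1 hi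
      have e : 2 ^ ν / 2 ^ i = 2 ^ (ν - i) := Nat.pow_div (by omega) (by norm_num)
      have := hf (2 ^ ν / 2 ^ i) (by rw [e]; exact Nat.one_le_two_pow) (Nat.div_le_self _ _)
      rw [mul_assoc]
      refine mul_le_mul_of_nonneg_left (this.trans (le_of_eq ?_)) (by positivity)
      congr 2
      rw [e, show 2 ^ ν = 2 ^ i * 2 ^ (ν - i) by rw [← pow_add]; congr 1; omega]
      push_cast
      rw [mul_div_cancel_right₀ _ (by positivity)]
    -- The geometric sum is comparable to √(2^s), which is at most √(2N/Λ); multiplied by Λ this is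
    -- of order √(NΛ).
    have h4 : Λ * √(2 ^ s : ℝ) ≤ 2 * √((2 ^ ν : ℕ) * Λ) := by
      refine abs_le_of_sq_le_sq' ?_ (by positivity) |>.2
      rw [mul_pow, mul_pow, Real.sq_sqrt (by positivity), Real.sq_sqrt (by positivity)]
      nlinarith
    calc ∑ i ∈ Finset.range s, r * f (2 ^ ν / 2 ^ i) ≤ ∑ i ∈ Finset.range s, r * W * √(2 ^ i : ℝ) :=
          Finset.sum_le_sum hterm
      _ ≤ r * W * (3 * √(2 ^ s)) := by
          rw [← Finset.mul_sum]
          exact mul_le_mul_of_nonneg_left (sum_sqrt_two_pow s) (by positivity)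
      _ = 9 * W * (Λ * √(2 ^ s)) := by rw [← hr]; push_cast; ring
      _ ≤ 9 * W * (2 * √((2 ^ ν : ℕ) * Λ)) := by gcongr
      _ = _ := by ring
  linarith

theorem bestQueries_le {ν Λ t₀ r : ℕ} (hΛ : 1 ≤ Λ) (ht₀ : min Λ (2 ^ ν) = t₀) (hr : 3 * Λ = r) :
    (bestQueries (2 ^ ν) r t₀ : ℝ) ≤ 120 * √((2 ^ ν : ℕ) * Λ) := by
  have h := sum_cost_le hΛ ht₀ hr (f := fun T => (searchQueries (2 ^ ν) T : ℝ)) (W := 6)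
    (by norm_num) fun T h1 h2 => by
      have := iters_add_one_le h1 h2
      simp only [searchQueries]
      push_cast at *
      linarith
  unfold bestQueries halvingQueries countdownQueries
  push_cast at *
  linarith

theorem bestTime_le {S m ν Λ t₀ r : ℕ} (hΛ : 1 ≤ Λ) (ht₀ : min Λ (2 ^ ν) = t₀) (hr : 3 * Λ = r) :
    (bestTime S m (2 ^ ν) r t₀ : ℝ) ≤ 60 * (4000 * m + S + 50) * √((2 ^ ν : ℕ) * Λ) + 31 := by
  have h := sum_cost_le hΛ ht₀ hr (f := fun T => (searchTime S m (2 ^ ν) T + 50 : ℝ))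
    (W := 3 * (4000 * m + S + 50)) (by positivity) fun T h1 h2 => by
      have := iters_add_one_le h1 h2
      simp only [searchTime]
      push_cast at *
      have h0 : (0 : ℝ) ≤ iters (2 ^ ν) T := by positivity
      calc (4000 * m * (iters (2 ^ ν) T + 1) + S + 50 : ℝ)
          ≤ (4000 * m + S + 50) * (iters (2 ^ ν) T + 1) := by
            have : 0 ≤ (S + 50 : ℝ) * iters (2 ^ ν) T := by positivity
            nlinarith
        _ ≤ (4000 * m + S + 50) * (3 * √(2 ^ ν / T)) := by gcongr
        _ = _ := by ring
  -- The overhead of 40 per halving is spread over its r ≥ 1 searches, which raises 10 to 50.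
  have e1 : (halvingTime S m (2 ^ ν) r (halvings (2 ^ ν) t₀) : ℝ) ≤
      ∑ i ∈ Finset.range (halvings (2 ^ ν) t₀), r * (searchTime S m (2 ^ ν) (2 ^ ν / 2 ^ i) + 50 : ℝ) := by
    unfold halvingTime
    push_cast
    refine Finset.sum_le_sum fun i _ => ?_
    have : (1 : ℝ) ≤ r := by exact_mod_cast (show 1 ≤ r by omega)
    nlinarith
  have e2 : (countdownTime S m (2 ^ ν) t₀ 0 : ℝ) ≤
      ∑ i ∈ Finset.range (t₀ - 0), (searchTime S m (2 ^ ν) (t₀ - i) + 50 : ℝ) := by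
    unfold countdownTime
    push_cast
    exact Finset.sum_le_sum fun i _ => by linarith
  unfold bestTime
  push_cast at *
  linarith

/-- The logarithm in the complexity. -/
def logTerm (n k : ℕ) (ε : ℝ) : ℝ := Real.log (k * Real.log n / ε)

theorem logTerm_eq {n k : ℕ} {ε : ℝ} (hn : 3 ≤ n) (hk : 1 ≤ k) (hε : 0 < ε) :
    logTerm n k ε = Real.log k + Real.log (Real.log n) - Real.log ε := by
  have hn' : (1 : ℝ) < n := by exact_mod_cast (show 1 < n by omega)
  have := Real.log_pos hn'
  have hk' : (0 : ℝ) < k := by exact_mod_cast hk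
  rw [logTerm, Real.log_div (by positivity) hε.ne', Real.log_mul hk'.ne' this.ne']

/-- From log 3 = 1 + log (3/e) ≥ 2 - e/3. It matters that the bound exceeds 1, so that log log n is
bounded away from 0. -/
theorem one_add_le_log {n : ℕ} (hn : 3 ≤ n) : (1.09 : ℝ) ≤ Real.log n := by
  have h3 : (3 : ℝ) ≤ n := by exact_mod_cast hn
  have he := Real.exp_one_lt_d9
  have hpos := Real.exp_pos 1
  have h1 : Real.log (3 / Real.exp 1) = Real.log 3 - 1 := by
    rw [Real.log_div (by norm_num) hpos.ne', Real.log_exp]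
  have h2 := Real.one_sub_inv_le_log_of_pos (show 0 < 3 / Real.exp 1 by positivity)
  rw [inv_div] at h2
  have h4 := Real.log_le_log (by norm_num) h3
  have : Real.exp 1 / 3 ≤ 0.91 := by linarith
  linarith

theorem clog_le_log {n : ℕ} (hn : 3 ≤ n) : (Nat.clog 2 n : ℝ) ≤ 3 * Real.log n := by
  have h1 := one_add_le_log hn
  have h2 : 2 ^ (Nat.clog 2 n - 1) < n := Nat.pow_pred_clog_lt_self (by norm_num) (by omega)
  have h3 : ((2 : ℝ) ^ (Nat.clog 2 n - 1)) ≤ n := by exact_mod_cast h2.le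
  have h4 := Real.log_le_log (by positivity) h3
  rw [Real.log_pow, Nat.cast_sub (Nat.clog_pos (by norm_num) (by omega))] at h4
  have := Real.log_two_gt_d9
  push_cast at h4
  have h5 : (0 : ℝ) ≤ Nat.clog 2 n - 1 := by
    have : (1 : ℝ) ≤ Nat.clog 2 n := by
      exact_mod_cast Nat.clog_pos (by norm_num) (show 1 < n by omega)
    linarith
  nlinarith

/-- The terms log k and -log ε are non-negative, and log log n ≥ 1 - 1/1.09 > 1/20. With this bound
additive constants are absorbed into the logarithm. -/
theorem logTerm_ge {n k : ℕ} {ε : ℝ} (hn : 3 ≤ n) (hk : 1 ≤ k) (hε : 0 < ε) (hε1 : ε < 1) :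
    1 / 20 ≤ logTerm n k ε := by
  rw [logTerm_eq hn hk hε]
  have h1 := one_add_le_log hn
  have h2 := Real.one_sub_inv_le_log_of_pos (show (0 : ℝ) < Real.log n by linarith)
  have h3 : (Real.log n)⁻¹ ≤ (1.09)⁻¹ := inv_anti₀ (by norm_num) h1
  have h4 := Real.log_neg hε hε1
  have h5 : 0 ≤ Real.log (k : ℝ) := Real.log_natCast_nonneg k
  norm_num at h3 ⊢
  linarith

/-- Multiplied by log 2, the summands of the budget are bounded by -log ε, log k, and log log n plus
a constant; the constants are absorbed by `logTerm_ge`. -/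
theorem budget_le {n k l κ N : ℕ} {ε : ℝ} (hn : 3 ≤ n) (hk : 1 ≤ k) (hε : 0 < ε) (hε1 : ε < 1)
    (hl : Nat.clog 2 n = l) (hκ : 2 ^ κ ≤ k) : (budget ε N κ l : ℝ) ≤ 4000 * logTerm n k ε := by
  have hL := logTerm_ge hn hk hε hε1
  rw [logTerm_eq hn hk hε] at hL ⊢
  have h1 := one_add_le_log hn
  have h2 := Real.log_two_gt_d9
  have h2' := Real.log_two_lt_d9
  have e1 : (leading ε N : ℝ) * Real.log 2 ≤ - Real.log ε := by
    have := Real.log_neg (by positivity) (two_pow_leading_mul_lt hε hε1 N)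
    rw [Real.log_mul hε.ne' (by positivity), Real.log_pow] at this
    linarith
  have e2 : (κ : ℝ) * Real.log 2 ≤ Real.log k := by
    have : ((2 : ℝ) ^ κ) ≤ k := by exact_mod_cast hκ
    rw [← Real.log_pow]
    exact Real.log_le_log (by positivity) this
  have hl2 : 2 ≤ l := by
    rw [← hl]
    exact (Nat.lt_clog_iff_pow_lt (by norm_num)).2 (by omega)
  have e3 : (Nat.clog 2 l : ℝ) * Real.log 2 ≤ Real.log (Real.log n) + 3 := by
    have h3 : 2 ^ (Nat.clog 2 l - 1) < l := Nat.pow_pred_clog_lt_self (by norm_num) (by omega)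
    have h4 : ((2 : ℝ) ^ (Nat.clog 2 l - 1)) ≤ 3 * Real.log n := by
      refine le_trans ?_ (clog_le_log hn)
      rw [hl]
      exact_mod_cast h3.le
    have h5 := Real.log_le_log (by positivity) h4
    rw [Real.log_pow, Nat.cast_sub (Nat.clog_pos (by norm_num) (by omega)),
      Real.log_mul (by norm_num) (by linarith)] at h5
    have h6 := Real.log_le_sub_one_of_pos (show (0 : ℝ) < 3 by norm_num)
    push_cast at h5
    linarith
  unfold budget
  push_cast
  have : ((leading ε N + κ + Nat.clog 2 l + 3 : ℝ)) * Real.log 2 ≤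
      (Real.log k + Real.log (Real.log n) - Real.log ε) + 6 := by linarith
  have h0 : (0 : ℝ) ≤ leading ε N + κ + Nat.clog 2 l + 3 := by positivity
  nlinarith

end

end HybridRAM

/-! ### Total cost and choice of the machine size -/

namespace HybridRAM

set_option linter.unusedSimpArgs false

noncomputable section

open scoped ENNReal

theorem blockLog_bounds {k : ℕ} (hk : 1 ≤ k) : 2 ^ blockLog k ≤ k ∧ k ≤ 2 * 2 ^ blockLog k := by
  unfold blockLog
  have h1 := Nat.le_pow_clog (b := 2) (by norm_num) k
  rcases Nat.eq_zero_or_pos (Nat.clog 2 k) with h | h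
  · rw [h] at h1 ⊢
    simp at h1 ⊢
    omega
  · refine ⟨(Nat.pow_lt_of_lt_clog (by omega)).le, ?_⟩
    obtain ⟨c, hc⟩ : ∃ c, Nat.clog 2 k = c + 1 := ⟨_, (Nat.sub_add_cancel h).symm⟩
    rw [hc, pow_succ] at h1
    rw [hc, Nat.add_sub_cancel]
    omega

section Cost

variable {E : Env} {w S n k b l κ ν t₀ r : ℕ}

/-- Since 2^l ≤ 2n and k ≤ 2 · 2^κ, one has k 2^ν ≤ 4n. This turns 2k block searches of cost √(2^ν
Λ) into √(nkΛ). -/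
theorem Sizes.sqrt_le (Z : Sizes E w S n k b l κ ν t₀ r) (hε : 0 < E.eps) (hε1 : E.eps < 1) :
    2 * k * √((2 ^ ν : ℕ) * (budget E.eps (2 ^ ν) κ l : ℝ)) ≤ 260 * √(n * k * logTerm n k E.eps) := by
  have hκ := blockLog_bounds Z.one_le
  rw [Z.hκ] at hκ
  have hL := logTerm_ge Z.three_le Z.one_le hε hε1
  have hΛ := budget_le (N := 2 ^ ν) Z.three_le Z.one_le hε hε1 Z.hl hκ.1
  have hl : 2 ^ l ≤ 2 * n := by
    have h1 : 2 ^ (l - 1) < n := by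
      rw [← Z.hl]
      exact Nat.pow_pred_clog_lt_self (by norm_num) (by have := Z.three_le; omega)
    have h2 : 1 ≤ l := by
      rw [← Z.hl]
      exact Nat.clog_pos (by norm_num) (by have := Z.three_le; omega)
    obtain ⟨i, rfl⟩ : ∃ i, l = i + 1 := ⟨_, (Nat.sub_add_cancel h2).symm⟩
    rw [Nat.add_sub_cancel] at h1
    rw [pow_succ]
    omega
  have hN : k * 2 ^ ν ≤ 4 * n := by
    have : 2 ^ κ * 2 ^ ν = 2 ^ l := by rw [← pow_add, Z.hκν]
    nlinarith [Nat.mul_le_mul_right (2 ^ ν) hκ.2]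
  have hN' : (k : ℝ) * (2 ^ ν : ℕ) ≤ 4 * n := by exact_mod_cast hN
  refine abs_le_of_sq_le_sq' ?_ (by positivity) |>.2
  have hkpos : (0 : ℝ) ≤ k := by positivity
  rw [mul_pow, mul_pow, mul_pow, Real.sq_sqrt (by positivity), Real.sq_sqrt (by positivity)]
  calc (2 ^ 2 * k ^ 2 * ((2 ^ ν : ℕ) * (budget E.eps (2 ^ ν) κ l : ℝ)) : ℝ)
      = 4 * k * ((k * (2 ^ ν : ℕ)) * (budget E.eps (2 ^ ν) κ l : ℝ)) := by ring
    _ ≤ 4 * k * ((4 * n) * (4000 * logTerm n k E.eps)) := by gcongr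
    -- The constant 260 is chosen because 64000 ≤ 260².
    _ = 64000 * (n * k * logTerm n k E.eps) := by ring
    _ ≤ _ := by
      have : 0 ≤ n * k * logTerm n k E.eps := by positivity
      nlinarith

theorem Sizes.add_le (Z : Sizes E w S n k b l κ ν t₀ r) : ((2 : ℝ) ^ κ + k) ≤ 2 * k := by
  have hκ := (blockLog_bounds Z.one_le).1
  rw [Z.hκ] at hκ
  have : (2 : ℝ) ^ κ ≤ k := by exact_mod_cast hκ
  linarith

theorem Sizes.queries_le (Z : Sizes E w S n k b l κ ν t₀ r) (hε : 0 < E.eps) (hε1 : E.eps < 1) :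
    (minimaQueries k κ ν t₀ r : ℝ) ≤ 31200 * √(n * k * logTerm n k E.eps) := by
  have h1 := bestQueries_le (by unfold budget; omega) Z.ht₀ Z.hr
  have h2 := Z.sqrt_le hε hε1
  unfold minimaQueries
  push_cast at *
  calc ((2 : ℝ) ^ κ + k) * bestQueries (2 ^ ν) r t₀
      ≤ (2 * k) * (120 * √(2 ^ ν * budget E.eps (2 ^ ν) κ l)) := by gcongr; exact Z.add_le
    _ ≤ _ := by linarith

/-- Key length and number of qubits are O(l) by `hb` and `hS`, so the time exceeds the query bound
by a factor O(l), and l ≤ 3 log n. -/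
theorem Sizes.time_le (Z : Sizes E w S n k b l κ ν t₀ r) (hε : 0 < E.eps) (hε1 : E.eps < 1) {d : ℕ}
    (hb : b ≤ d * l) (hS : S = (2 * d + 20) * l) :
    (minimaTime E S k b l κ ν t₀ r : ℝ) ≤ (780 * (60 * (4000 * (d + 2) + (2 * d + 20) + 50) + 600)) *
      (√(n * k * logTerm n k E.eps) * Real.log n) := by
  have h1 := bestTime_le (S := S) (m := l + b + 1) (by unfold budget; omega) Z.ht₀ Z.hr
  have h2 := Z.sqrt_le hε hε1
  have h3 := clog_le_log Z.three_le
  rw [Z.hl] at h3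
  have hl1 : 1 ≤ l := by
    rw [← Z.hl]
    exact Nat.clog_pos (by norm_num) (by have := Z.three_le; omega)
  have hκl : κ ≤ l := by have := Z.hκν; omega
  have hcl : Nat.clog 2 l ≤ l := Nat.clog_le_of_le_pow Nat.lt_two_pow_self.le
  set q := √((2 ^ ν : ℕ) * (budget E.eps (2 ^ ν) κ l : ℝ)) with hq
  have hΛ1 : 1 ≤ budget E.eps (2 ^ ν) κ l := by unfold budget; omega
  have hq1 : 1 ≤ q := by
    rw [hq, Real.one_le_sqrt]
    exact_mod_cast Nat.mul_le_mul (Nat.one_le_two_pow (n := ν)) hΛ1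
  -- The number of digits of ε that are read is at most the block size and at most the budget, so it
  -- is at most the geometric mean of the two.
  have hlead : (leading E.eps (2 ^ ν) : ℝ) ≤ q := by
    refine Real.le_sqrt_of_sq_le ?_
    rw [sq]
    exact_mod_cast Nat.mul_le_mul (leading_le E.eps (2 ^ ν)) (by unfold budget; omega)
  have hk1 : (1 : ℝ) ≤ k := by exact_mod_cast Z.one_le
  have hl1' : (1 : ℝ) ≤ l := by exact_mod_cast hl1
  have hκl' : (κ : ℝ) ≤ l := by exact_mod_cast hκl
  have hcl' : (Nat.clog 2 l : ℝ) ≤ l := by exact_mod_cast hcl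
  have hb' : (b : ℝ) ≤ d * l := by exact_mod_cast hb
  have hS' : (S : ℝ) = (2 * d + 20) * l := by rw [hS]; push_cast; ring
  have hlq : (l : ℝ) ≤ l * q := le_mul_of_one_le_right (by positivity) hq1
  have hlq1 : (1 : ℝ) ≤ l * q := hl1'.trans hlq
  have hqlq : q ≤ l * q := le_mul_of_one_le_left (by positivity) hl1'
  set D : ℝ := 60 * (4000 * (d + 2) + (2 * d + 20) + 50) with hD
  have hm : 60 * (4000 * ((l + b + 1 : ℕ) : ℝ) + S + 50) * q ≤ D * (l * q) := by
    have : 60 * (4000 * ((l + b + 1 : ℕ) : ℝ) + S + 50) ≤ D * l := by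
      rw [hS', hD]; push_cast; nlinarith
    rw [← mul_assoc]
    exact mul_le_mul_of_nonneg_right this (by positivity)
  have hrefresh : (refreshTime S (l + b + 1) (2 ^ ν) r t₀ κ + 60 : ℝ) ≤ (D + 204) * (l * q) := by
    unfold refreshTime
    push_cast at *
    linarith
  have hinit : (16 * (l + κ + Nat.clog 2 l) + 26 * leading E.eps (2 ^ ν) + 300 : ℝ) ≤
      374 * (l * q) := by linarith
  have hsum := Z.add_le
  have hD0 : 0 ≤ D := by rw [hD]; positivity
  calc (minimaTime E S k b l κ ν t₀ r : ℝ)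
      = (16 * (l + κ + Nat.clog 2 l) + 26 * leading E.eps (2 ^ ν) + 300) +
        (2 ^ κ + k) * (refreshTime S (l + b + 1) (2 ^ ν) r t₀ κ + 60) := by
        unfold minimaTime; push_cast; ring
    _ ≤ 374 * (l * q) + (2 * k) * ((D + 204) * (l * q)) := by gcongr
    _ ≤ (D + 600) * l * (2 * k * q) := by nlinarith
    _ ≤ (D + 600) * (3 * Real.log n) * (260 * √(n * k * logTerm n k E.eps)) := by gcongr
    _ = _ := by ring

end Cost

/-- One number (2d + 20)l serves as word length and as number of qubits: with b ≤ dl it covers the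
two registers of l + b + 1 qubits and words for all keys and thresholds. -/
theorem sizes_of_array {A : Type*} [LinearOrder A] {d n k b : ℕ} (a : Fin n → A)
    (enc : A ↪o Fin (2 ^ b)) (ε : ℝ) (hn : 3 ≤ n) (hk : 1 ≤ k) (hkn : k ≤ n)
    (hb : b ≤ d * Nat.clog 2 n) :
    ∃ l κ ν t₀ r, Sizes (arrayEnv a enc ε) ((2 * d + 20) * Nat.clog 2 n)
      ((2 * d + 20) * Nat.clog 2 n) n k b l κ ν t₀ r := by
  set l := Nat.clog 2 n with hl
  have hl1 : 1 ≤ l := Nat.clog_pos (by norm_num) (by omega)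
  have hcl : Nat.clog 2 l ≤ l := Nat.clog_le_of_le_pow Nat.lt_two_pow_self.le
  have hκl : blockLog k ≤ l :=
    (Nat.sub_le _ _).trans (Nat.clog_mono_right 2 hkn)
  have hlead := leading_le ε (2 ^ (l - blockLog k))
  have hN : 2 ^ (l - blockLog k) ≤ 2 ^ l := Nat.pow_le_pow_right (by norm_num) (by omega)
  have hll : l < 2 ^ l := Nat.lt_two_pow_self
  have e : (2 * d + 20) * l = 2 * (d * l) + 20 * l := by ring
  refine ⟨l, blockLog k, l - blockLog k, _, _, hl.symm, rfl, by omega, rfl, rfl, hn, hk, hkn, ?_, ?_,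
    Nat.lt_two_pow_self, ?_, rfl, rfl, fun i => ?_, fun i hi => ?_⟩
  · exact Nat.pow_le_pow_right (by norm_num) (by omega)
  -- The repetition count is at most 3(2^l + 2l + 3), which is below 32 · 2^l and so fits into a
  -- word.
  · have h5 : 2 ^ (l + 5) ≤ 2 ^ ((2 * d + 20) * l) := Nat.pow_le_pow_right (by norm_num) (by omega)
    have h6 : 2 ^ (l + 5) = 32 * 2 ^ l := by ring
    simp only [budget, arrayEnv]
    omega
  · omega
  · simp only [arrayEnv]
    split_ifs
    exacts [(enc _).2, Nat.two_pow_pos b]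
  · simp only [arrayEnv]
    rw [dif_neg (by omega)]

end

end HybridRAM

/-! ### Assembly of the bounds -/

open HybridRAM in
theorem corollary3p2 (d : ℕ) :
    ∃ (c : ℕ) (C : ℝ) (P : Program), d + 2 ≤ c ∧
      ∀ (n k b : ℕ) (ε : ℝ) (A : Type*) [LinearOrder A] (a : Fin n → A) (enc : A ↪o Fin (2 ^ b)),
        3 ≤ n → 1 ≤ k → k ≤ n → b ≤ d * Nat.clog 2 n → 0 < ε → ε < 1 →
        ∃ fuel : ℕ,
          let w := c * Nat.clog 2 n
          let S := c * Nat.clog 2 n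
          let μ := P.exec (arrayEnv a enc ε) fuel (initState w S n k b)
          (∀ o ∈ μ.support, ∃ s : State w S, o = some s ∧
            (s.queries : ℝ) ≤ C * √(n * k * Real.log (k * Real.log n / ε)) ∧
            (s.time : ℝ) ≤ C * (√(n * k * Real.log (k * Real.log n / ε)) * Real.log n)) ∧
          ENNReal.ofReal (1 - ε) ≤
            μ.toOuterMeasure {o | ∃ s : State w S, o = some s ∧ s.Correct a k} := by
  classical
  -- The constant is that of the time bound; it also exceeds 31200, the constant of the query bound.
  refine ⟨2 * d + 20, 780 * (60 * (4000 * (d + 2) + (2 * d + 20) + 50) + 600), minimaP, by omega, ?_⟩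
  intro n k b ε A _ a enc hn hk hkn hb hε hε1
  refine ⟨fuelFor ((2 * d + 20) * Nat.clog 2 n), ?_⟩
  obtain ⟨l, κ, ν, t₀, r, Z⟩ := sizes_of_array a enc ε hn hk hkn hb
  obtain ⟨st, hst, spec⟩ := spec_minimaP Z
  have hrep := rep_init (E := arrayEnv a enc ε) (w := (2 * d + 20) * Nat.clog 2 n)
    (S := (2 * d + 20) * Nat.clog 2 n) n k b
  refine ⟨fun o ho => ?_, ?_⟩
  -- The specification has value at most 1, hence finite, so every outcome in the support is a
  -- described final state.
  · obtain ⟨s, rfl, μ, -, hs⟩ := spec.support (ne_top_of_le_ne_top (by simp) (min_le_left _ _)) hrep o ho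
    have hq := hs.queries
    have ht := hs.time
    rw [(hst μ).2.1] at hq
    have ht' := (hst μ).2.2
    refine ⟨s, rfl, ?_, ?_⟩
    · refine le_trans (Nat.cast_le.2 (show s.queries ≤ minimaQueries k κ ν t₀ r by omega)) ?_
      refine (Z.queries_le hε hε1).trans (mul_le_mul_of_nonneg_right ?_ (Real.sqrt_nonneg _))
      have : (0 : ℝ) ≤ d := by positivity
      linarith
    · refine le_trans (Nat.cast_le.2 (show s.time ≤ minimaTime (arrayEnv a enc ε)
        ((2 * d + 20) * Nat.clog 2 n) k b l κ ν t₀ r by omega)) ?_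
      exact Z.time_le hε hε1 (Z.hl ▸ hb) (by rw [Z.hl])
  · refine le_trans ?_ ((spec.prob (fun μ => ?_) hrep).trans (MeasureTheory.measure_mono ?_))
    · rw [ENNReal.ofReal_sub _ hε.le, ENNReal.ofReal_one]
      -- The failure bound needs k ≤ 2 · 2^κ, so that the number of block minima is at most 3 · 2^κ
      -- ≤ 4 · 2^κ.
      refine tsub_le_tsub_left ((min_le_right _ _).trans (failure_le hε Z.hκν ?_ Z.ht₀ Z.hr)) _
      rw [← Z.hκ]
      exact (blockLog_bounds hk).2
    · split_ifs
      exacts [.inl rfl, .inr le_rfl]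
    · rintro o ⟨s, rfl, μ, -, h0, hs⟩
      refine ⟨s, rfl, ?_⟩
      have hgood : Good (arrayEnv a enc ε) n l b κ ν k μ := by
        by_contra h
        rw [if_neg h] at h0
        exact one_ne_zero h0
      refine hgood.correct (by rw [← Z.hl]; exact Nat.le_pow_clog (by norm_num) n)
        ((Nat.pow_le_pow_right (by norm_num) (by omega)).trans Z.big) hkn fun i hi => ?_
      rw [hs.mem i hi, (hst μ).1]
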